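/- **Complete Bernstein functions.** Let $\mathcal{CBF}^{\flat}$ be the class of complete Bernstein functions with zero linear drift, that is, of functions $f:[0,\infty)\to[0,\infty)$ of the form $$f(z)=a+\int_0^\infty (1-e^{-zx})\,\pi(x)\,dx,\qquad z\ge 0,$$ where $a\ge 0$, $\int_0^\infty \min(1,x)\,\pi(x)\,dx<\infty$, and $\pi:(0,\infty)\to[0,\infty)$ is completely monotone, i.e. smooth with $(-1)^n\pi^{(n)}\ge 0$ for all $n\ge 0$ ($\pi=0$ is allowed). **Voiculescu transform.** For a probability measure $\mu$ on $\mathbb R$ let $G_\mu(z)=\int_{\mathbb R}\frac{\mu(dx)}{z-x}$ and $F_\mu=1/G_\mu$ on $\mathbb H=\{\operatorname{Im} z>0\}$. For some $\alpha,M>0$ there is an analytic right inverse $F_\mu^{-1}$ of $F_\mu$ on $\Gamma_{\alpha,M}=\{z:|\operatorname{Re}z|<\alpha\operatorname{Im}z,\ \operatorname{Im}z>M\}$ with values in $\mathbb H$ and with $F_\mu^{-1}(z)/z\to1$ as $z\to\infty$ in $\Gamma_{\alpha,M}$. The Voiculescu transform is $\phi_\mu(z)=F_\mu^{-1}(z)-z$.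 For $z>0$, $\phi_\mu(-z)$ denotes the value at $-z$ of the analytic continuation of $\phi_\mu$ from the truncated cone to (a neighbourhood of) $\mathbb H\cup(-\infty,0)$, when this continuation exists, and $\phi_\mu(-0)=\lim_{z\downarrow0}\phi_\mu(-z)$ is its value at $z=0$. **Free convolution and free regular measures.** $\mu_1\boxplus\mu_2$ is the probability measure with $\phi_{\mu_1\boxplus\mu_2}=\phi_{\mu_1}+\phi_{\mu_2}$ on some $\Gamma_{\alpha,M}$, and $\mu^{\boxplus t}$ is the probability measure (if it exists) with $\phi_{\mu^{\boxplus t}}=t\phi_\mu$ on some $\Gamma_{\alpha,M}$. A probability measure $\mu$ is freely infinitely divisible if for every $n\ge1$ it is the $n$-fold free convolution $\mu_n\boxplus\dots\boxplus\mu_n$ of some probability measure $\mu_n$. It is *free regular* if it is freely infinitely divisible and $\mu^{\boxplus t}$ is supported on $[0,\infty)$ for every $t>0$. **Semigroups.** A free regular semigroup is a family $(\mu_t)_{t\ge0}$ of free regular measures with $\mu_s\boxplus\mu_t=\mu_{s+t}$. A $\mathrm{BO}^\flat$ semigroup is a family $(\nu_t)_{t\ge0}$ of sub-probability measures on $[0,\infty)$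 with $\nu_s*\nu_t=\nu_{s+t}$ such that each $\nu_t$ satisfies $\int e^{-zy}\,\nu_t(dy)=e^{-f_t(z)}$, $z>0$, for some $f_t\in\mathcal{CBF}^\flat$. **Proposition 1.** 1. A probability measure $\mu$ on $\mathbb R$ is free regular if and only if $z\in[0,\infty)\mapsto\phi_\mu(-z)$ exists and belongs to $\mathcal{CBF}^\flat$. 2. For every $f\in\mathcal{CBF}^\flat$ there is exactly one free regular measure $\mu$ with $\phi_\mu(-z)=f(z)$ for all $z\ge0$. 3. The relation $\phi_{\mu_t}(-z)=t f(z)$ for all $t,z\ge0$ is a bijection between free regular semigroups $(\mu_t)_{t\ge0}$ and functions $f\in\mathcal{CBF}^\flat$. 4. The relation $\int_{[0,\infty)}e^{-zy}\,\nu_t(dy)=e^{-tf(z)}$ for all $t\ge0$, $z>0$ is a bijection between $\mathrm{BO}^\flat$ semigroups $(\nu_t)_{t\ge0}$ and functions $f\in\mathcal{CBF}^\flat$. -/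

import Mathlib

open MeasureTheory Filter Topology Set
open scoped NNReal ENNReal

namespace FreeRegular

noncomputable section

/-! ### Bernstein functions, as functions `[0,∞) → [0,∞)` -/

/-- `f` is a Bernstein function with killing rate `a`, linear drift `b` and Lévy measure `m`:
`f z = a + b z + ∫_{(0,∞)} (1 - e^{-zx}) m(dx)`, where `m` is concentrated on `(0,∞)` and
`∫ min(1,x) m(dx) < ∞`. -/
structure IsBernsteinTriplet (f : ℝ≥0 → ℝ≥0) (a b : ℝ≥0) (m : Measure ℝ) : Prop where
  concentrated : m (Iic 0) = 0
  levy : ∫⁻ x, ENNReal.ofReal (min 1 x) ∂m < ∞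
  repr : ∀ z : ℝ≥0, (f z : ℝ) = a + b * z + ∫ x, (1 - Real.exp (-(z * x))) ∂m

/-- `g` is completely monotone on `(0,∞)`: it is smooth there and `(-1)^n g^{(n)} ≥ 0`. The zero
function is completely monotone. -/
def IsCompletelyMonotone (g : ℝ → ℝ) : Prop :=
  ContDiffOn ℝ (⊤ : ℕ∞) g (Ioi 0) ∧ ∀ n : ℕ, ∀ x : ℝ, 0 < x → 0 ≤ (-1) ^ n * iteratedDeriv n g x

/-- `f` is a complete Bernstein function with linear drift coefficient `b`: its Lévy measure has a
completely monotone density with respect to Lebesgue measure on `(0,∞)`. -/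
def IsCompleteBernsteinWithDrift (f : ℝ≥0 → ℝ≥0) (b : ℝ≥0) : Prop :=
  ∃ (a : ℝ≥0) (g : ℝ → ℝ), IsCompletelyMonotone g ∧
    IsBernsteinTriplet f a b
      ((volume.restrict (Ioi (0 : ℝ))).withDensity fun x => ENNReal.ofReal (g x))

/-- The class of complete Bernstein functions. -/
def CBF : Set (ℝ≥0 → ℝ≥0) := {f | ∃ b, IsCompleteBernsteinWithDrift f b}

/-- The class of complete Bernstein functions with zero linear drift. -/
def CBFflat : Set (ℝ≥0 → ℝ≥0) := {f | IsCompleteBernsteinWithDrift f 0}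

/-! ### Classical convolution semigroups in the Bondesson class -/

/-- `f` is the Laplace exponent of the measure `ν` on `[0,∞)`. -/
def HasLaplaceExponent (ν : Measure ℝ≥0) (f : ℝ≥0 → ℝ≥0) : Prop :=
  ∀ z : ℝ≥0, 0 < z → ∫ y : ℝ≥0, Real.exp (-((z : ℝ) * y)) ∂ν = Real.exp (-(f z : ℝ))

/-- A sub-probability measure on `[0,∞)` in the Bondesson class whose Laplace exponent has zero
linear drift. -/
def IsBondessonFlat (ν : Measure ℝ≥0) : Prop :=
  ν univ ≤ 1 ∧ ∃ f ∈ CBFflat, HasLaplaceExponent ν f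

/-- A convolution semigroup `(ν_t)_{t ≥ 0}` of driftless Bondesson class measures. -/
def IsBondessonFlatSemigroup (ν : ℝ≥0 → Measure ℝ≥0) : Prop :=
  (∀ t, IsBondessonFlat (ν t)) ∧ ∀ s t, ν (s + t) = (ν s).conv (ν t)

/-! ### The Voiculescu transform and free additive convolution -/

/-- The Cauchy transform `G_μ(z) = ∫ μ(dx) / (z - x)`. -/
def cauchyTransform (μ : ProbabilityMeasure ℝ) (z : ℂ) : ℂ :=
  ∫ x : ℝ, 1 / (z - (x : ℂ)) ∂(μ : Measure ℝ)

/-- The reciprocal Cauchy transform `F_μ = 1 / G_μ`. -/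
def reciprocalCauchy (μ : ProbabilityMeasure ℝ) (z : ℂ) : ℂ := 1 / cauchyTransform μ z

/-- The truncated cone `Γ_{α,M}`. -/
def truncatedCone (α M : ℝ) : Set ℂ := {z | |z.re| < α * z.im ∧ M < z.im}

/-- `φ` represents the Voiculescu transform of `μ`: on some truncated cone `Γ_{α,M}` the function
`z ↦ z + φ z` is analytic, takes values in the upper half-plane, is a right inverse of `F_μ`, and is
asymptotic to `z` at infinity. The last clause selects the inverse branch (`F_μ` need not be
injective on the upper half-plane) and so determines `φ` on the cone. Nothing is said about the
values of `φ` outside the cone. -/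
def IsVoiculescuTransform (μ : ProbabilityMeasure ℝ) (φ : ℂ → ℂ) : Prop :=
  ∃ α M : ℝ, 0 < α ∧ 0 < M ∧
    AnalyticOnNhd ℂ φ (truncatedCone α M) ∧
    (∀ z ∈ truncatedCone α M, 0 < (z + φ z).im ∧ reciprocalCauchy μ (z + φ z) = z) ∧
    Tendsto (fun z => (z + φ z) / z) (Bornology.cobounded ℂ ⊓ 𝓟 (truncatedCone α M)) (𝓝 1)

/-- `χ = μ₁ ⊞ μ₂`: `φ_χ = φ_{μ₁} + φ_{μ₂}` on some truncated cone. -/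
def IsFreeConv (μ₁ μ₂ χ : ProbabilityMeasure ℝ) : Prop :=
  ∃ φ₁ φ₂ : ℂ → ℂ, IsVoiculescuTransform μ₁ φ₁ ∧ IsVoiculescuTransform μ₂ φ₂ ∧
    IsVoiculescuTransform χ fun z => φ₁ z + φ₂ z

/-- `IsFreeConvIter ν n χ`: the measure `χ` is the `n`-fold free convolution of `ν` with itself. -/
def IsFreeConvIter (ν : ProbabilityMeasure ℝ) : ℕ → ProbabilityMeasure ℝ → Prop
  | 0, χ => χ = ⟨Measure.dirac 0, inferInstance⟩
  | 1, χ => χ = ν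
  | n + 2, χ => ∃ ρ, IsFreeConvIter ν (n + 1) ρ ∧ IsFreeConv ρ ν χ

/-- Free infinite divisibility. -/
def IsFreelyInfDiv (μ : ProbabilityMeasure ℝ) : Prop :=
  ∀ n : ℕ, 1 ≤ n → ∃ ν : ProbabilityMeasure ℝ, IsFreeConvIter ν n μ

/-- `χ = μ^{⊞ t}`, the measure with `φ_χ = t φ_μ` on some truncated cone. -/
def IsFreeConvPower (μ : ProbabilityMeasure ℝ) (t : ℝ) (χ : ProbabilityMeasure ℝ) : Prop :=
  ∃ φ : ℂ → ℂ, IsVoiculescuTransform μ φ ∧ IsVoiculescuTransform χ fun z => (t : ℂ) * φ z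

/-- Free regular measures: freely infinitely divisible, and `μ^{⊞ t}` is supported on `[0,∞)` for
all `t > 0`. -/
def IsFreeRegular (μ : ProbabilityMeasure ℝ) : Prop :=
  IsFreelyInfDiv μ ∧
    ∀ t : ℝ, 0 < t → ∃ χ, IsFreeConvPower μ t χ ∧ (χ : Measure ℝ) (Iio 0) = 0

/-- A free convolution semigroup `(μ_t)_{t ≥ 0}` of free regular measures. -/
def IsFreeRegularSemigroup (μ : ℝ≥0 → ProbabilityMeasure ℝ) : Prop :=
  (∀ t, IsFreeRegular (μ t)) ∧ ∀ s t, IsFreeConv (μ s) (μ t) (μ (s + t))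

/-- `f` is the function `z ∈ [0,∞) ↦ φ_μ(-z)`: the Voiculescu transform continues analytically from
a truncated cone to the upper half-plane and across the negative half-axis, the continuation at `-z`
is `f z` for `z > 0`, and `f 0` is the limit of `φ_μ(-z)` as `z ↓ 0`. (The set of continuation is
connected, so the continuation is unique.) -/
def IsVoiculescuOnNegAxis (μ : ProbabilityMeasure ℝ) (f : ℝ≥0 → ℝ≥0) : Prop :=
  (∃ φ : ℂ → ℂ, IsVoiculescuTransform μ φ ∧
    AnalyticOnNhd ℂ φ {z | 0 < z.im ∨ (z.im = 0 ∧ z.re < 0)} ∧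
    ∀ z : ℝ≥0, 0 < z → φ (-((z : ℝ) : ℂ)) = ((f z : ℝ) : ℂ)) ∧
  Tendsto f (𝓝[>] 0) (𝓝 (f 0))

end

end FreeRegular

open FreeRegular

/-!
The functions of the class `CBF♭` are exactly the functions
`w ↦ ∫_{[0,1]} w / ((1 - y) + y w) ρ(dy)` with a finite measure `ρ` on `[0,1]`, `ρ {0} = 0`. The
mass of `ρ` at `0` is the linear drift, and compactness of the interval of parameters makes this
family of transforms, drift included, stable under pointwise limits. Such a transform `f` is
characterized by being holomorphic on the slit plane, nonnegative on `(0,∞)` and such that `f w`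
lies in the cone generated by `1` and `w`; this follows from the Poisson representation of the
function `q ↦ f (q²) / q`, whose real part is nonnegative on the right half-plane.

If `μ` is free regular, `F_t` is the reciprocal Cauchy transform of `μ^{⊞t}` and `φ = φ_μ`, then
`F_t (z + t φ z) = z`, and, since `μ^{⊞t}` lives on `[0,∞)`, the function
`w ↦ t⁻¹ (-F_t (-w) - w)` has such a representation. As `t → 0` it converges to `w ↦ φ (-w)`,
and `F_μ⁻¹ z / z → 1` excludes a drift. Conversely, the inverse `Ψ` of `v ↦ v - f v` is the limit
of the Picard iterates `v ↦ w + f v`; along them `w / Ψ w` stays in the family, and its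
representing measure, moved to `[0,∞)`, is a probability measure with Voiculescu transform
`z ↦ f (-z)`. It is unique since the right inverse of `F_μ` asymptotic to the identity is
determined by `μ`, and the Cauchy transform determines the measure.

On the classical side, `exp (-f)` is a limit of compound Poisson Laplace transforms, and
compactness of `[0,∞]` provides the limiting measure. A semigroup yields an additive function of
`t ∈ [0,∞)` with values in `[0,∞)` at each `z`, and such a function is linear.
-/

namespace FreeRegular

open Complex (slitPlane)
open UpperHalfPlane (upperHalfPlaneSet isOpen_upperHalfPlaneSet)
open unitInterval

/-! ### Measures on compact spaces -/

section CompactSpace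

variable {X : Type*} [TopologicalSpace X] [CompactSpace X] [MeasurableSpace X]
  [OpensMeasurableSpace X]

lemma integrable_of_continuous {E : Type*} [NormedAddCommGroup E] {ρ : Measure X}
    [IsFiniteMeasure ρ] {f : X → E} (hf : Continuous f) : Integrable f ρ :=
  hf.integrable_of_hasCompactSupport (HasCompactSupport.of_compactSpace f)

lemma aestronglyMeasurable_of_continuous {E : Type*} [NormedAddCommGroup E] {ρ : Measure X}
    [IsFiniteMeasure ρ] {f : X → E} (hf : Continuous f) : AEStronglyMeasurable f ρ :=
  (integrable_of_continuous hf).aestronglyMeasurable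

lemma differentiableOn_integral_of_hasDerivAt (ρ : Measure X) [IsFiniteMeasure ρ] {U : Set ℂ}
    (hU : IsOpen U) {F F' : ℂ → X → ℂ} (hF : ∀ z ∈ U, Continuous (F z))
    (hF' : ContinuousOn (fun p : ℂ × X ↦ F' p.1 p.2) (U ×ˢ univ))
    (hderiv : ∀ z ∈ U, ∀ x, HasDerivAt (fun z ↦ F z x) (F' z x) z) :
    DifferentiableOn ℂ (fun z ↦ ∫ x, F z x ∂ρ) U := by
  intro z₀ hz₀
  obtain ⟨ε, hε, hball⟩ := Metric.nhds_basis_closedBall.mem_iff.1 (hU.mem_nhds hz₀)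
  obtain ⟨C, hC⟩ := ((isCompact_closedBall z₀ ε).prod isCompact_univ).exists_bound_of_continuousOn
    (hF'.mono (prod_mono_left hball))
  have hderiv_integral := hasDerivAt_integral_of_dominated_loc_of_deriv_le (μ := ρ)
    (bound := fun _ ↦ C) (Metric.ball_mem_nhds z₀ hε)
    (by filter_upwards [hU.mem_nhds hz₀] with z hz
        using aestronglyMeasurable_of_continuous (hF z hz))
    (integrable_of_continuous (hF z₀ hz₀))
    (aestronglyMeasurable_of_continuous <| hF'.comp_continuous (f := fun x ↦ (z₀, x))
      (by fun_prop) fun x ↦ ⟨hz₀, mem_univ x⟩)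
    (.of_forall fun x z hz ↦ hC (z, x) ⟨Metric.ball_subset_closedBall hz, mem_univ x⟩)
    (integrable_const C)
    (.of_forall fun x z hz ↦ hderiv z (hball (Metric.ball_subset_closedBall hz)) x)
  exact hderiv_integral.2.differentiableAt.differentiableWithinAt

lemma norm_integral_sub_integral_le_dist_mul (ρ : Measure X) [IsFiniteMeasure ρ]
    (f g : C(X, ℂ)) :
    ‖∫ x, f x ∂ρ - ∫ x, g x ∂ρ‖ ≤ dist f g * ρ.real univ := by
  rw [← integral_sub (integrable_of_continuous f.continuous)
    (integrable_of_continuous g.continuous)]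
  refine norm_integral_le_of_norm_le_const (.of_forall fun x ↦ ?_)
  rw [← dist_eq_norm]
  exact ContinuousMap.dist_apply_le_dist (f := f) (g := g) x

end CompactSpace

lemma exists_tendsto_hyperfilter_integral {X : Type*} [TopologicalSpace X] [CompactSpace X]
    [T2Space X] [MeasurableSpace X] [BorelSpace X] {ρ : ℕ → Measure X}
    [∀ n, IsFiniteMeasure (ρ n)] {C : ℝ} (hC : ∀ n, (ρ n).real univ ≤ C) :
    ∃ ρ' : Measure X, IsFiniteMeasure ρ' ∧ ∀ f : C(X, ℂ),
      Tendsto (fun n ↦ ∫ x, f x ∂(ρ n)) (hyperfilter ℕ) (𝓝 (∫ x, f x ∂ρ')) := by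
  let r (n : ℕ) : FiniteMeasure X := ⟨ρ n, inferInstance⟩
  have hr (n : ℕ) : (r n).mass ≤ C.toNNReal :=
    NNReal.coe_le_coe.1 ((hC n).trans (Real.le_coe_toNNReal C))
  obtain ⟨ρ', -, hlim⟩ :=
    (isCompact_setOfPred_finiteMeasure_le_of_compactSpace X C.toNNReal).ultrafilter_le_nhds
      ((hyperfilter ℕ).map r) (le_principal_iff.2 (Filter.mem_map.2 (univ_mem' hr)))
  have hlim : Tendsto r (hyperfilter ℕ) (𝓝 ρ') := hlim
  rw [FiniteMeasure.tendsto_iff_forall_integral_rclike_tendsto ℂ] at hlim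
  exact ⟨ρ', inferInstance, fun f ↦ hlim (BoundedContinuousFunction.mkOfCompact f)⟩

/-! ### The transform of a measure on the unit interval -/

/-- The kernel `w / (1 - y + y w)` of the integral representation of complete Bernstein functions.
The parameter `y` is `1 / (1 + s)` in the classical kernel `w (1 + s) / (w + s)`; this makes the
parameter space compact, with the drift at `y = 0` and the killing rate at `y = 1`. -/
noncomputable def cbfKernel (w : ℂ) (y : I) : ℂ := w / (1 - (y : ℝ) + (y : ℝ) * w)

/-- The complete Bernstein function represented by the measure `ρ`, on the slit plane. -/
noncomputable def cbfTransform (ρ : Measure I) (w : ℂ) : ℂ := ∫ y, cbfKernel w y ∂ρ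

/-- The holomorphic functions on the slit plane with `f w` in the convex cone generated by `1` and
`w`, that is, those which do not leave the sector between the positive half-axis and `w`. They are
the complete Bernstein functions, drift included. -/
structure IsSectorPreserving (f : ℂ → ℂ) : Prop where
  differentiableOn : DifferentiableOn ℂ f slitPlane
  mem_cone : ∀ w ∈ slitPlane, ∃ a b : ℝ, 0 ≤ a ∧ 0 ≤ b ∧ f w = a + b * w

lemma add_mul_mem_slitPlane {a b : ℝ} {w : ℂ} (ha : 0 ≤ a) (hb : 0 ≤ b) (hab : 0 < a + b)
    (hw : w ∈ slitPlane) : (a : ℂ) + b * w ∈ slitPlane := by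
  simp only [Complex.mem_slitPlane_iff, Complex.add_re, Complex.add_im, Complex.re_ofReal_mul,
    Complex.im_ofReal_mul, Complex.ofReal_re, Complex.ofReal_im, zero_add] at hw ⊢
  rcases hb.eq_or_lt with rfl | hb
  · exact .inl (by simpa using hab)
  · exact hw.imp (fun hw ↦ by positivity) (fun hw ↦ by positivity)

lemma cbfDenom_mem_slitPlane {w : ℂ} (hw : w ∈ slitPlane) (y : I) :
    (1 : ℂ) - (y : ℝ) + (y : ℝ) * w ∈ slitPlane := by
  simpa using add_mul_mem_slitPlane (sub_nonneg.2 y.2.2) y.2.1 (by simp) hw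

lemma cbfDenom_ne_zero {w : ℂ} (hw : w ∈ slitPlane) (y : I) :
    (1 : ℂ) - (y : ℝ) + (y : ℝ) * w ≠ 0 :=
  Complex.slitPlane_ne_zero (cbfDenom_mem_slitPlane hw y)

lemma cbfDenom_pos {x : ℝ} (hx : 0 < x) (y : I) : 0 < 1 - (y : ℝ) + y * x := by
  rcases y.2.2.eq_or_lt with h | h
  · simpa [h] using hx
  · linarith [mul_nonneg y.2.1 hx.le]

lemma continuous_cbfKernel_uncurry :
    Continuous fun p : slitPlane × I ↦ cbfKernel p.1 p.2 := by
  unfold cbfKernel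
  exact Continuous.div (by fun_prop) (by fun_prop) fun p ↦ cbfDenom_ne_zero p.1.2 p.2

/-- The kernel as a continuous map into `C(I, ℂ)`, which makes the dependence on `w` uniform
in `y`. -/
noncomputable def cbfKernelMap : C(slitPlane, C(I, ℂ)) :=
  ContinuousMap.curry ⟨fun p : slitPlane × I ↦ cbfKernel p.1 p.2, continuous_cbfKernel_uncurry⟩

lemma continuous_cbfKernel {w : ℂ} (hw : w ∈ slitPlane) : Continuous (cbfKernel w) :=
  (cbfKernelMap ⟨w, hw⟩).continuous

lemma hasDerivAt_cbfKernel {w : ℂ} (hw : w ∈ slitPlane) (y : I) :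
    HasDerivAt (fun w ↦ cbfKernel w y)
      ((1 - (y : ℝ)) / (1 - (y : ℝ) + (y : ℝ) * w) ^ 2) w := by
  have hdenom : HasDerivAt (fun w : ℂ ↦ (1 : ℂ) - (y : ℝ) + (y : ℝ) * w) ((y : ℝ) : ℂ) w := by
    simpa using ((hasDerivAt_id w).const_mul ((y : ℝ) : ℂ)).const_add ((1 : ℂ) - (y : ℝ))
  refine ((hasDerivAt_id w).div hdenom (cbfDenom_ne_zero hw y)).congr_deriv ?_
  simp only [id]
  ring

lemma cbfKernel_eq_add_mul {w : ℂ} (hw : w ∈ slitPlane) (y : I) :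
    cbfKernel w y =
      (((y : ℝ) * Complex.normSq w / Complex.normSq (1 - (y : ℝ) + (y : ℝ) * w) : ℝ) : ℂ) +
      (((1 - (y : ℝ)) / Complex.normSq (1 - (y : ℝ) + (y : ℝ) * w) : ℝ) : ℂ) * w := by
  set D : ℂ := 1 - (y : ℝ) + (y : ℝ) * w with hD
  have hconj_ne : (starRingEnd ℂ) D ≠ 0 := by simpa using cbfDenom_ne_zero hw y
  have hkernel : cbfKernel w y = (starRingEnd ℂ) D * w / Complex.normSq D := by
    rw [Complex.normSq_eq_conj_mul_self, mul_div_mul_left _ _ hconj_ne, cbfKernel]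
  have hconj : (starRingEnd ℂ) D = 1 - (y : ℝ) + (y : ℝ) * (starRingEnd ℂ) w := by
    simp [hD, Complex.conj_ofReal]
  rw [hkernel, hconj]
  push_cast
  rw [Complex.normSq_eq_conj_mul_self (z := w)]
  ring

lemma cbfTransform_ofReal (ρ : Measure I) (x : ℝ) :
    cbfTransform ρ x = ((∫ y : I, x / (1 - (y : ℝ) + y * x) ∂ρ : ℝ) : ℂ) := by
  rw [← integral_complex_ofReal]
  simp only [cbfTransform, cbfKernel]
  push_cast
  rfl

@[simp] lemma cbfTransform_one (ρ : Measure I) : cbfTransform ρ 1 = ρ.real univ := by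
  simp [cbfTransform, cbfKernel]

section FiniteMeasure

variable (ρ : Measure I) [IsFiniteMeasure ρ]

lemma integrable_cbfKernel {w : ℂ} (hw : w ∈ slitPlane) : Integrable (cbfKernel w) ρ :=
  integrable_of_continuous (continuous_cbfKernel hw)

lemma differentiableOn_cbfTransform : DifferentiableOn ℂ (cbfTransform ρ) slitPlane := by
  refine differentiableOn_integral_of_hasDerivAt ρ Complex.isOpen_slitPlane
    (fun w hw ↦ continuous_cbfKernel hw) ?_ fun w hw y ↦ hasDerivAt_cbfKernel hw y
  exact ContinuousOn.div (by fun_prop) (by fun_prop) fun p hp ↦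
    pow_ne_zero _ (cbfDenom_ne_zero hp.1 p.2)

lemma isSectorPreserving_cbfTransform : IsSectorPreserving (cbfTransform ρ) := by
  refine ⟨differentiableOn_cbfTransform ρ, fun w hw ↦ ?_⟩
  have hpos (y : I) : 0 < Complex.normSq (1 - (y : ℝ) + (y : ℝ) * w) :=
    Complex.normSq_pos.2 (cbfDenom_ne_zero hw y)
  have hdiv {f : I → ℝ} (hf : Continuous f) :
      Integrable (fun y : I ↦ f y / Complex.normSq (1 - (y : ℝ) + (y : ℝ) * w)) ρ :=
    integrable_of_continuous
      (hf.div (Complex.continuous_normSq.comp (by fun_prop)) fun y ↦ (hpos y).ne')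
  refine ⟨∫ y : I, (y : ℝ) * Complex.normSq w / Complex.normSq (1 - (y : ℝ) + (y : ℝ) * w) ∂ρ,
    ∫ y : I, (1 - (y : ℝ)) / Complex.normSq (1 - (y : ℝ) + (y : ℝ) * w) ∂ρ,
    integral_nonneg fun y ↦ ?_, integral_nonneg fun y ↦ ?_, ?_⟩
  · exact div_nonneg (mul_nonneg y.2.1 (Complex.normSq_nonneg _)) (hpos y).le
  · exact div_nonneg (sub_nonneg.2 y.2.2) (hpos y).le
  · simp_rw [cbfTransform, cbfKernel_eq_add_mul hw]
    rw [← integral_complex_ofReal, ← integral_complex_ofReal, ← integral_mul_const]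
    exact integral_add (hdiv (by fun_prop)).ofReal ((hdiv (by fun_prop)).ofReal.mul_const w)

end FiniteMeasure

section Limits

variable {ρ : ℕ → Measure I} [∀ n, IsFiniteMeasure (ρ n)] {C : ℝ}

lemma exists_tendsto_hyperfilter_cbfTransform (hC : ∀ n, (ρ n).real univ ≤ C) :
    ∃ ρ' : Measure I, IsFiniteMeasure ρ' ∧ ∀ (v : ℕ → ℂ) (w : ℂ), (∀ n, v n ∈ slitPlane) →
      w ∈ slitPlane → Tendsto v atTop (𝓝 w) →
      Tendsto (fun n ↦ cbfTransform (ρ n) (v n)) (hyperfilter ℕ) (𝓝 (cbfTransform ρ' w)) := by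
  obtain ⟨ρ', hρ', hlim⟩ := exists_tendsto_hyperfilter_integral hC
  refine ⟨ρ', hρ', fun v w hv hw hvw ↦ ?_⟩
  have hmap : Tendsto (fun n ↦ cbfKernelMap ⟨v n, hv n⟩) atTop (𝓝 (cbfKernelMap ⟨w, hw⟩)) :=
    (cbfKernelMap.continuous.tendsto _).comp (tendsto_subtype_rng.2 hvw)
  have hdiff : Tendsto (fun n ↦ cbfTransform (ρ n) (v n) - ∫ y, cbfKernelMap ⟨w, hw⟩ y ∂(ρ n))
      atTop (𝓝 0) := by
    refine squeeze_zero_norm (a := fun n ↦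
      dist (cbfKernelMap ⟨v n, hv n⟩) (cbfKernelMap ⟨w, hw⟩) * C) (fun n ↦ ?_)
      (by simpa using (tendsto_iff_dist_tendsto_zero.1 hmap).mul_const C)
    exact (norm_integral_sub_integral_le_dist_mul (ρ n) (cbfKernelMap ⟨v n, hv n⟩) _).trans
      (mul_le_mul_of_nonneg_left (hC n) dist_nonneg)
  simpa only [sub_add_cancel, zero_add, cbfTransform] using!
    (hdiff.mono_left Nat.hyperfilter_le_atTop).add (hlim (cbfKernelMap ⟨w, hw⟩))

lemma exists_cbfTransform_eq_of_tendsto (hC : ∀ n, (ρ n).real univ ≤ C) :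
    ∃ ρ' : Measure I, IsFiniteMeasure ρ' ∧ ∀ (v : ℕ → ℂ) (w L : ℂ), (∀ n, v n ∈ slitPlane) →
      w ∈ slitPlane → Tendsto v atTop (𝓝 w) →
      Tendsto (fun n ↦ cbfTransform (ρ n) (v n)) atTop (𝓝 L) → cbfTransform ρ' w = L := by
  obtain ⟨ρ', hρ', hlim⟩ := exists_tendsto_hyperfilter_cbfTransform hC
  exact ⟨ρ', hρ', fun v w L hv hw hvw hL ↦
    tendsto_nhds_unique (hlim v w hv hw hvw) (hL.mono_left Nat.hyperfilter_le_atTop)⟩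

end Limits

/-! ### The integral representation of sector-preserving functions -/

lemma eqOn_slitPlane_of_eqOn_pos {f g : ℂ → ℂ} (hf : DifferentiableOn ℂ f slitPlane)
    (hg : DifferentiableOn ℂ g slitPlane) (h : ∀ x : ℝ, 0 < x → f x = g x) :
    EqOn f g slitPlane := by
  have hconn : IsPreconnected slitPlane :=
    (Complex.starConvex_one_slitPlane.isPathConnected Complex.one_mem_slitPlane).isConnected
      |>.isPreconnected
  refine (hf.analyticOnNhd Complex.isOpen_slitPlane).eqOn_of_preconnected_of_frequently_eq
    (hg.analyticOnNhd Complex.isOpen_slitPlane) hconn Complex.one_mem_slitPlane ?_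
  have hpos : ∀ᶠ x : ℝ in 𝓝[≠] 1, f x = g x :=
    nhdsWithin_le_nhds ((lt_mem_nhds one_pos).mono h)
  refine Tendsto.frequently (f := fun x : ℝ ↦ (x : ℂ)) ?_ hpos.frequently
  exact tendsto_nhdsWithin_iff.2
    ⟨tendsto_nhdsWithin_of_tendsto_nhds (Complex.continuous_ofReal.tendsto' 1 1 Complex.ofReal_one),
    eventually_nhdsWithin_of_forall fun x hx ↦ by simpa using hx⟩

lemma sq_mem_slitPlane {q : ℂ} (hq : 0 < q.re) : q ^ 2 ∈ slitPlane := by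
  rw [Complex.mem_slitPlane_iff]
  rcases eq_or_ne q.im 0 with him | him
  · left
    simp only [sq, Complex.mul_re, him, mul_zero, sub_zero]
    positivity
  · right
    simp only [sq, Complex.mul_im]
    rw [mul_comm q.im, ← two_mul]
    exact mul_ne_zero two_ne_zero (mul_ne_zero hq.ne' him)

/-- The Cayley transform of the unit disc onto the right half-plane. -/
noncomputable def discToHalfPlane (u : ℂ) : ℂ := (1 + u) / (1 - u)

lemma one_sub_ne_zero_of_norm_lt_one {u : ℂ} (hu : ‖u‖ < 1) : 1 - u ≠ 0 :=
  sub_ne_zero.2 fun h ↦ by simp [← h] at hu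

lemma discToHalfPlane_re_pos {u : ℂ} (hu : ‖u‖ < 1) : 0 < (discToHalfPlane u).re := by
  have hdenom : 0 < Complex.normSq (1 - u) :=
    Complex.normSq_pos.2 (one_sub_ne_zero_of_norm_lt_one hu)
  have hnorm : Complex.normSq u < 1 := by
    rw [Complex.normSq_eq_norm_sq]
    exact pow_lt_one₀ (norm_nonneg u) hu two_ne_zero
  rw [discToHalfPlane, Complex.div_re, ← add_div]
  refine div_pos ?_ hdenom
  rw [Complex.normSq_apply] at hnorm
  simp only [Complex.add_re, Complex.one_re, Complex.sub_re, Complex.add_im, Complex.one_im,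
    Complex.sub_im, zero_add, zero_sub]
  linarith

lemma discToHalfPlane_ne_zero {u : ℂ} (hu : ‖u‖ < 1) : discToHalfPlane u ≠ 0 := fun h ↦ by
  simpa [h] using discToHalfPlane_re_pos hu

lemma differentiableOn_discToHalfPlane :
    DifferentiableOn ℂ discToHalfPlane (Metric.ball 0 1) := by
  refine DifferentiableOn.div (by fun_prop) (by fun_prop) fun u hu ↦ ?_
  exact one_sub_ne_zero_of_norm_lt_one (mem_ball_zero_iff.1 hu)

lemma discToHalfPlane_ofReal (u : ℝ) :
    discToHalfPlane u = (((1 + u) / (1 - u) : ℝ) : ℂ) := by simp [discToHalfPlane]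

/-- The function `q ↦ f (q ^ 2) / q` on the right half-plane, transported to the unit disc. It has
nonnegative real part when `f` is sector-preserving. -/
noncomputable def discFun (f : ℂ → ℂ) (u : ℂ) : ℂ :=
  f (discToHalfPlane u ^ 2) / discToHalfPlane u

namespace IsSectorPreserving

variable {f : ℂ → ℂ}

lemma differentiableOn_discFun (hf : IsSectorPreserving f) :
    DifferentiableOn ℂ (discFun f) (Metric.ball 0 1) := by
  refine DifferentiableOn.div (hf.differentiableOn.comp
    (differentiableOn_discToHalfPlane.pow 2) fun u hu ↦ ?_) differentiableOn_discToHalfPlane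
    fun u hu ↦ discToHalfPlane_ne_zero (mem_ball_zero_iff.1 hu)
  exact sq_mem_slitPlane (discToHalfPlane_re_pos (mem_ball_zero_iff.1 hu))

lemma discFun_re_nonneg (hf : IsSectorPreserving f) {u : ℂ} (hu : ‖u‖ < 1) :
    0 ≤ (discFun f u).re := by
  have hre := discToHalfPlane_re_pos hu
  have hne := discToHalfPlane_ne_zero hu
  obtain ⟨a, b, ha, hb, hab⟩ := hf.mem_cone _ (sq_mem_slitPlane hre)
  have hdisc : discFun f u = a * (discToHalfPlane u)⁻¹ + b * discToHalfPlane u := by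
    rw [discFun, hab]
    field_simp
  rw [hdisc, Complex.add_re, Complex.re_ofReal_mul, Complex.re_ofReal_mul, Complex.inv_re]
  have := Complex.normSq_nonneg (discToHalfPlane u)
  positivity

lemma apply_ofReal_eq (hf : IsSectorPreserving f) {x : ℝ} (hx : 0 < x) : f x = (f x).re := by
  obtain ⟨a, b, -, -, hab⟩ := hf.mem_cone x (by simpa)
  rw [hab]
  norm_cast

end IsSectorPreserving

/-- The point of the unit interval below `exp (i θ)`, after rescaling the diameter `[-1, 1]` of the
unit disc so that `1` goes to `0` and `-1` to `1`. -/
noncomputable def angleToUnit (θ : ℝ) : I :=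
  ⟨(1 - Real.cos θ) / 2, by constructor <;> linarith [Real.cos_le_one θ, Real.neg_one_le_cos θ]⟩

lemma continuous_angleToUnit : Continuous angleToUnit := by
  unfold angleToUnit
  fun_prop

lemma poissonKernel_circleMap {R : ℝ} (hR : 0 < R) (u θ : ℝ) :
    poissonKernel 0 (R * u : ℝ) (circleMap 0 R θ) =
      (1 - u ^ 2) / ((1 - u) ^ 2 + 4 * u * angleToUnit θ) := by
  have hcircle : ‖circleMap 0 R θ‖ ^ 2 = R ^ 2 := by simp
  have hpoint : ‖((R * u : ℝ) : ℂ)‖ ^ 2 = R ^ 2 * u ^ 2 := by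
    rw [Complex.norm_real, Real.norm_eq_abs, sq_abs, mul_pow]
  have hdist : ‖circleMap 0 R θ - ((R * u : ℝ) : ℂ)‖ ^ 2 =
      R ^ 2 * ((1 - u) ^ 2 + 4 * u * angleToUnit θ) := by
    rw [← Complex.normSq_eq_norm_sq, Complex.normSq_apply]
    simp only [circleMap, angleToUnit, zero_add, Complex.sub_re, Complex.sub_im,
      Complex.re_ofReal_mul, Complex.im_ofReal_mul, Complex.exp_ofReal_mul_I_re,
      Complex.exp_ofReal_mul_I_im, Complex.ofReal_re, Complex.ofReal_im]
    linear_combination R ^ 2 * Real.sin_sq_add_cos_sq θ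
  rw [poissonKernel_def, sub_zero, sub_zero, hcircle, hpoint, hdist,
    show R ^ 2 - R ^ 2 * u ^ 2 = R ^ 2 * (1 - u ^ 2) by ring]
  exact mul_div_mul_left _ _ (by positivity)

lemma exists_integral_angleToUnit_eq {g : ℝ → ℝ} (hg : Continuous g) (hg0 : ∀ θ, 0 ≤ g θ) :
    ∃ ρ : Measure I, IsFiniteMeasure ρ ∧ ∀ k : I → ℝ, Measurable k →
      ∫ y, k y ∂ρ = ∫ θ in Ioc 0 (2 * Real.pi), g θ * k (angleToUnit θ) := by
  have hint : Integrable g (volume.restrict (Ioc 0 (2 * Real.pi))) :=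
    hg.integrableOn_Icc.mono_set Ioc_subset_Icc_self
  have := isFiniteMeasure_withDensity_ofReal hint.2
  refine ⟨((volume.restrict (Ioc 0 (2 * Real.pi))).withDensity fun θ ↦ ENNReal.ofReal (g θ)).map
    angleToUnit, inferInstance, fun k hk ↦ ?_⟩
  rw [integral_map continuous_angleToUnit.aemeasurable hk.aestronglyMeasurable,
    integral_withDensity_eq_integral_toReal_smul (by fun_prop) (by simp)]
  simp_rw [ENNReal.toReal_ofReal (hg0 _), smul_eq_mul]

open InnerProductSpace in
lemma exists_integral_eq_of_harmonicOnNhd {h : ℂ → ℝ} {R : ℝ} (hR : 0 < R)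
    (hh : HarmonicOnNhd h (Metric.closedBall 0 R)) (hh0 : ∀ z ∈ Metric.sphere 0 R, 0 ≤ h z) :
    ∃ ρ : Measure I, IsFiniteMeasure ρ ∧ ∀ u : ℝ, |u| < 1 →
      h (R * u : ℝ) = ∫ y : I, (1 - u ^ 2) / ((1 - u) ^ 2 + 4 * u * y) ∂ρ := by
  have hcircle (θ : ℝ) : circleMap 0 R θ ∈ Metric.sphere (0 : ℂ) R :=
    circleMap_mem_sphere 0 hR.le θ
  have hcont : Continuous fun θ ↦ (2 * Real.pi)⁻¹ * h (circleMap 0 R θ) :=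
    continuous_const.mul (ContinuousOn.comp_continuous
      (fun z hz ↦ (hh z hz).1.continuousAt.continuousWithinAt)
      (continuous_circleMap 0 R) fun θ ↦ Metric.sphere_subset_closedBall (hcircle θ))
  obtain ⟨ρ, hρ, hint⟩ := exists_integral_angleToUnit_eq hcont
    fun θ ↦ mul_nonneg (by positivity) (hh0 _ (hcircle θ))
  refine ⟨ρ, hρ, fun u hu ↦ ?_⟩
  have hball : ((R * u : ℝ) : ℂ) ∈ Metric.ball 0 R := by
    rw [mem_ball_zero_iff, Complex.norm_real, Real.norm_eq_abs, abs_mul, abs_of_pos hR]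
    exact mul_lt_of_lt_one_right hR hu
  rw [hint _ (by fun_prop), ← hh.circleAverage_poissonKernel_smul hball, Real.circleAverage_def,
    intervalIntegral.integral_of_le (by positivity), smul_eq_mul, ← integral_const_mul]
  refine integral_congr_ae (.of_forall fun θ ↦ ?_)
  simp only [Pi.smul_apply', smul_eq_mul, poissonKernel_circleMap hR]
  ring

lemma mul_poisson_eq_cbfKernel {s : ℝ} (hs : 0 < s) (y : I) {u : ℝ}
    (hu : u = (s - 1) / (s + 1)) :
    s * ((1 - u ^ 2) / ((1 - u) ^ 2 + 4 * u * y)) = s ^ 2 / (1 - y + y * s ^ 2) := by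
  have := cbfDenom_pos (x := s ^ 2) (by positivity) y
  have hmul : (1 - u) ^ 2 + 4 * u * y = 4 / (s + 1) ^ 2 * (1 - y + y * s ^ 2) := by
    rw [hu]
    field_simp
    ring
  rw [hmul, hu]
  field_simp
  ring

lemma abs_sub_one_div_add_one_lt_one {s : ℝ} (hs : 0 < s) : |(s - 1) / (s + 1)| < 1 := by
  rw [abs_div, abs_of_pos (by positivity : 0 < s + 1), div_lt_one (by positivity), abs_lt]
  constructor <;> linarith

lemma discToHalfPlane_sub_one_div_add_one {s : ℝ} (hs : 0 < s) :
    discToHalfPlane ((s - 1) / (s + 1) : ℝ) = s := by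
  rw [discToHalfPlane_ofReal]
  congr 1
  field_simp
  ring

namespace IsSectorPreserving

variable {f : ℂ → ℂ}

lemma exists_cbfTransform_sq_eq (hf : IsSectorPreserving f) {R : ℝ} (hR : R ∈ Ioo (0 : ℝ) 1) :
    ∃ ρ : Measure I, IsFiniteMeasure ρ ∧ ∀ s : ℝ, 0 < s →
      cbfTransform ρ (s ^ 2 : ℝ) =
        ((s * (discFun f (R * ((s - 1) / (s + 1)) : ℝ)).re : ℝ) : ℂ) := by
  have hharm : InnerProductSpace.HarmonicOnNhd (fun u ↦ (discFun f u).re)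
      (Metric.closedBall 0 R) := fun u hu ↦
    (hf.differentiableOn_discFun.analyticAt (Metric.isOpen_ball.mem_nhds
      (Metric.closedBall_subset_ball hR.2 hu))).harmonicAt_re
  obtain ⟨ρ, hρ, hpoisson⟩ := exists_integral_eq_of_harmonicOnNhd hR.1 hharm
    fun u hu ↦ hf.discFun_re_nonneg (by simpa [mem_sphere_zero_iff_norm.1 hu] using hR.2)
  refine ⟨ρ, hρ, fun s hs ↦ ?_⟩
  rw [cbfTransform_ofReal, hpoisson _ (abs_sub_one_div_add_one_lt_one hs), ← integral_const_mul]
  simp_rw [mul_poisson_eq_cbfKernel hs _ rfl]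

lemma tendsto_mul_discFun_re (hf : IsSectorPreserving f) {R : ℕ → ℝ}
    (hR : Tendsto R atTop (𝓝 1)) {s : ℝ} (hs : 0 < s) :
    Tendsto (fun n ↦ ((s * (discFun f (R n * ((s - 1) / (s + 1)) : ℝ)).re : ℝ) : ℂ)) atTop
      (𝓝 (f (s ^ 2 : ℝ))) := by
  set u : ℝ := (s - 1) / (s + 1)
  have hcont : ContinuousAt (discFun f) u :=
    (hf.differentiableOn_discFun.differentiableAt (Metric.isOpen_ball.mem_nhds
      (by simpa using abs_sub_one_div_add_one_lt_one hs))).continuousAt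
  have harg : Tendsto (fun n ↦ ((R n * u : ℝ) : ℂ)) atTop (𝓝 u) := by
    simpa only [one_mul] using! (Complex.continuous_ofReal.tendsto _).comp (hR.mul_const u)
  have hlim : ((s * (discFun f u).re : ℝ) : ℂ) = f (s ^ 2 : ℝ) := by
    rw [discFun, discToHalfPlane_sub_one_div_add_one hs, ← Complex.ofReal_pow,
      hf.apply_ofReal_eq (by positivity), ← Complex.ofReal_div, Complex.ofReal_re,
      mul_div_cancel₀ _ hs.ne']
  rw [← hlim]
  exact (Complex.continuous_ofReal.tendsto _).comp
    (((Complex.continuous_re.tendsto _).comp (hcont.tendsto.comp harg)).const_mul s)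

theorem exists_eqOn_cbfTransform (hf : IsSectorPreserving f) :
    ∃ ρ : Measure I, IsFiniteMeasure ρ ∧ EqOn f (cbfTransform ρ) slitPlane := by
  obtain ⟨R, -, hR, hR_lim⟩ := exists_seq_strictMono_tendsto' one_pos (α := ℝ)
  choose ρ hρ hρ_eq using fun n ↦ hf.exists_cbfTransform_sq_eq (hR n)
  have hmass (n : ℕ) : (ρ n).real univ ≤ (f 1).re := by
    have := hρ_eq n 1 one_pos
    simp only [one_pow, Complex.ofReal_one, cbfTransform_one, sub_self, zero_div, mul_zero,
      one_mul, Complex.ofReal_inj] at this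
    simp [this, discFun, discToHalfPlane]
  obtain ⟨ρ', hρ', hlim⟩ := exists_cbfTransform_eq_of_tendsto hmass
  refine ⟨ρ', hρ', eqOn_slitPlane_of_eqOn_pos hf.differentiableOn
    (differentiableOn_cbfTransform ρ') fun x hx ↦ ?_⟩
  have hmem : (x : ℂ) ∈ slitPlane := by simpa
  refine (hlim (fun _ ↦ x) x (f x) (fun _ ↦ hmem) hmem tendsto_const_nhds ?_).symm
  have hsqrt := Real.sqrt_pos.2 hx
  simpa only [← hρ_eq _ _ hsqrt, Real.sq_sqrt hx.le] using hf.tendsto_mul_discFun_re hR_lim hsqrt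

end IsSectorPreserving

/-! ### Analyticity of the Cauchy transform -/

lemma integrable_inv_sub_pow {μ : Measure ℝ} [IsFiniteMeasure μ] {z : ℂ} {ε : ℝ} (hε : 0 < ε)
    (h : ∀ᵐ x : ℝ ∂μ, ε ≤ ‖z - x‖) (n : ℕ) : Integrable (fun x : ℝ ↦ (z - x)⁻¹ ^ n) μ := by
  refine .of_bound (Measurable.aestronglyMeasurable (by fun_prop)) (ε⁻¹ ^ n)
    (h.mono fun x hx ↦ ?_)
  rw [norm_pow, norm_inv]
  gcongr

lemma hasDerivAt_inv_sub_pow (a : ℂ) {z : ℂ} (hz : z - a ≠ 0) (n : ℕ) :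
    HasDerivAt (fun w ↦ (w - a)⁻¹ ^ n) (-n * (z - a)⁻¹ ^ (n + 1)) z := by
  refine ((((hasDerivAt_id z).sub_const a).inv hz).pow n).congr_deriv ?_
  rcases n with _ | n
  · simp
  · simp only [id, Pi.inv_apply, Nat.add_sub_cancel, neg_div, one_div, ← inv_pow]
    ring

lemma hasDerivAt_integral_inv_sub_pow {μ : Measure ℝ} [IsFiniteMeasure μ] {z : ℂ} {ε : ℝ}
    (hε : 0 < ε) (h : ∀ᵐ x : ℝ ∂μ, ε ≤ ‖z - x‖) (n : ℕ) :
    HasDerivAt (fun w : ℂ ↦ ∫ x : ℝ, (w - x)⁻¹ ^ n ∂μ)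
      (-n * ∫ x : ℝ, (z - x)⁻¹ ^ (n + 1) ∂μ) z := by
  have hle {w : ℂ} (hw : w ∈ Metric.ball z (ε / 2)) {x : ℝ} (hx : ε ≤ ‖z - x‖) :
      ε / 2 ≤ ‖w - x‖ := by
    have := norm_sub_le_norm_sub_add_norm_sub z w x
    rw [mem_ball_iff_norm'] at hw
    linarith
  rw [← integral_const_mul]
  refine (hasDerivAt_integral_of_dominated_loc_of_deriv_le
    (F := fun (w : ℂ) (x : ℝ) ↦ (w - x)⁻¹ ^ n)
    (F' := fun (w : ℂ) (x : ℝ) ↦ -n * (w - x)⁻¹ ^ (n + 1))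
    (bound := fun _ ↦ n * (ε / 2)⁻¹ ^ (n + 1)) (Metric.ball_mem_nhds z (half_pos hε))
    (.of_forall fun w ↦ Measurable.aestronglyMeasurable (by fun_prop))
    (integrable_inv_sub_pow hε h n) (Measurable.aestronglyMeasurable (by fun_prop))
    ?_ (integrable_const _) ?_).2
  · filter_upwards [h] with x hx w hw
    rw [norm_mul, norm_neg, norm_pow, Complex.norm_natCast, norm_inv]
    gcongr
    exact hle hw hx
  · filter_upwards [h] with x hx w hw
    exact hasDerivAt_inv_sub_pow _ (norm_pos_iff.1 ((half_pos hε).trans_le (hle hw hx))) n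

lemma abs_im_le_norm_sub_ofReal (z : ℂ) (x : ℝ) : |z.im| ≤ ‖z - x‖ := by
  simpa using Complex.abs_im_le_norm (z - x)

lemma sub_ofReal_ne_zero {z : ℂ} (hz : z.im ≠ 0) (x : ℝ) : z - x ≠ 0 :=
  norm_pos_iff.1 ((abs_pos.2 hz).trans_le (abs_im_le_norm_sub_ofReal z x))

lemma exists_forall_le_norm_sub_ofReal {z : ℂ} (hz : -z ∈ slitPlane) :
    ∃ ε > 0, ∀ x : ℝ, 0 ≤ x → ε ≤ ‖z - x‖ := by
  obtain ⟨ε, hε, hball⟩ := Metric.isOpen_iff.1 Complex.isOpen_slitPlane _ hz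
  refine ⟨ε, hε, fun x hx ↦ not_lt.1 fun h ↦ ?_⟩
  have : -(x : ℂ) ∈ slitPlane := hball (by simpa [dist_comm, dist_eq_norm z] using h)
  simp only [Complex.neg_ofReal_mem_slitPlane] at this
  exact hx.not_gt this

lemma cauchyTransform_eq_integral_inv_sub_pow (μ : ProbabilityMeasure ℝ) :
    cauchyTransform μ = fun z : ℂ ↦ ∫ x : ℝ, (z - x)⁻¹ ^ 1 ∂(μ : Measure ℝ) := by
  ext z
  simp only [cauchyTransform, one_div, pow_one]

lemma differentiableAt_cauchyTransform {μ : ProbabilityMeasure ℝ} {z : ℂ} {ε : ℝ} (hε : 0 < ε)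
    (h : ∀ᵐ x : ℝ ∂(μ : Measure ℝ), ε ≤ ‖z - x‖) : DifferentiableAt ℂ (cauchyTransform μ) z := by
  rw [cauchyTransform_eq_integral_inv_sub_pow]
  exact (hasDerivAt_integral_inv_sub_pow hε h 1).differentiableAt

lemma analyticOnNhd_cauchyTransform (μ : ProbabilityMeasure ℝ) :
    AnalyticOnNhd ℂ (cauchyTransform μ) upperHalfPlaneSet :=
  DifferentiableOn.analyticOnNhd (fun z hz ↦
    (differentiableAt_cauchyTransform (abs_pos.2 (ne_of_gt hz)) (.of_forall
      (abs_im_le_norm_sub_ofReal z))).differentiableWithinAt) isOpen_upperHalfPlaneSet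

/-! ### Measures on the positive half-axis -/

lemma integral_pos_of_ae_pos {α : Type*} [MeasurableSpace α] {μ : Measure α} [NeZero μ]
    {g : α → ℝ} (hg : Integrable g μ) (h : ∀ᵐ x ∂μ, 0 < g x) : 0 < ∫ x, g x ∂μ := by
  rw [integral_pos_iff_support_of_nonneg_ae (h.mono fun x hx ↦ hx.le) hg, pos_iff_ne_zero]
  exact frequently_ae_mem_iff.1 (h.mono fun x hx ↦ hx.ne').frequently

lemma norm_integral_sq_le {α E : Type*} [MeasurableSpace α] {μ : Measure α}
    [IsProbabilityMeasure μ] [NormedAddCommGroup E] [NormedSpace ℝ E] [CompleteSpace E]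
    {g : α → E} (hg : Integrable g μ) (hg2 : Integrable (fun x ↦ ‖g x‖ ^ 2) μ) :
    ‖∫ x, g x ∂μ‖ ^ 2 ≤ ∫ x, ‖g x‖ ^ 2 ∂μ :=
  (convexOn_univ_norm.pow (fun _ _ ↦ norm_nonneg _) 2).map_integral_le
    (by fun_prop) isClosed_univ (by simp) hg hg2

lemma inv_eq_norm_inv_sq_mul_conj (a : ℂ) : a⁻¹ = (‖a⁻¹‖ ^ 2 : ℝ) * (starRingEnd ℂ) a := by
  rw [norm_inv, inv_pow, ← Complex.normSq_eq_norm_sq, mul_comm, ← Complex.inv_def]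

lemma exists_cauchyTransform_eq_mul_conj_sub {χ : ProbabilityMeasure ℝ}
    (hχ : ∀ᵐ x ∂(χ : Measure ℝ), 0 ≤ x) {z : ℂ} {ε : ℝ} (hε : 0 < ε)
    (h : ∀ᵐ x : ℝ ∂(χ : Measure ℝ), ε ≤ ‖z - x‖) :
    ∃ A B : ℝ, 0 < A ∧ 0 ≤ B ∧ Complex.normSq (cauchyTransform χ z) ≤ A ∧
      cauchyTransform χ z = A * (starRingEnd ℂ) z - B := by
  have hint : Integrable (fun x : ℝ ↦ (z - x)⁻¹) (χ : Measure ℝ) := by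
    simpa using integrable_inv_sub_pow hε h 1
  have hA : Integrable (fun x : ℝ ↦ ‖(z - x)⁻¹‖ ^ 2) (χ : Measure ℝ) := by
    simpa using (integrable_inv_sub_pow hε h 2).norm
  have hsplit (x : ℝ) : (z - x)⁻¹ = (‖(z - x)⁻¹‖ ^ 2 : ℝ) * (starRingEnd ℂ) z -
      (x * ‖(z - x)⁻¹‖ ^ 2 : ℝ) := by
    conv_lhs => rw [inv_eq_norm_inv_sq_mul_conj]
    rw [map_sub, Complex.conj_ofReal, Complex.ofReal_mul]
    ring
  have hB : Integrable (fun x : ℝ ↦ x * ‖(z - x)⁻¹‖ ^ 2) (χ : Measure ℝ) := by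
    refine ((hA.ofReal.mul_const ((starRingEnd ℂ) z)).sub hint).re.congr (.of_forall fun x ↦ ?_)
    change (((‖(z - x)⁻¹‖ ^ 2 : ℝ) : ℂ) * (starRingEnd ℂ) z - (z - x)⁻¹).re = _
    nth_rewrite 2 [hsplit x]
    rw [sub_sub_cancel, Complex.ofReal_re]
  have hG : cauchyTransform χ z = ∫ x : ℝ, (z - x)⁻¹ ∂(χ : Measure ℝ) := by
    simp only [cauchyTransform, one_div]
  refine ⟨∫ x : ℝ, ‖(z - x)⁻¹‖ ^ 2 ∂(χ : Measure ℝ),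
    ∫ x : ℝ, x * ‖(z - x)⁻¹‖ ^ 2 ∂(χ : Measure ℝ),
    ?_, ?_, ?_, ?_⟩
  · refine integral_pos_of_ae_pos hA (h.mono fun x hx ↦ ?_)
    have := hε.trans_le hx
    rw [norm_inv]
    positivity
  · exact integral_nonneg_of_ae (hχ.mono fun x hx ↦ by positivity)
  · rw [hG, Complex.normSq_eq_norm_sq]
    exact norm_integral_sq_le hint hA
  · rw [hG, ← integral_complex_ofReal, ← integral_complex_ofReal, ← integral_mul_const,
      ← integral_sub (hA.ofReal.mul_const _) hB.ofReal]
    exact integral_congr_ae (.of_forall hsplit)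

theorem isSectorPreserving_neg_reciprocalCauchy_neg_sub {χ : ProbabilityMeasure ℝ}
    (h : (χ : Measure ℝ) (Iio 0) = 0) :
    IsSectorPreserving fun w ↦ -reciprocalCauchy χ (-w) - w := by
  have hχ : ∀ᵐ x ∂(χ : Measure ℝ), 0 ≤ x := by simpa [ae_iff] using! h
  have hbound (w : ℂ) (hw : w ∈ slitPlane) :
      ∃ ε > 0, ∀ᵐ x : ℝ ∂(χ : Measure ℝ), ε ≤ ‖-w - x‖ := by
    obtain ⟨ε, hε, hle⟩ := exists_forall_le_norm_sub_ofReal (z := -w) (by simpa)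
    exact ⟨ε, hε, hχ.mono hle⟩
  have hG (w : ℂ) (hw : w ∈ slitPlane) : ∃ A B : ℝ, 0 < A ∧ 0 ≤ B ∧
      Complex.normSq (cauchyTransform χ (-w)) ≤ A ∧
      cauchyTransform χ (-w) = -(B + A * (starRingEnd ℂ) w) := by
    obtain ⟨ε, hε, hle⟩ := hbound w hw
    obtain ⟨A, B, hA, hB, hAB, h⟩ := exists_cauchyTransform_eq_mul_conj_sub hχ hε hle
    exact ⟨A, B, hA, hB, hAB, by rw [h, map_neg]; ring⟩
  have hne (w : ℂ) (hw : w ∈ slitPlane) : cauchyTransform χ (-w) ≠ 0 := by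
    obtain ⟨A, B, hA, hB, -, h⟩ := hG w hw
    rw [h, neg_ne_zero]
    refine Complex.slitPlane_ne_zero (add_mul_mem_slitPlane hB hA.le (by positivity) ?_)
    simpa [Complex.mem_slitPlane_iff] using hw
  refine ⟨fun w hw ↦ ?_, fun w hw ↦ ?_⟩
  · obtain ⟨ε, hε, hle⟩ := hbound w hw
    have hd : DifferentiableAt ℂ (fun w ↦ cauchyTransform χ (-w)) w :=
      (differentiableAt_cauchyTransform hε hle).comp w differentiable_neg.differentiableAt
    simp only [reciprocalCauchy, one_div]
    exact ((hd.inv (hne w hw)).neg.sub differentiableAt_id).differentiableWithinAt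
  · obtain ⟨A, B, -, hB, hle, h⟩ := hG w hw
    have hpos : 0 < Complex.normSq (cauchyTransform χ (-w)) := Complex.normSq_pos.2 (hne w hw)
    refine ⟨B / Complex.normSq (cauchyTransform χ (-w)),
      A / Complex.normSq (cauchyTransform χ (-w)) - 1, by positivity, ?_, ?_⟩
    · rwa [sub_nonneg, one_le_div hpos]
    · nth_rewrite 1 [reciprocalCauchy, one_div, Complex.inv_def, h]
      simp only [map_neg, map_add, map_mul, Complex.conj_ofReal, Complex.conj_conj]
      push_cast
      ring

/-! ### Truncated cones -/

/-- The filter of neighbourhoods of infinity in `s`. -/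
noncomputable def coboundedWithin (s : Set ℂ) : Filter ℂ := Bornology.cobounded ℂ ⊓ 𝓟 s

section CoboundedWithin

variable {ι : Type*} {l : Filter ι} {f : ι → ℂ} (s : Set ℂ)

instance : (coboundedWithin s).IsCountablyGenerated := by
  rw [coboundedWithin, ← comap_norm_atTop]
  infer_instance

lemma eventually_mem_coboundedWithin : ∀ᶠ z in coboundedWithin s, z ∈ s :=
  mem_inf_of_right (mem_principal_self _)

lemma tendsto_norm_coboundedWithin : Tendsto (fun z : ℂ ↦ ‖z‖) (coboundedWithin s) atTop :=
  tendsto_norm_cobounded_atTop.mono_left inf_le_left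

variable {s} in
lemma tendsto_coboundedWithin (hf : Tendsto (fun i ↦ ‖f i‖) l atTop) (hs : ∀ᶠ i in l, f i ∈ s) :
    Tendsto f l (coboundedWithin s) :=
  tendsto_inf.2 ⟨tendsto_norm_atTop_iff_cobounded.1 hf, tendsto_principal.2 hs⟩

end CoboundedWithin

lemma truncatedCone_mono {α α' M M' : ℝ} (hα : α' ≤ α) (hM : M ≤ M') (hM' : 0 ≤ M') :
    truncatedCone α' M' ⊆ truncatedCone α M := fun _ hz ↦
  ⟨hz.1.trans_le (mul_le_mul_of_nonneg_right hα (hM'.trans hz.2.le)), hM.trans_lt hz.2⟩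

lemma isOpen_truncatedCone (α M : ℝ) : IsOpen (truncatedCone α M) :=
  IsOpen.inter (isOpen_lt (f := fun z : ℂ ↦ |z.re|) (by fun_prop) (by fun_prop))
    (isOpen_lt (g := Complex.im) (by fun_prop) (by fun_prop))

lemma convex_truncatedCone (α M : ℝ) : Convex ℝ (truncatedCone α M) := by
  have hcone : truncatedCone α M = {z | (Complex.reLm - α • Complex.imLm) z < 0} ∩
      {z | 0 < (Complex.reLm + α • Complex.imLm) z} ∩ {z | M < z.im} := by
    ext z
    simp [truncatedCone, abs_lt, and_comm, sub_neg, neg_lt_iff_pos_add]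
  rw [hcone]
  exact ((convex_halfSpace_lt (LinearMap.isLinear _) 0).inter
    (convex_halfSpace_gt (LinearMap.isLinear _) 0)).inter (convex_halfSpace_im_gt M)

lemma im_pos_of_mem_truncatedCone {α M : ℝ} (hM : 0 ≤ M) {z : ℂ} (hz : z ∈ truncatedCone α M) :
    0 < z.im := hM.trans_lt hz.2

lemma norm_le_of_mem_truncatedCone {α M : ℝ} (hM : 0 ≤ M) {z : ℂ} (hz : z ∈ truncatedCone α M) :
    ‖z‖ ≤ (1 + α) * z.im := by
  have h1 := Complex.norm_le_abs_re_add_abs_im z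
  rw [abs_of_pos (im_pos_of_mem_truncatedCone hM hz)] at h1
  linarith [hz.1]

lemma mul_I_mem_truncatedCone {α M r : ℝ} (hα : 0 < α) (hM : 0 ≤ M) (hr : M < r) :
    (r : ℂ) * Complex.I ∈ truncatedCone α M := by
  simpa [truncatedCone] using! ⟨mul_pos hα (hM.trans_lt hr), hr⟩

/-- The filter of neighbourhoods of infinity in a truncated cone. -/
noncomputable abbrev coneFilter (α M : ℝ) : Filter ℂ := coboundedWithin (truncatedCone α M)

lemma coneFilter_mono {α α' M M' : ℝ} (hα : α' ≤ α) (hM : M ≤ M') (hM' : 0 ≤ M') :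
    coneFilter α' M' ≤ coneFilter α M :=
  inf_le_inf_left _ (principal_mono.2 (truncatedCone_mono hα hM hM'))

lemma neBot_coneFilter {α M : ℝ} (hα : 0 < α) (hM : 0 ≤ M) : (coneFilter α M).NeBot := by
  have hray : Tendsto (fun r : ℝ ↦ (r : ℂ) * Complex.I) atTop (coneFilter α M) := by
    refine tendsto_coboundedWithin ?_ ?_
    · simpa using tendsto_abs_atTop_atTop
    · filter_upwards [eventually_gt_atTop M] with r hr using mul_I_mem_truncatedCone hα hM hr
  exact hray.neBot

lemma exists_forall_mem_truncatedCone {α M : ℝ} {p : ℂ → Prop} (h : ∀ᶠ z in coneFilter α M, p z) :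
    ∃ R : ℝ, ∀ M', R ≤ M' → ∀ z ∈ truncatedCone α M', p z := by
  rw [coneFilter, coboundedWithin, ← comap_norm_atTop, eventually_inf_principal,
    eventually_comap] at h
  obtain ⟨R, hR⟩ := eventually_atTop.1 h
  refine ⟨max R (max M 0), fun M' hM' z hz ↦ ?_⟩
  rw [max_le_iff, max_le_iff] at hM'
  obtain ⟨hRM, hMM, hM0⟩ := hM'
  refine hR ‖z‖ ?_ z rfl (truncatedCone_mono le_rfl hMM hM0 hz)
  linarith [hz.2, Complex.im_le_norm z]

/-! ### Uniqueness of the Voiculescu transform -/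

/-- The three conditions of `IsVoiculescuTransform` on a specified truncated cone. -/
structure IsVoiculescuTransformOn (μ : ProbabilityMeasure ℝ) (φ : ℂ → ℂ) (α M : ℝ) : Prop where
  analyticOnNhd : AnalyticOnNhd ℂ φ (truncatedCone α M)
  rightInverse : ∀ z ∈ truncatedCone α M, 0 < (z + φ z).im ∧ reciprocalCauchy μ (z + φ z) = z
  tendsto_div : Tendsto (fun z ↦ (z + φ z) / z) (coneFilter α M) (𝓝 1)

lemma isVoiculescuTransform_iff {μ : ProbabilityMeasure ℝ} {φ : ℂ → ℂ} :
    IsVoiculescuTransform μ φ ↔ ∃ α M : ℝ, 0 < α ∧ 0 < M ∧ IsVoiculescuTransformOn μ φ α M := by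
  refine exists₂_congr fun α M ↦ and_congr_right' (and_congr_right' ?_)
  exact ⟨fun ⟨h₁, h₂, h₃⟩ ↦ ⟨h₁, h₂, h₃⟩, fun ⟨h₁, h₂, h₃⟩ ↦ ⟨h₁, h₂, h₃⟩⟩

namespace IsVoiculescuTransformOn

variable {μ : ProbabilityMeasure ℝ} {φ : ℂ → ℂ} {α M : ℝ}

lemma mono (h : IsVoiculescuTransformOn μ φ α M) {α' M' : ℝ} (hα : α' ≤ α) (hM : M ≤ M')
    (hM' : 0 ≤ M') : IsVoiculescuTransformOn μ φ α' M' where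
  analyticOnNhd := h.analyticOnNhd.mono (truncatedCone_mono hα hM hM')
  rightInverse z hz := h.rightInverse z (truncatedCone_mono hα hM hM' hz)
  tendsto_div := h.tendsto_div.mono_left (coneFilter_mono hα hM hM')

lemma congr {φ' : ℂ → ℂ} (h : IsVoiculescuTransformOn μ φ α M)
    (he : EqOn φ φ' (truncatedCone α M)) : IsVoiculescuTransformOn μ φ' α M where
  analyticOnNhd := h.analyticOnNhd.congr (isOpen_truncatedCone _ _) he
  rightInverse z hz := he hz ▸ h.rightInverse z hz
  tendsto_div := h.tendsto_div.congr' <| (eventually_mem_coboundedWithin _).mono fun z hz ↦ by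
    rw [he hz]

lemma cauchyTransform_add (h : IsVoiculescuTransformOn μ φ α M) {z : ℂ}
    (hz : z ∈ truncatedCone α M) : cauchyTransform μ (z + φ z) = z⁻¹ := by
  rw [← inv_inv (cauchyTransform μ _), ← one_div (cauchyTransform μ _), ← reciprocalCauchy,
    (h.rightInverse z hz).2]

end IsVoiculescuTransformOn

lemma IsVoiculescuTransform.exists_common {μ₁ μ₂ : ProbabilityMeasure ℝ} {φ₁ φ₂ : ℂ → ℂ}
    (h₁ : IsVoiculescuTransform μ₁ φ₁) (h₂ : IsVoiculescuTransform μ₂ φ₂) :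
    ∃ α M : ℝ, 0 < α ∧ 0 < M ∧
      IsVoiculescuTransformOn μ₁ φ₁ α M ∧ IsVoiculescuTransformOn μ₂ φ₂ α M := by
  obtain ⟨α₁, M₁, hα₁, hM₁, h₁⟩ := isVoiculescuTransform_iff.1 h₁
  obtain ⟨α₂, M₂, hα₂, -, h₂⟩ := isVoiculescuTransform_iff.1 h₂
  have hM : 0 < max M₁ M₂ := hM₁.trans_le (le_max_left _ _)
  exact ⟨min α₁ α₂, max M₁ M₂, lt_min hα₁ hα₂, hM,
    h₁.mono (min_le_left _ _) (le_max_left _ _) hM.le,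
    h₂.mono (min_le_right _ _) (le_max_right _ _) hM.le⟩

lemma IsVoiculescuTransform.congr {μ : ProbabilityMeasure ℝ} {φ φ' : ℂ → ℂ}
    (h : IsVoiculescuTransform μ φ) {α M : ℝ} (hα : 0 < α) (he : EqOn φ φ' (truncatedCone α M)) :
    IsVoiculescuTransform μ φ' := by
  obtain ⟨α₁, M₁, hα₁, hM₁, h⟩ := isVoiculescuTransform_iff.1 h
  have hM' : 0 < max M M₁ := hM₁.trans_le (le_max_right _ _)
  exact isVoiculescuTransform_iff.2 ⟨min α α₁, max M M₁, lt_min hα hα₁, hM',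
    (h.mono (min_le_right _ _) (le_max_right _ _) hM'.le).congr
      (he.mono (truncatedCone_mono (min_le_left _ _) (le_max_left _ _) hM'.le))⟩

section ConeAsymptotics

variable {α M : ℝ} {ψ : ℂ → ℂ}

lemma eventually_mul_norm_le_norm_sub (hα : 0 < α) (hM : 0 ≤ M)
    (hψ : Tendsto (fun z ↦ ψ z / z) (coneFilter α M) (𝓝 1)) :
    ∃ c > 0, ∀ᶠ z in coneFilter α M, 0 < ‖ψ z‖ ∧ ∀ x : ℝ, c * ‖ψ z‖ ≤ ‖ψ z - x‖ := by
  set δ : ℝ := 1 / (2 * (1 + α)) with hδ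
  have hδ0 : 0 < δ := by positivity
  have hδ1 : δ < 1 := by
    rw [hδ, div_lt_one (by positivity)]
    linarith
  refine ⟨δ / 2, by positivity, ?_⟩
  filter_upwards [hψ.eventually (Metric.ball_mem_nhds 1 hδ0), eventually_mem_coboundedWithin _]
    with z hz hzc
  have him := im_pos_of_mem_truncatedCone hM hzc
  have hz0 : z ≠ 0 := fun h ↦ by simp [h] at him
  have hzn : 0 < ‖z‖ := norm_pos_iff.2 hz0
  have hdist : ‖ψ z - z‖ < δ * ‖z‖ := by
    rw [dist_eq_norm, div_sub_one hz0, norm_div, div_lt_iff₀ hzn] at hz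
    exact hz
  have hlow (x : ℝ) : 2 * δ * ‖z‖ ≤ ‖z - x‖ := by
    have := (le_abs_self z.im).trans (abs_im_le_norm_sub_ofReal z x)
    have := norm_le_of_mem_truncatedCone hM hzc
    rw [hδ]
    field_simp
    nlinarith
  have hup : ‖ψ z‖ ≤ 2 * ‖z‖ := by
    have := norm_sub_norm_le (ψ z) z
    nlinarith
  refine ⟨?_, fun x ↦ ?_⟩
  · have := norm_sub_norm_le z (ψ z)
    rw [norm_sub_rev] at this
    nlinarith
  · have := norm_sub_le_norm_sub_add_norm_sub z (ψ z) x
    rw [norm_sub_rev z (ψ z)] at this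
    nlinarith [hlow x]

lemma tendsto_norm_of_tendsto_div_id (hψ : Tendsto (fun z ↦ ψ z / z) (coneFilter α M) (𝓝 1)) :
    Tendsto (fun z ↦ ‖ψ z‖) (coneFilter α M) atTop := by
  have hn := tendsto_norm_coboundedWithin (truncatedCone α M)
  refine (hψ.norm.pos_mul_atTop (by simp) hn).congr' ?_
  filter_upwards [hn.eventually_gt_atTop 0] with z hz
  rw [norm_div, div_mul_cancel₀ _ hz.ne']

lemma tendsto_div_sub_ofReal (hα : 0 < α) (hM : 0 ≤ M)
    (hψ : Tendsto (fun z ↦ ψ z / z) (coneFilter α M) (𝓝 1)) (x : ℝ) :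
    Tendsto (fun z ↦ ψ z / (ψ z - x)) (coneFilter α M) (𝓝 1) := by
  obtain ⟨c, hc, h⟩ := eventually_mul_norm_le_norm_sub hα hM hψ
  rw [tendsto_iff_norm_sub_tendsto_zero]
  refine squeeze_zero' (.of_forall fun _ ↦ norm_nonneg _) (g := fun z ↦ |x| / c / ‖ψ z‖) ?_
    ((tendsto_norm_of_tendsto_div_id hψ).const_div_atTop _)
  filter_upwards [h] with z ⟨hz, hle⟩
  have hne : ψ z - x ≠ 0 := norm_pos_iff.1 ((mul_pos hc hz).trans_le (hle x))
  rw [div_sub_one hne, sub_sub_cancel, norm_div, Complex.norm_real, Real.norm_eq_abs, div_div]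
  gcongr
  exact hle x

lemma tendsto_integral_div_sub_mul_div_sub {μ : Measure ℝ} [IsProbabilityMeasure μ] (hα : 0 < α)
    (hM : 0 ≤ M) {ψ₁ ψ₂ : ℂ → ℂ} (h₁ : Tendsto (fun z ↦ ψ₁ z / z) (coneFilter α M) (𝓝 1))
    (h₂ : Tendsto (fun z ↦ ψ₂ z / z) (coneFilter α M) (𝓝 1)) :
    Tendsto (fun z ↦ ∫ x : ℝ, ψ₁ z / (ψ₁ z - x) * (ψ₂ z / (ψ₂ z - x)) ∂μ) (coneFilter α M)
      (𝓝 1) := by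
  have hbound {ψ : ℂ → ℂ} (h : Tendsto (fun z ↦ ψ z / z) (coneFilter α M) (𝓝 1)) :
      ∃ C, ∀ᶠ z in coneFilter α M, ∀ x : ℝ, ‖ψ z / (ψ z - x)‖ ≤ C := by
    obtain ⟨c, hc, h⟩ := eventually_mul_norm_le_norm_sub hα hM h
    refine ⟨1 / c, h.mono fun z ⟨hz, hle⟩ x ↦ ?_⟩
    rw [norm_div, div_le_div_iff₀ ((mul_pos hc hz).trans_le (hle x)) hc, one_mul, mul_comm]
    exact hle x
  obtain ⟨C₁, hC₁⟩ := hbound h₁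
  obtain ⟨C₂, hC₂⟩ := hbound h₂
  have := tendsto_integral_filter_of_dominated_convergence (μ := μ) (l := coneFilter α M)
    (F := fun z x ↦ ψ₁ z / (ψ₁ z - (x : ℝ)) * (ψ₂ z / (ψ₂ z - (x : ℝ)))) (f := fun _ ↦ (1 : ℂ))
    (fun _ ↦ C₁ * C₂)
    (.of_forall fun z ↦ Measurable.aestronglyMeasurable (by fun_prop)) ?_ (integrable_const _) ?_
  · simpa using this
  · filter_upwards [hC₁, hC₂] with z hz₁ hz₂
    exact .of_forall fun x ↦ norm_mul_le_of_le (hz₁ x) (hz₂ x)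
  · refine .of_forall fun x ↦ ?_
    simpa using (tendsto_div_sub_ofReal hα hM h₁ x).mul (tendsto_div_sub_ofReal hα hM h₂ x)

end ConeAsymptotics

lemma integral_div_sub_mul_div_sub_eq_zero {μ : ProbabilityMeasure ℝ} {a b : ℂ} (ha : a.im ≠ 0)
    (hb : b.im ≠ 0) (h : cauchyTransform μ a = cauchyTransform μ b) (hab : a ≠ b) :
    ∫ x : ℝ, a / (a - x) * (b / (b - x)) ∂(μ : Measure ℝ) = 0 := by
  have hint {c : ℂ} (hc : c.im ≠ 0) : Integrable (fun x : ℝ ↦ 1 / (c - x)) (μ : Measure ℝ) := by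
    simpa using integrable_inv_sub_pow (abs_pos.2 hc) (.of_forall (abs_im_le_norm_sub_ofReal c)) 1
  have hba : b - a ≠ 0 := sub_ne_zero.2 hab.symm
  have hsplit (x : ℝ) : a / (a - x) * (b / (b - x)) =
      a * b / (b - a) * (1 / (a - x) - 1 / (b - x)) := by
    have h1 := sub_ofReal_ne_zero ha x
    have h2 := sub_ofReal_ne_zero hb x
    field_simp
    ring
  simp_rw [hsplit]
  rw [integral_const_mul, integral_sub (hint ha) (hint hb)]
  exact mul_eq_zero_of_right _ (sub_eq_zero.2 h)

lemma IsVoiculescuTransform.exists_eqOn {μ : ProbabilityMeasure ℝ} {φ₁ φ₂ : ℂ → ℂ}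
    (h₁ : IsVoiculescuTransform μ φ₁) (h₂ : IsVoiculescuTransform μ φ₂) :
    ∃ α M : ℝ, 0 < α ∧ 0 < M ∧ EqOn φ₁ φ₂ (truncatedCone α M) := by
  obtain ⟨α, M, hα, hM, h₁, h₂⟩ := h₁.exists_common h₂
  have hlim := tendsto_integral_div_sub_mul_div_sub (μ := (μ : Measure ℝ)) hα hM.le
    h₁.tendsto_div h₂.tendsto_div
  -- At `z`, distinct values of the two right inverses would make this integral vanish.
  have heq : ∀ᶠ z in coneFilter α M, φ₁ z = φ₂ z := by
    filter_upwards [hlim.eventually_ne one_ne_zero, eventually_mem_coboundedWithin _] with z hz hzc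
    by_contra hne
    exact hz <| integral_div_sub_mul_div_sub_eq_zero (h₁.rightInverse z hzc).1.ne'
      (h₂.rightInverse z hzc).1.ne'
      ((h₁.cauchyTransform_add hzc).trans (h₂.cauchyTransform_add hzc).symm)
      fun h ↦ hne (add_left_cancel h)
  obtain ⟨R, hR⟩ := exists_forall_mem_truncatedCone heq
  exact ⟨α, max R 1, hα, by positivity, hR _ (le_max_left _ _)⟩

lemma IsVoiculescuTransform.eqOn_cauchyTransform {μ ν : ProbabilityMeasure ℝ} {φ : ℂ → ℂ}
    (hμ : IsVoiculescuTransform μ φ) (hν : IsVoiculescuTransform ν φ) :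
    EqOn (cauchyTransform μ) (cauchyTransform ν) upperHalfPlaneSet := by
  obtain ⟨α, M, hα, hM, hμ, hν⟩ := hμ.exists_common hν
  set z₀ : ℂ := ((M + 1 : ℝ) : ℂ) * Complex.I
  have hz₀ : z₀ ∈ truncatedCone α M := mul_I_mem_truncatedCone hα hM.le (by linarith)
  have hev : ∀ᶠ z in 𝓝[≠] z₀, z ∈ truncatedCone α M :=
    mem_nhdsWithin_of_mem_nhds ((isOpen_truncatedCone _ _).mem_nhds hz₀)
  have hlim : Tendsto (fun z ↦ z + φ z) (𝓝[≠] z₀) (𝓝[≠] (z₀ + φ z₀)) := by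
    refine tendsto_nhdsWithin_iff.2 ⟨?_, ?_⟩
    · exact (continuousAt_id.add (hμ.analyticOnNhd z₀ hz₀).continuousAt).tendsto.mono_left
        nhdsWithin_le_nhds
    · filter_upwards [self_mem_nhdsWithin, hev] with z hz hzc h
      have hinv := (hμ.rightInverse z hzc).2
      rw [mem_singleton_iff.1 h, (hμ.rightInverse z₀ hz₀).2] at hinv
      exact hz hinv.symm
  refine (analyticOnNhd_cauchyTransform μ).eqOn_of_preconnected_of_frequently_eq
    (analyticOnNhd_cauchyTransform ν) (convex_halfSpace_im_gt 0).isPreconnected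
    (hμ.rightInverse z₀ hz₀).1 (hlim.frequently (hev.mono fun z hz ↦ ?_).frequently)
  rw [hμ.cauchyTransform_add hz, hν.cauchyTransform_add hz]

/-! ### The Cauchy transform determines the measure -/

open BoundedContinuousFunction in
theorem ext_of_integral_pow_mul_star_pow_eq {E 𝕜 : Type*} [RCLike 𝕜] [MeasurableSpace E]
    [TopologicalSpace E] [PolishSpace E] [BorelSpace E] {μ ν : Measure E} [IsFiniteMeasure μ]
    [IsFiniteMeasure ν] {u : E →ᵇ 𝕜} (hu : Function.Injective u)
    (h : ∀ m n : ℕ, ∫ x, u x ^ m * star (u x) ^ n ∂μ = ∫ x, u x ^ m * star (u x) ^ n ∂ν) :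
    μ = ν := by
  refine ext_of_forall_mem_subalgebra_integral_eq_of_polish (𝕜 := 𝕜)
    (A := StarAlgebra.adjoin 𝕜 {u}) (fun x y hxy ↦ ?_) fun g hg ↦ ?_
  · exact ⟨u, ⟨u.toContinuousMap, ⟨u, StarAlgebra.self_mem_adjoin_singleton 𝕜 _, rfl⟩, rfl⟩,
      hu.ne hxy⟩
  · have hspan : g ∈ Submodule.span 𝕜 (Submonoid.closure {u, star u} : Set (E →ᵇ 𝕜)) := by
      rw [← Algebra.adjoin_eq_span, insert_eq, ← Set.star_singleton,
        ← StarAlgebra.adjoin_toSubalgebra]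
      exact hg
    clear hg
    induction hspan using Submodule.span_induction with
    | mem g hg =>
      obtain ⟨m, n, rfl⟩ := (Submonoid.mem_closure_pair _ _ _).1 hg
      exact h m n
    | zero => simp
    | add f g _ _ hf hg =>
      simp only [coe_add, Pi.add_apply]
      rw [integral_add (f.integrable _) (g.integrable _),
        integral_add (f.integrable _) (g.integrable _), hf, hg]
    | smul c f _ hf => simp only [coe_smul, integral_smul, hf]

lemma integral_inv_sub_pow_eq {μ ν : ProbabilityMeasure ℝ}
    (h : EqOn (cauchyTransform μ) (cauchyTransform ν) upperHalfPlaneSet) (n : ℕ) {z : ℂ}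
    (hz : z ∈ upperHalfPlaneSet) : ∫ x : ℝ, (z - x)⁻¹ ^ n ∂(μ : Measure ℝ) =
      ∫ x : ℝ, (z - x)⁻¹ ^ n ∂(ν : Measure ℝ) := by
  rcases n with _ | n
  · simp
  induction n generalizing z with
  | zero => simpa only [cauchyTransform_eq_integral_inv_sub_pow] using h hz
  | succ n ih =>
    have hderiv (χ : ProbabilityMeasure ℝ) := hasDerivAt_integral_inv_sub_pow
      (μ := (χ : Measure ℝ)) (abs_pos.2 (ne_of_gt hz)) (.of_forall (abs_im_le_norm_sub_ofReal z))
      (n + 1)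
    have heq : (fun w : ℂ ↦ ∫ x : ℝ, (w - x)⁻¹ ^ (n + 1) ∂(ν : Measure ℝ)) =ᶠ[𝓝 z]
        fun w ↦ ∫ x : ℝ, (w - x)⁻¹ ^ (n + 1) ∂(μ : Measure ℝ) := by
      filter_upwards [isOpen_upperHalfPlaneSet.mem_nhds hz] with w hw using (ih hw).symm
    exact mul_left_cancel₀ (neg_ne_zero.2 (Nat.cast_ne_zero.2 n.succ_ne_zero))
      (((hderiv μ).congr_of_eventuallyEq heq).unique (hderiv ν))

/-- The bounded continuous function `x ↦ (i - x)⁻¹` on the real line. -/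
noncomputable def invISub : BoundedContinuousFunction ℝ ℂ :=
  .ofNormedAddCommGroup (fun x : ℝ ↦ (Complex.I - x)⁻¹)
    (Continuous.inv₀ (by fun_prop) (sub_ofReal_ne_zero (by simp))) 1 fun x ↦ by
      rw [norm_inv]
      exact inv_le_one_of_one_le₀ (by simpa using abs_im_le_norm_sub_ofReal Complex.I x)

lemma invISub_apply (x : ℝ) : invISub x = (Complex.I - x)⁻¹ := rfl

lemma invISub_injective : Function.Injective invISub := fun x y h ↦ by
  simpa [invISub_apply] using h

lemma invISub_mul_star (x : ℝ) :
    invISub x * star (invISub x) = Complex.I / 2 * (invISub x - star (invISub x)) := by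
  have h1 := sub_ofReal_ne_zero (z := Complex.I) (by simp) x
  have h2 := sub_ofReal_ne_zero (z := -Complex.I) (by simp) x
  simp only [invISub_apply, star_inv₀, star_sub, RCLike.star_def, Complex.conj_I,
    Complex.conj_ofReal]
  field_simp
  ring_nf
  simp

lemma integral_invISub_pow_mul_star_pow_eq {μ ν : ProbabilityMeasure ℝ}
    (h : EqOn (cauchyTransform μ) (cauchyTransform ν) upperHalfPlaneSet) (m n : ℕ) :
    ∫ x, invISub x ^ m * star (invISub x) ^ n ∂(μ : Measure ℝ) =
      ∫ x, invISub x ^ m * star (invISub x) ^ n ∂(ν : Measure ℝ) := by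
  have hpow (m : ℕ) : ∫ x, invISub x ^ m ∂(μ : Measure ℝ) = ∫ x, invISub x ^ m ∂(ν : Measure ℝ) :=
    integral_inv_sub_pow_eq h m (by simp [upperHalfPlaneSet])
  induction m generalizing n with
  | zero =>
    simp only [pow_zero, one_mul, ← star_pow]
    simpa only [RCLike.star_def, integral_conj] using congrArg star (hpow n)
  | succ m ihm =>
    induction n with
    | zero => simpa using hpow (m + 1)
    | succ n ihn =>
      have hint (χ : ProbabilityMeasure ℝ) (m n : ℕ) :
          Integrable (fun x ↦ invISub x ^ m * star (invISub x) ^ n) (χ : Measure ℝ) :=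
        (invISub ^ m * star invISub ^ n).integrable _
      have hstep (x : ℝ) : invISub x ^ (m + 1) * star (invISub x) ^ (n + 1) = Complex.I / 2 *
          (invISub x ^ (m + 1) * star (invISub x) ^ n -
            invISub x ^ m * star (invISub x) ^ (n + 1)) := by
        linear_combination invISub x ^ m * star (invISub x) ^ n * invISub_mul_star x
      simp_rw [hstep, integral_const_mul]
      rw [integral_sub (hint μ _ _) (hint μ _ _), integral_sub (hint ν _ _) (hint ν _ _), ihn, ihm]

lemma eq_of_eqOn_cauchyTransform {μ ν : ProbabilityMeasure ℝ}
    (h : EqOn (cauchyTransform μ) (cauchyTransform ν) upperHalfPlaneSet) : μ = ν :=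
  Subtype.ext <| ext_of_integral_pow_mul_star_pow_eq (μ := (μ : Measure ℝ)) (ν := (ν : Measure ℝ))
    invISub_injective (integral_invISub_pow_mul_star_pow_eq h)

lemma IsVoiculescuTransform.eq {μ ν : ProbabilityMeasure ℝ} {φ : ℂ → ℂ}
    (hμ : IsVoiculescuTransform μ φ) (hν : IsVoiculescuTransform ν φ) : μ = ν :=
  eq_of_eqOn_cauchyTransform (hμ.eqOn_cauchyTransform hν)

/-! ### Growth of the transform at infinity -/

/-- A sector which contains the right half-plane and stays away from the negative half-axis. -/
def wideSector : Set ℂ := {w | -(3 / 4) * ‖w‖ ≤ w.re}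

lemma ofReal_mem_wideSector {r : ℝ} (hr : 0 ≤ r) : (r : ℂ) ∈ wideSector := by
  simp only [wideSector, mem_ofPred_eq, Complex.norm_real, Complex.ofReal_re, Real.norm_eq_abs,
    abs_of_nonneg hr]
  linarith

lemma neg_mem_wideSector {M : ℝ} {z : ℂ} (hz : z ∈ truncatedCone 1 M) :
    -z ∈ wideSector := by
  have hre : z.re ^ 2 ≤ z.im ^ 2 :=
    sq_le_sq' (by linarith [neg_abs_le z.re, hz.1]) (by linarith [le_abs_self z.re, hz.1])
  have hnorm : z.re ^ 2 ≤ (3 / 4 * ‖z‖) ^ 2 := by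
    rw [mul_pow, Complex.sq_norm, Complex.normSq_apply]
    nlinarith
  have := abs_le_of_sq_le_sq hnorm (by positivity)
  simp only [wideSector, mem_ofPred_eq, norm_neg, Complex.neg_re]
  linarith [le_abs_self z.re]

lemma le_norm_add_mul {a b : ℝ} (ha : 0 ≤ a) (hb : 0 ≤ b) {w : ℂ} (hw : w ∈ wideSector) :
    (1 / 3) * (a + b * ‖w‖) ≤ ‖(a : ℂ) + b * w‖ := by
  have hre : -(3 / 4) * ‖w‖ ≤ w.re := hw
  have hnormSq : ‖(a : ℂ) + b * w‖ ^ 2 = a ^ 2 + 2 * (a * b) * w.re + (b * ‖w‖) ^ 2 := by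
    rw [mul_pow, Complex.sq_norm, Complex.sq_norm, Complex.normSq_apply, Complex.normSq_apply]
    simp only [Complex.add_re, Complex.ofReal_re, Complex.re_ofReal_mul, Complex.add_im,
      Complex.ofReal_im, Complex.im_ofReal_mul, zero_add]
    ring
  refine abs_le_of_sq_le_sq' ?_ (norm_nonneg _) |>.2
  rw [hnormSq]
  nlinarith [mul_le_mul_of_nonneg_left hre (mul_nonneg ha hb), sq_nonneg (a - b * ‖w‖),
    mul_nonneg (mul_nonneg ha hb) (norm_nonneg w)]

lemma mem_slitPlane_of_mem_wideSector {w : ℂ} (hw : w ∈ wideSector) (h0 : w ≠ 0) :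
    w ∈ slitPlane := by
  rw [Complex.mem_slitPlane_iff_not_le_zero, Complex.nonpos_iff]
  rintro ⟨hre, him⟩
  have hnorm : ‖w‖ = -w.re := by
    rw [Complex.norm_eq_sqrt_sq_add_sq, him, zero_pow two_ne_zero, add_zero, Real.sqrt_sq_eq_abs,
      abs_of_nonpos hre]
  have hle : -(3 / 4) * ‖w‖ ≤ w.re := hw
  linarith [norm_pos_iff.2 h0]

lemma le_norm_cbfDenom {w : ℂ} (hw : w ∈ wideSector) (y : I) :
    (1 / 3) * (1 - (y : ℝ) + y * ‖w‖) ≤ ‖(1 : ℂ) - (y : ℝ) + (y : ℝ) * w‖ := by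
  simpa using le_norm_add_mul (sub_nonneg.2 y.2.2) y.2.1 hw

lemma norm_one_sub_coe_le_one (y : I) : ‖(1 : ℂ) - (y : ℝ)‖ ≤ 1 := by
  rw [← Complex.ofReal_one, ← Complex.ofReal_sub, Complex.norm_real,
    Real.norm_of_nonneg (sub_nonneg.2 y.2.2)]
  linarith [y.2.1]

lemma norm_cbfDenom_le (w : ℂ) (y : I) : ‖(1 : ℂ) - (y : ℝ) + (y : ℝ) * w‖ ≤ 1 + ‖w‖ := by
  refine norm_add_le_of_le (norm_one_sub_coe_le_one y) ?_
  rw [norm_mul, Complex.norm_real, Real.norm_of_nonneg y.2.1]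
  exact mul_le_of_le_one_left (norm_nonneg _) y.2.2

lemma one_le_cbfDenom {r : ℝ} (hr : 1 ≤ r) (y : I) : 1 ≤ 1 - (y : ℝ) + y * r := by
  nlinarith [y.2.1]

lemma cbfTransform_div (ρ : Measure I) {w : ℂ} (hw : w ≠ 0) :
    cbfTransform ρ w / w = ∫ y : I, (1 - (y : ℝ) + (y : ℝ) * w)⁻¹ ∂ρ := by
  rw [cbfTransform, ← integral_div]
  refine integral_congr_ae (.of_forall fun y ↦ ?_)
  simp only [cbfKernel]
  rw [div_div, mul_comm, ← div_div, div_self hw, one_div]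

lemma norm_inv_cbfDenom_le {w : ℂ} (hw : w ∈ wideSector) (h0 : w ≠ 0) (y : I) :
    ‖((1 : ℂ) - (y : ℝ) + (y : ℝ) * w)⁻¹‖ ≤ 3 * (1 - (y : ℝ) + y * ‖w‖)⁻¹ := by
  have hpos := cbfDenom_pos (norm_pos_iff.2 h0) y
  calc ‖((1 : ℂ) - (y : ℝ) + (y : ℝ) * w)⁻¹‖ ≤ ((1 / 3) * (1 - (y : ℝ) + y * ‖w‖))⁻¹ := by
        rw [norm_inv]
        exact inv_anti₀ (by positivity) (le_norm_cbfDenom hw y)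
    _ = 3 * (1 - (y : ℝ) + y * ‖w‖)⁻¹ := by rw [mul_inv]; norm_num

lemma tendsto_inv_cbfDenom (y : I) :
    Tendsto (fun w : ℂ ↦ ((1 : ℂ) - (y : ℝ) + (y : ℝ) * w)⁻¹) (Bornology.cobounded ℂ)
      (𝓝 (({0} : Set I).indicator (fun _ ↦ 1) y)) := by
  by_cases hy : y = 0
  · simp [hy]
  · rw [indicator_of_notMem (by simpa using hy)]
    have hy' : ((y : ℝ) : ℂ) ≠ 0 := by simpa using hy
    exact tendsto_inv₀_cobounded.comp
      ((tendsto_const_add_cobounded _).comp (tendsto_mul_left_cobounded hy'))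

lemma tendsto_cbfTransform_div (ρ : Measure I) [IsFiniteMeasure ρ] :
    Tendsto (fun w ↦ cbfTransform ρ w / w) (coboundedWithin wideSector) (𝓝 (ρ.real {0})) := by
  have hone : ∀ᶠ w in coboundedWithin wideSector, 1 ≤ ‖w‖ :=
    (tendsto_norm_coboundedWithin _).eventually_ge_atTop 1
  have hlim : Tendsto (fun w : ℂ ↦ ∫ y : I, (1 - (y : ℝ) + (y : ℝ) * w)⁻¹ ∂ρ)
      (coboundedWithin wideSector)
      (𝓝 (∫ y : I, ({0} : Set I).indicator (fun _ ↦ (1 : ℂ)) y ∂ρ)) := by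
    refine tendsto_integral_filter_of_dominated_convergence (fun _ ↦ 3)
      (.of_forall fun w ↦ Measurable.aestronglyMeasurable (by fun_prop)) ?_
      (integrable_const _) (.of_forall fun y ↦ (tendsto_inv_cbfDenom y).mono_left inf_le_left)
    filter_upwards [eventually_mem_coboundedWithin _, hone] with w hw hw1
    refine .of_forall fun y ↦
      (norm_inv_cbfDenom_le hw (norm_pos_iff.1 (one_pos.trans_le hw1)) y).trans ?_
    linarith [inv_le_one_of_one_le₀ (one_le_cbfDenom hw1 y)]
  rw [integral_indicator_const _ (measurableSet_singleton _), Complex.real_smul, mul_one] at hlim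
  refine hlim.congr' ?_
  filter_upwards [hone] with w hw
  exact (cbfTransform_div ρ (norm_pos_iff.1 (one_pos.trans_le hw))).symm

lemma tendsto_ofReal_coboundedWithin_wideSector :
    Tendsto (fun r : ℝ ↦ (r : ℂ)) atTop (coboundedWithin wideSector) :=
  tendsto_coboundedWithin (by simpa using tendsto_abs_atTop_atTop)
    ((eventually_ge_atTop 0).mono fun _ ↦ ofReal_mem_wideSector)

lemma tendsto_neg_coneFilter (M : ℝ) :
    Tendsto (fun z : ℂ ↦ -z) (coneFilter 1 M) (coboundedWithin wideSector) :=
  tendsto_coboundedWithin (by simpa only [norm_neg] using tendsto_norm_coboundedWithin _)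
    ((eventually_mem_coboundedWithin _).mono fun _ ↦ neg_mem_wideSector)

lemma tendsto_add_cbfTransform_neg_div (ρ : Measure I) [IsFiniteMeasure ρ] (M : ℝ) :
    Tendsto (fun z ↦ (z + cbfTransform ρ (-z)) / z) (coneFilter 1 M) (𝓝 (1 - ρ.real {0})) := by
  refine (((tendsto_cbfTransform_div ρ).comp (tendsto_neg_coneFilter M)).const_sub 1).congr' ?_
  filter_upwards [(tendsto_norm_coboundedWithin _).eventually_gt_atTop 0] with z hz
  rw [Function.comp_apply, add_div, div_self (norm_pos_iff.1 hz), div_neg, sub_neg_eq_add]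

lemma im_cbfTransform_sub_div (ρ : Measure I) [IsFiniteMeasure ρ] {w : ℂ} (hw : w ∈ slitPlane) :
    (cbfTransform ρ w - cbfTransform ρ w / w).im =
      w.im * ∫ y : I, (‖(1 : ℂ) - (y : ℝ) + (y : ℝ) * w‖ ^ 2)⁻¹ ∂ρ := by
  have hdenom := cbfDenom_ne_zero hw
  have hint : Integrable (fun y : I ↦ (1 - (y : ℝ) + (y : ℝ) * w)⁻¹) ρ :=
    integrable_of_continuous (Continuous.inv₀ (by fun_prop) hdenom)
  have him := Complex.imCLM.integral_comp_comm ((integrable_cbfKernel ρ hw).sub hint)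
  simp only [Pi.sub_apply] at him
  rw [cbfTransform_div ρ (Complex.slitPlane_ne_zero hw), cbfTransform,
    ← integral_sub (integrable_cbfKernel ρ hw) hint, ← Complex.imCLM_apply, ← him,
    ← integral_const_mul]
  refine integral_congr_ae (.of_forall fun y ↦ ?_)
  have hnormSq := (Complex.normSq_pos.2 (hdenom y)).ne'
  simp only [Complex.imCLM_apply, cbfKernel, Complex.sub_im, Complex.div_im, Complex.inv_im,
    Complex.sub_re, Complex.add_re, Complex.add_im, Complex.re_ofReal_mul, Complex.im_ofReal_mul,
    Complex.ofReal_re, Complex.ofReal_im, Complex.one_re, Complex.one_im,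
    ← Complex.normSq_eq_norm_sq]
  field_simp
  ring

/-- Controls the masses of a family of measures by the values of their transforms at one point. -/
lemma abs_im_mul_mass_le (ρ : Measure I) [IsFiniteMeasure ρ] {w : ℂ} (hw : w ∈ slitPlane) :
    |w.im| * ρ.real univ ≤ (1 + ‖w‖) ^ 2 * ‖cbfTransform ρ w - cbfTransform ρ w / w‖ := by
  have hnorm (y : I) : 0 < ‖(1 : ℂ) - (y : ℝ) + (y : ℝ) * w‖ :=
    norm_pos_iff.2 (cbfDenom_ne_zero hw y)
  have hmass : ρ.real univ ≤
      (1 + ‖w‖) ^ 2 * ∫ y : I, (‖(1 : ℂ) - (y : ℝ) + (y : ℝ) * w‖ ^ 2)⁻¹ ∂ρ := by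
    have hcont : Continuous fun y : I ↦ (‖(1 : ℂ) - (y : ℝ) + (y : ℝ) * w‖ ^ 2)⁻¹ :=
      Continuous.inv₀ (by fun_prop) fun y ↦ (pow_pos (hnorm y) 2).ne'
    calc ρ.real univ = ∫ _, 1 ∂ρ := by simp
      _ ≤ ∫ y : I, (1 + ‖w‖) ^ 2 * (‖(1 : ℂ) - (y : ℝ) + (y : ℝ) * w‖ ^ 2)⁻¹ ∂ρ := by
        refine integral_mono (integrable_const _)
          ((integrable_of_continuous hcont).const_mul _) fun y ↦ ?_
        have := hnorm y
        rw [← div_eq_mul_inv, one_le_div (by positivity)]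
        gcongr
        exact norm_cbfDenom_le w y
      _ = _ := integral_const_mul _ _
  calc |w.im| * ρ.real univ
      ≤ |w.im| * ((1 + ‖w‖) ^ 2 * ∫ y : I, (‖(1 : ℂ) - (y : ℝ) + (y : ℝ) * w‖ ^ 2)⁻¹ ∂ρ) := by
        gcongr
    _ = (1 + ‖w‖) ^ 2 * |(cbfTransform ρ w - cbfTransform ρ w / w).im| := by
        rw [im_cbfTransform_sub_div ρ hw, abs_mul,
          abs_of_nonneg (integral_nonneg fun y ↦ by positivity), mul_left_comm]
    _ ≤ _ := by
        gcongr
        exact Complex.abs_im_le_norm _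

/-! ### From convolution powers to the integral representation -/

lemma neg_mem_slitPlane_of_im_pos {z : ℂ} (hz : 0 < z.im) : -z ∈ slitPlane :=
  Complex.mem_slitPlane_iff.2 (.inr (by simpa using hz.ne'))

lemma IsSectorPreserving.const_mul {f : ℂ → ℂ} (hf : IsSectorPreserving f) {c : ℝ} (hc : 0 ≤ c) :
    IsSectorPreserving fun w ↦ c * f w := by
  refine ⟨hf.differentiableOn.const_mul _, fun w hw ↦ ?_⟩
  obtain ⟨a, b, ha, hb, h⟩ := hf.mem_cone w hw
  exact ⟨c * a, c * b, by positivity, by positivity, by rw [h]; push_cast; ring⟩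

lemma IsVoiculescuTransform.reciprocalCauchy_add_eq {χ : ProbabilityMeasure ℝ} {φ : ℂ → ℂ}
    (h : IsVoiculescuTransform χ φ) {α M : ℝ} (hα : 0 < α) (hM : 0 ≤ M)
    (hφ : AnalyticOnNhd ℂ φ (truncatedCone α M))
    (him : ∀ z ∈ truncatedCone α M, 0 < (z + φ z).im) {z : ℂ} (hz : z ∈ truncatedCone α M) :
    reciprocalCauchy χ (z + φ z) = z := by
  obtain ⟨α₁, M₁, hα₁, -, h₁⟩ := isVoiculescuTransform_iff.1 h
  have hG : AnalyticOnNhd ℂ (fun z ↦ cauchyTransform χ (z + φ z) * z) (truncatedCone α M) :=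
    ((analyticOnNhd_cauchyTransform χ).comp (analyticOnNhd_id.add hφ) him).mul analyticOnNhd_id
  have hM' : 0 ≤ max M M₁ := hM.trans (le_max_left _ _)
  have hmem := mul_I_mem_truncatedCone (lt_min hα hα₁) hM' (lt_add_one _)
  have hone : EqOn (fun z ↦ cauchyTransform χ (z + φ z) * z) 1 (truncatedCone α M) := by
    refine hG.eqOn_of_preconnected_of_eventuallyEq analyticOnNhd_const
      (convex_truncatedCone α M).isPreconnected
      (truncatedCone_mono (min_le_left _ _) (le_max_left _ _) hM' hmem) ?_
    filter_upwards [(isOpen_truncatedCone _ _).mem_nhds hmem] with z hz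
    rw [h₁.cauchyTransform_add
      (truncatedCone_mono (min_le_right _ _) (le_max_right _ _) hM' hz), Pi.one_apply]
    exact inv_mul_cancel₀ fun h ↦ by simpa [h] using im_pos_of_mem_truncatedCone hM' hz
  exact (eq_one_div_of_mul_eq_one_right (hone hz)).symm

lemma exists_forall_mass_le_of_tendsto {ρ : ℕ → Measure I} [∀ n, IsFiniteMeasure (ρ n)]
    {v : ℕ → ℂ} {w L : ℂ} (hv : ∀ n, (v n).im ≠ 0) (hw : w.im ≠ 0) (hvw : Tendsto v atTop (𝓝 w))
    (hL : Tendsto (fun n ↦ cbfTransform (ρ n) (v n)) atTop (𝓝 L)) :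
    ∃ C, ∀ n, (ρ n).real univ ≤ C := by
  have hbound : Tendsto (fun n ↦ (1 + ‖v n‖) ^ 2 *
      ‖cbfTransform (ρ n) (v n) - cbfTransform (ρ n) (v n) / v n‖ / |(v n).im|) atTop
      (𝓝 ((1 + ‖w‖) ^ 2 * ‖L - L / w‖ / |w.im|)) := by
    have hw0 : w ≠ 0 := fun h ↦ hw (by simp [h])
    exact (((hvw.norm.const_add 1).pow 2).mul (hL.sub (hL.div hvw hw0)).norm).div
      ((Complex.continuous_im.tendsto _).comp hvw).abs (abs_pos.2 hw).ne'
  obtain ⟨C, hC⟩ := hbound.bddAbove_range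
  refine ⟨C, fun n ↦ le_trans ?_ (hC ⟨n, rfl⟩)⟩
  rw [le_div_iff₀ (abs_pos.2 (hv n)), mul_comm]
  exact abs_im_mul_mass_le (ρ n) (Complex.mem_slitPlane_iff.2 (.inr (hv n)))

lemma IsVoiculescuTransform.measure_singleton_zero_eq_zero {μ : ProbabilityMeasure ℝ}
    {ρ : Measure I} [IsFiniteMeasure ρ]
    (h : IsVoiculescuTransform μ fun z ↦ cbfTransform ρ (-z)) : ρ {0} = 0 := by
  obtain ⟨α, M, hα, hM, h⟩ := isVoiculescuTransform_iff.1 h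
  have := neBot_coneFilter (lt_min hα one_pos) hM.le
  have hlim := tendsto_nhds_unique (h.tendsto_div.mono_left
      (coneFilter_mono (min_le_left α 1) le_rfl hM.le))
    ((tendsto_add_cbfTransform_neg_div ρ M).mono_left
      (coneFilter_mono (min_le_right α 1) le_rfl hM.le))
  rw [eq_comm, sub_eq_self, Complex.ofReal_eq_zero] at hlim
  exact (measureReal_eq_zero_iff).1 hlim

section FreeConvPower

variable {μ χ : ProbabilityMeasure ℝ} {φ : ℂ → ℂ} {α M t : ℝ}

lemma IsVoiculescuTransformOn.im_add_mul_pos (hφ : IsVoiculescuTransformOn μ φ α M) (hM : 0 ≤ M)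
    (ht0 : 0 < t) (ht1 : t ≤ 1) {z : ℂ} (hz : z ∈ truncatedCone α M) :
    0 < (z + t * φ z).im := by
  have hone := (hφ.rightInverse z hz).1
  have hzero := im_pos_of_mem_truncatedCone hM hz
  simp only [Complex.add_im, Complex.im_ofReal_mul] at hone ⊢
  nlinarith

lemma IsFreeConvPower.reciprocalCauchy_add_eq (h : IsFreeConvPower μ t χ) (hα : 0 < α)
    (hM : 0 < M) (hφ : IsVoiculescuTransformOn μ φ α M) (ht0 : 0 < t) (ht1 : t ≤ 1) {z : ℂ}
    (hz : z ∈ truncatedCone α M) : reciprocalCauchy χ (z + t * φ z) = z := by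
  obtain ⟨φ', hφ', hχ⟩ := h
  obtain ⟨α', M', hα', -, heq⟩ :=
    hφ'.exists_eqOn (isVoiculescuTransform_iff.2 ⟨α, M, hα, hM, hφ⟩)
  have hχφ : IsVoiculescuTransform χ fun z ↦ t * φ z :=
    hχ.congr (M := M') hα' fun z hz ↦ by simp only [heq hz]
  exact hχφ.reciprocalCauchy_add_eq hα hM.le (analyticOnNhd_const.mul hφ.analyticOnNhd)
    (fun _ hz ↦ hφ.im_add_mul_pos hM.le ht0 ht1 hz) hz

-- The represented function is `w ↦ t⁻¹ (-F_χ(-w) - w)`, which is close to `w ↦ φ (-w)` for small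
-- `t`.
lemma IsFreeConvPower.exists_cbfTransform_eq (h : IsFreeConvPower μ t χ) (hα : 0 < α) (hM : 0 < M)
    (hφ : IsVoiculescuTransformOn μ φ α M) (ht0 : 0 < t) (ht1 : t ≤ 1)
    (hχ : (χ : Measure ℝ) (Iio 0) = 0) :
    ∃ ρ : Measure I, IsFiniteMeasure ρ ∧
      ∀ z ∈ truncatedCone α M, cbfTransform ρ (-(z + t * φ z)) = φ z := by
  obtain ⟨ρ, hρ, hrep⟩ := ((isSectorPreserving_neg_reciprocalCauchy_neg_sub hχ).const_mul
    (inv_nonneg.2 ht0.le)).exists_eqOn_cbfTransform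
  refine ⟨ρ, hρ, fun z hz ↦ ?_⟩
  have ht : (t : ℂ) ≠ 0 := Complex.ofReal_ne_zero.2 ht0.ne'
  rw [← hrep (neg_mem_slitPlane_of_im_pos (hφ.im_add_mul_pos hM.le ht0 ht1 hz))]
  simp only [neg_neg]
  rw [h.reciprocalCauchy_add_eq hα hM hφ ht0 ht1 hz]
  push_cast
  field_simp
  ring

lemma exists_cbfTransform_isVoiculescuTransform
    (h : ∀ t : ℝ, 0 < t → ∃ χ, IsFreeConvPower μ t χ ∧ (χ : Measure ℝ) (Iio 0) = 0) :
    ∃ ρ : Measure I, IsFiniteMeasure ρ ∧ ρ {0} = 0 ∧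
      IsVoiculescuTransform μ fun z ↦ cbfTransform ρ (-z) := by
  obtain ⟨-, ⟨φ, hφ, -⟩, -⟩ := h 1 one_pos
  obtain ⟨α, M, hα, hM, hφM⟩ := isVoiculescuTransform_iff.1 hφ
  obtain ⟨t, -, ht, htlim⟩ := exists_seq_strictAnti_tendsto' (one_pos (α := ℝ))
  choose χ hpow hχ using fun n ↦ h (t n) (ht n).1
  choose ρ hρ hrep using fun n ↦
    (hpow n).exists_cbfTransform_eq hα hM hφM (ht n).1 (ht n).2.le (hχ n)
  have him (n : ℕ) {z : ℂ} (hz : z ∈ truncatedCone α M) : 0 < (z + t n * φ z).im :=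
    hφM.im_add_mul_pos hM.le (ht n).1 (ht n).2.le hz
  have hlim (z : ℂ) : Tendsto (fun n ↦ -(z + t n * φ z)) atTop (𝓝 (-z)) := by
    simpa using
      ((((Complex.continuous_ofReal.tendsto _).comp htlim).mul_const (φ z)).const_add z).neg
  have hconst {z : ℂ} (hz : z ∈ truncatedCone α M) :
      Tendsto (fun n ↦ cbfTransform (ρ n) (-(z + t n * φ z))) atTop (𝓝 (φ z)) :=
    tendsto_const_nhds.congr fun n ↦ (hrep n z hz).symm
  have hz₀ := mul_I_mem_truncatedCone hα hM.le (lt_add_one M)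
  obtain ⟨C, hC⟩ := exists_forall_mass_le_of_tendsto
    (fun n ↦ by simpa only [Complex.neg_im] using neg_ne_zero.2 (him n hz₀).ne')
    (by simpa only [Complex.neg_im] using
      neg_ne_zero.2 (im_pos_of_mem_truncatedCone hM.le hz₀).ne') (hlim _) (hconst hz₀)
  obtain ⟨ρ', hρ', hρlim⟩ := exists_cbfTransform_eq_of_tendsto hC
  have hφρ : IsVoiculescuTransform μ fun z ↦ cbfTransform ρ' (-z) := by
    refine hφ.congr (M := M) hα fun z hz ↦ (hρlim _ (-z) (φ z)
      (fun n ↦ neg_mem_slitPlane_of_im_pos (him n hz))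
      (neg_mem_slitPlane_of_im_pos (im_pos_of_mem_truncatedCone hM.le hz)) (hlim z)
      (hconst hz)).symm
  exact ⟨ρ', hρ', hφρ.measure_singleton_zero_eq_zero, hφρ⟩

end FreeConvPower

/-! ### Existence of the measure with a given Voiculescu transform -/

section IterSolution

variable {f : ℂ → ℂ} {w : ℂ}

/-- The Picard iterates for the equation `Ψ w = w + f (Ψ w)`, whose solution `Ψ` is the inverse
function of `v ↦ v - f v`. -/
noncomputable def iterSolution (f : ℂ → ℂ) : ℕ → ℂ → ℂ
  | 0, w => w
  | k + 1, w => w + f (iterSolution f k w)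

lemma IsSectorPreserving.exists_iterSolution_eq_add_mul (hf : IsSectorPreserving f) (k : ℕ)
    (hw : w ∈ slitPlane) :
    ∃ a b : ℝ, 0 ≤ a ∧ 1 ≤ b ∧ iterSolution f k w = a + b * w := by
  induction k with
  | zero => exact ⟨0, 1, le_rfl, le_rfl, by simp [iterSolution]⟩
  | succ k ih =>
    obtain ⟨a, b, ha, hb, h⟩ := ih
    have hmem := add_mul_mem_slitPlane ha (zero_le_one.trans hb) (by linarith) hw
    obtain ⟨a', b', ha', hb', h'⟩ := hf.mem_cone _ hmem
    refine ⟨a' + b' * a, 1 + b' * b, by positivity, by nlinarith, ?_⟩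
    rw [iterSolution, h, h']
    push_cast
    ring

lemma IsSectorPreserving.iterSolution_mem_slitPlane (hf : IsSectorPreserving f) (k : ℕ)
    (hw : w ∈ slitPlane) : iterSolution f k w ∈ slitPlane := by
  obtain ⟨a, b, ha, hb, h⟩ := hf.exists_iterSolution_eq_add_mul k hw
  rw [h]
  exact add_mul_mem_slitPlane ha (zero_le_one.trans hb) (by linarith) hw

lemma IsSectorPreserving.differentiableOn_iterSolution (hf : IsSectorPreserving f) (k : ℕ) :
    DifferentiableOn ℂ (iterSolution f k) slitPlane := by
  induction k with
  | zero => exact differentiableOn_id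
  | succ k ih =>
    exact differentiableOn_id.add
      (hf.differentiableOn.comp ih fun _ hw ↦ hf.iterSolution_mem_slitPlane k hw)

lemma IsSectorPreserving.div_iterSolution (hf : IsSectorPreserving f) (k : ℕ) :
    IsSectorPreserving fun w ↦ w / iterSolution f k w := by
  refine ⟨differentiableOn_id.div (hf.differentiableOn_iterSolution k) fun w hw ↦
    Complex.slitPlane_ne_zero (hf.iterSolution_mem_slitPlane k hw), fun w hw ↦ ?_⟩
  obtain ⟨a, b, ha, hb, h⟩ := hf.exists_iterSolution_eq_add_mul k hw
  refine ⟨b * Complex.normSq w / Complex.normSq (iterSolution f k w),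
    a / Complex.normSq (iterSolution f k w),
    div_nonneg (mul_nonneg (by linarith) (Complex.normSq_nonneg w)) (Complex.normSq_nonneg _),
    div_nonneg ha (Complex.normSq_nonneg _), ?_⟩
  rw [div_eq_mul_inv, Complex.inv_def, h]
  push_cast
  rw [Complex.normSq_eq_conj_mul_self (z := w)]
  simp only [map_add, map_mul, Complex.conj_ofReal]
  ring

end IterSolution

lemma le_norm_add_mul_of_norm_sub_le {v v' : ℂ} {a b : ℝ} (ha : 0 ≤ a) (hb : 0 ≤ b)
    (hv : v ∈ wideSector) (h : ‖v' - v‖ ≤ 3 / 100 * ‖v‖) :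
    (1 / 4) * (a + b * ‖v‖) ≤ ‖(a : ℂ) + b * v'‖ := by
  have hdiff : ‖((a : ℂ) + b * v') - (a + b * v)‖ ≤ b * (3 / 100 * ‖v‖) := by
    rw [add_sub_add_left_eq_sub, ← mul_sub, norm_mul, Complex.norm_real, Real.norm_of_nonneg hb]
    gcongr
  have htriangle := norm_le_norm_add_norm_sub' ((a : ℂ) + b * v) (a + b * v')
  rw [norm_sub_rev] at htriangle
  nlinarith [le_norm_add_mul ha hb hv, mul_nonneg hb (norm_nonneg v)]

lemma mem_slitPlane_of_norm_sub_le {v v' : ℂ} (hv : v ∈ wideSector) (h0 : v ≠ 0)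
    (h : ‖v' - v‖ ≤ 3 / 100 * ‖v‖) : v' ∈ slitPlane := by
  rw [Complex.mem_slitPlane_iff_not_le_zero, Complex.nonpos_iff]
  rintro ⟨hre, him⟩
  have hv' : ((-v'.re : ℝ) : ℂ) + ((1 : ℝ) : ℂ) * v' = 0 :=
    Complex.ext (by simp) (by simp [him])
  have hle := le_norm_add_mul_of_norm_sub_le (neg_nonneg.2 hre) zero_le_one hv h
  rw [hv', norm_zero] at hle
  linarith [norm_pos_iff.2 h0]

lemma cbfKernel_sub_cbfKernel {v v' : ℂ} (hv : v ∈ slitPlane) (hv' : v' ∈ slitPlane) (y : I) :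
    cbfKernel v' y - cbfKernel v y = (1 - (y : ℝ)) * (v' - v) /
      ((1 - (y : ℝ) + (y : ℝ) * v) * (1 - (y : ℝ) + (y : ℝ) * v')) := by
  rw [cbfKernel, cbfKernel, div_sub_div _ _ (cbfDenom_ne_zero hv' y) (cbfDenom_ne_zero hv y),
    mul_comm (1 - ((y : ℝ) : ℂ) + (y : ℝ) * v')]
  ring

lemma norm_cbfKernel_sub_le {v v' : ℂ} (hv : v ∈ wideSector) (h1 : 1 ≤ ‖v‖)
    (h : ‖v' - v‖ ≤ 3 / 100 * ‖v‖) (y : I) :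
    ‖cbfKernel v' y - cbfKernel v y‖ ≤ 12 * (1 - (y : ℝ) + y * ‖v‖)⁻¹ * ‖v' - v‖ := by
  have h0 : v ≠ 0 := norm_pos_iff.1 (by linarith)
  rw [cbfKernel_sub_cbfKernel (mem_slitPlane_of_mem_wideSector hv h0)
    (mem_slitPlane_of_norm_sub_le hv h0 h), norm_div, norm_mul, norm_mul]
  set d : ℝ := 1 - (y : ℝ) + y * ‖v‖
  have hd : 1 ≤ d := one_le_cbfDenom h1 y
  have hv'd : (1 / 4) * d ≤ ‖(1 : ℂ) - (y : ℝ) + (y : ℝ) * v'‖ := by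
    simpa using le_norm_add_mul_of_norm_sub_le (sub_nonneg.2 y.2.2) y.2.1 hv h
  have hdenom : (1 / 12) * d ≤
      ‖(1 : ℂ) - (y : ℝ) + (y : ℝ) * v‖ * ‖(1 : ℂ) - (y : ℝ) + (y : ℝ) * v'‖ :=
    calc (1 / 12) * d ≤ ((1 / 3) * d) * ((1 / 4) * d) := by nlinarith
      _ ≤ _ := mul_le_mul (le_norm_cbfDenom hv y) hv'd (by positivity) (norm_nonneg _)
  calc _ ≤ 1 * ‖v' - v‖ / ((1 / 12) * d) := by gcongr; exact norm_one_sub_coe_le_one y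
    _ = 12 * d⁻¹ * ‖v' - v‖ := by field_simp

lemma cbfKernel_neg_eq_mul (z : ℂ) {y : I} (hy : (y : ℝ) ≠ 0) :
    cbfKernel (-z) y = z * ((y : ℝ)⁻¹ • (z - ((1 - (y : ℝ)) / y : ℝ))⁻¹) := by
  have hyC : ((y : ℝ) : ℂ) ≠ 0 := Complex.ofReal_ne_zero.2 hy
  have hdenom : (1 : ℂ) - (y : ℝ) + (y : ℝ) * -z =
      -((y : ℝ) : ℂ) * (z - ((1 - (y : ℝ)) / y : ℝ)) := by
    push_cast
    field_simp
    ring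
  rw [cbfKernel, hdenom, neg_mul, neg_div_neg_eq, Complex.real_smul, Complex.ofReal_inv, ← mul_inv,
    div_eq_mul_inv]

lemma exists_probabilityMeasure_cbfTransform_neg_eq {ρ : Measure I}
    (h : ∫⁻ y : I, (ENNReal.ofReal y)⁻¹ ∂ρ = 1) :
    ∃ μ : ProbabilityMeasure ℝ, (μ : Measure ℝ) (Iio 0) = 0 ∧
      ∀ z, cbfTransform ρ (-z) = z * cauchyTransform μ z := by
  set P : Measure I := ρ.withDensity fun y ↦ (ENNReal.ofReal y)⁻¹ with hP
  have : IsProbabilityMeasure P := ⟨by rw [hP, withDensity_apply _ .univ, setLIntegral_univ, h]⟩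
  have hmeas : Measurable fun y : I ↦ (1 - (y : ℝ)) / y := by fun_prop
  refine ⟨⟨P.map fun y : I ↦ (1 - (y : ℝ)) / y,
    Measure.isProbabilityMeasure_map hmeas.aemeasurable⟩, ?_, fun z ↦ ?_⟩
  · have hempty : (fun y : I ↦ (1 - (y : ℝ)) / y) ⁻¹' Iio 0 = ∅ :=
      eq_empty_of_forall_notMem fun y ↦ (div_nonneg (sub_nonneg.2 y.2.2) y.2.1).not_gt
    rw [ProbabilityMeasure.coe_mk, Measure.map_apply hmeas measurableSet_Iio, hempty, measure_empty]
  · have hfin : ∀ᵐ y : I ∂ρ, (ENNReal.ofReal y)⁻¹ < ∞ := ae_lt_top (by fun_prop) (by simp [h])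
    simp only [cauchyTransform, ProbabilityMeasure.coe_mk]
    rw [integral_map hmeas.aemeasurable (Measurable.aestronglyMeasurable (by fun_prop)), hP,
      integral_withDensity_eq_integral_toReal_smul (by fun_prop) hfin, ← integral_const_mul,
      cbfTransform]
    refine integral_congr_ae ?_
    filter_upwards [hfin] with y hy
    have hy0 : (y : ℝ) ≠ 0 := fun h0 ↦ by simp [h0] at hy
    rw [ENNReal.toReal_inv, ENNReal.toReal_ofReal y.2.1, cbfKernel_neg_eq_mul z hy0]
    simp only [one_div]

section CbfRatio

variable {ρ : Measure I} {v v' : ℂ}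

/-- The ratio `f r / r` for the complete Bernstein function `f` represented by `ρ`. -/
noncomputable def cbfRatio (ρ : Measure I) (r : ℝ) : ℝ := ∫ y : I, (1 - (y : ℝ) + y * r)⁻¹ ∂ρ

lemma cbfTransform_ofReal_eq_mul_cbfRatio (ρ : Measure I) (r : ℝ) :
    cbfTransform ρ r = ((r * cbfRatio ρ r : ℝ) : ℂ) := by
  rw [cbfTransform_ofReal, cbfRatio, ← integral_const_mul]
  simp only [div_eq_mul_inv]

lemma ofReal_sub_cbfTransform (ρ : Measure I) (r : ℝ) :
    (r : ℂ) - cbfTransform ρ r = ((r * (1 - cbfRatio ρ r) : ℝ) : ℂ) := by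
  rw [cbfTransform_ofReal_eq_mul_cbfRatio]
  push_cast
  ring

/-- The region of the wide sector in which `f` is small compared to the identity, `f` being the
function represented by `ρ`; there `v ↦ v - f v` can be inverted by Picard iteration. -/
def smallRatioRegion (ρ : Measure I) : Set ℂ :=
  {v | v ∈ wideSector ∧ 1 ≤ ‖v‖ ∧ cbfRatio ρ ‖v‖ ≤ 1 / 100}

lemma ne_zero_of_mem_smallRatioRegion (hv : v ∈ smallRatioRegion ρ) : v ≠ 0 :=
  norm_pos_iff.1 (one_pos.trans_le hv.2.1)

variable [IsFiniteMeasure ρ]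

lemma integrable_inv_cbfDenom {r : ℝ} (hr : 0 < r) :
    Integrable (fun y : I ↦ (1 - (y : ℝ) + y * r)⁻¹) ρ :=
  integrable_of_continuous (Continuous.inv₀ (by fun_prop) fun y ↦ (cbfDenom_pos hr y).ne')

lemma tendsto_cbfRatio (ρ : Measure I) [IsFiniteMeasure ρ] :
    Tendsto (cbfRatio ρ) atTop (𝓝 (ρ.real {0})) := by
  refine ((Complex.continuous_re.tendsto _).comp ((tendsto_cbfTransform_div ρ).comp
    tendsto_ofReal_coboundedWithin_wideSector)).congr' ?_
  filter_upwards [eventually_gt_atTop 0] with r hr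
  rw [Function.comp_apply, Function.comp_apply, cbfTransform_ofReal_eq_mul_cbfRatio,
    ← Complex.ofReal_div, Complex.ofReal_re, mul_div_cancel_left₀ _ hr.ne']

lemma norm_cbfTransform_le (hv : v ∈ wideSector) (h0 : v ≠ 0) :
    ‖cbfTransform ρ v‖ ≤ 3 * ‖v‖ * cbfRatio ρ ‖v‖ := by
  have hdiv : cbfTransform ρ v = v * ∫ y : I, (1 - (y : ℝ) + (y : ℝ) * v)⁻¹ ∂ρ := by
    rw [← cbfTransform_div ρ h0, mul_div_cancel₀ _ h0]
  rw [hdiv, norm_mul, mul_right_comm, mul_comm _ ‖v‖, cbfRatio, ← integral_const_mul]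
  gcongr
  exact norm_integral_le_of_norm_le ((integrable_inv_cbfDenom (norm_pos_iff.2 h0)).const_mul 3)
    (.of_forall (norm_inv_cbfDenom_le hv h0))

lemma norm_cbfTransform_sub_le (hv : v ∈ wideSector) (h1 : 1 ≤ ‖v‖)
    (h : ‖v' - v‖ ≤ 3 / 100 * ‖v‖) :
    ‖cbfTransform ρ v' - cbfTransform ρ v‖ ≤ 12 * cbfRatio ρ ‖v‖ * ‖v' - v‖ := by
  have hpos : 0 < ‖v‖ := by linarith
  have h0 : v ≠ 0 := norm_pos_iff.1 hpos
  rw [cbfTransform, cbfTransform, ← integral_sub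
    (integrable_cbfKernel ρ (mem_slitPlane_of_norm_sub_le hv h0 h))
    (integrable_cbfKernel ρ (mem_slitPlane_of_mem_wideSector hv h0)), cbfRatio,
    ← integral_const_mul, ← integral_mul_const]
  exact norm_integral_le_of_norm_le (((integrable_inv_cbfDenom hpos).const_mul 12).mul_const _)
    (.of_forall (norm_cbfKernel_sub_le hv h1 h))

lemma norm_cbfTransform_le_of_mem_smallRatioRegion (hv : v ∈ smallRatioRegion ρ) :
    ‖cbfTransform ρ v‖ ≤ 3 / 100 * ‖v‖ :=
  calc ‖cbfTransform ρ v‖ ≤ 3 * ‖v‖ * cbfRatio ρ ‖v‖ :=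
        norm_cbfTransform_le hv.1 (ne_zero_of_mem_smallRatioRegion hv)
    _ ≤ 3 * ‖v‖ * (1 / 100) := by gcongr; exact hv.2.2
    _ = 3 / 100 * ‖v‖ := by ring

lemma sub_cbfTransform_mem_slitPlane (hv : v ∈ smallRatioRegion ρ) :
    v - cbfTransform ρ v ∈ slitPlane := by
  refine mem_slitPlane_of_norm_sub_le hv.1 (ne_zero_of_mem_smallRatioRegion hv) ?_
  rw [sub_sub_cancel_left, norm_neg]
  exact norm_cbfTransform_le_of_mem_smallRatioRegion hv

lemma norm_iterSolution_sub_le (hv : v ∈ smallRatioRegion ρ) (k : ℕ) :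
    ‖iterSolution (cbfTransform ρ) k (v - cbfTransform ρ v) - v‖ ≤
      (1 / 2) ^ k * (3 / 100 * ‖v‖) := by
  induction k with
  | zero =>
    rw [iterSolution, sub_sub_cancel_left, norm_neg, pow_zero, one_mul]
    exact norm_cbfTransform_le_of_mem_smallRatioRegion hv
  | succ k ih =>
    have hclose := ih.trans
      (mul_le_of_le_one_left (by positivity) (pow_le_one₀ (by norm_num) (by norm_num)))
    rw [iterSolution, sub_add_eq_add_sub, add_sub_assoc, add_sub_cancel_left]
    calc _ ≤ 12 * cbfRatio ρ ‖v‖ * _ := norm_cbfTransform_sub_le hv.1 hv.2.1 hclose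
      _ ≤ 12 * (1 / 100) * ((1 / 2) ^ k * (3 / 100 * ‖v‖)) := by gcongr; exact hv.2.2
      _ ≤ (1 / 2) ^ (k + 1) * (3 / 100 * ‖v‖) := by
        have : 0 ≤ (1 / 2 : ℝ) ^ k * (3 / 100 * ‖v‖) := by positivity
        rw [pow_succ]
        linarith

lemma tendsto_iterSolution (hv : v ∈ smallRatioRegion ρ) :
    Tendsto (fun k ↦ iterSolution (cbfTransform ρ) k (v - cbfTransform ρ v)) atTop (𝓝 v) := by
  rw [tendsto_iff_norm_sub_tendsto_zero]
  refine squeeze_zero (fun _ ↦ norm_nonneg _) (norm_iterSolution_sub_le hv) ?_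
  simpa only [zero_mul] using (tendsto_pow_atTop_nhds_zero_of_lt_one (by norm_num : (0 : ℝ) ≤ 1 / 2)
    (by norm_num)).mul_const (3 / 100 * ‖v‖)

-- The functions `w ↦ w / Ψ w` are sector preserving for the iterates `Ψ`, hence also in the limit.
lemma exists_cbfTransform_sub_eq_div (ρ : Measure I) [IsFiniteMeasure ρ] :
    ∃ ρ' : Measure I, IsFiniteMeasure ρ' ∧ ∀ v ∈ smallRatioRegion ρ,
      cbfTransform ρ' (v - cbfTransform ρ v) = (v - cbfTransform ρ v) / v := by
  have hf := isSectorPreserving_cbfTransform ρ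
  choose τ hτ hrep using fun k ↦ (hf.div_iterSolution k).exists_eqOn_cbfTransform
  have hmass (k : ℕ) : (τ k).real univ ≤ 1 := by
    obtain ⟨a, b, ha, hb, h⟩ := hf.exists_iterSolution_eq_add_mul k Complex.one_mem_slitPlane
    have hone : ((1 / (a + b) : ℝ) : ℂ) = (τ k).real univ := by
      rw [← cbfTransform_one, ← hrep k Complex.one_mem_slitPlane]
      simp only [h]
      push_cast
      rw [mul_one]
    rw [← Complex.ofReal_injective hone, div_le_one (by linarith)]
    linarith
  obtain ⟨ρ', hρ', hlim⟩ := exists_cbfTransform_eq_of_tendsto hmass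
  refine ⟨ρ', hρ', fun v hv ↦ ?_⟩
  have hw := sub_cbfTransform_mem_slitPlane hv
  refine hlim (fun _ ↦ v - cbfTransform ρ v) _ _ (fun _ ↦ hw) hw tendsto_const_nhds ?_
  exact (tendsto_const_nhds.div (tendsto_iterSolution hv)
    (ne_zero_of_mem_smallRatioRegion hv)).congr fun k ↦ hrep k hw

lemma ofReal_mul_inv_cbfDenom_le {r : ℝ} (hr : 0 < r) (y : I) :
    ENNReal.ofReal (r * (1 - (y : ℝ) + y * r)⁻¹) ≤ (ENNReal.ofReal y)⁻¹ := by
  rcases y.2.1.eq_or_lt with hy | hy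
  · simp [← hy]
  · rw [← ENNReal.ofReal_inv_of_pos hy]
    refine ENNReal.ofReal_le_ofReal ?_
    rw [← div_eq_mul_inv, div_le_iff₀ (cbfDenom_pos hr y), inv_mul_eq_div, le_div_iff₀ hy]
    linarith [y.2.2]

lemma tendsto_ofReal_mul_inv_cbfDenom (y : I) :
    Tendsto (fun r : ℝ ↦ ENNReal.ofReal (r * (1 - (y : ℝ) + y * r)⁻¹)) atTop
      (𝓝 (ENNReal.ofReal y)⁻¹) := by
  rcases y.2.1.eq_or_lt with hy | hy
  · simpa [← hy] using ENNReal.tendsto_ofReal_nhds_top.2 tendsto_id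
  · rw [← ENNReal.ofReal_inv_of_pos hy]
    refine ENNReal.tendsto_ofReal ?_
    have hlim : Tendsto (fun r : ℝ ↦ ((1 - (y : ℝ)) / r + y)⁻¹) atTop (𝓝 (0 + (y : ℝ))⁻¹) :=
      ((tendsto_id.const_div_atTop _).add_const _).inv₀ (by rw [zero_add]; exact hy.ne')
    rw [zero_add] at hlim
    refine hlim.congr' ?_
    filter_upwards [eventually_gt_atTop 0] with r hr
    field_simp

lemma lintegral_inv_ofReal_eq_of_tendsto {x : ℝ → ℝ} {a : ℝ} (hx : Tendsto x atTop atTop)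
    (h : Tendsto (fun r ↦ x r * cbfRatio ρ (x r)) atTop (𝓝 a)) :
    ∫⁻ y : I, (ENNReal.ofReal y)⁻¹ ∂ρ = ENNReal.ofReal a := by
  have hlim : Tendsto (fun r ↦ ∫⁻ y : I, ENNReal.ofReal (x r * (1 - (y : ℝ) + y * x r)⁻¹) ∂ρ)
      atTop (𝓝 (ENNReal.ofReal a)) := by
    refine (ENNReal.tendsto_ofReal h).congr' ?_
    filter_upwards [hx.eventually_gt_atTop 0] with r hr
    rw [cbfRatio, ← integral_const_mul]
    exact ofReal_integral_eq_lintegral_ofReal ((integrable_inv_cbfDenom hr).const_mul _)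
      (.of_forall fun y ↦ mul_nonneg hr.le (inv_nonneg.2 (cbfDenom_pos hr y).le))
  refine le_antisymm ?_ (le_of_tendsto hlim ?_)
  · calc ∫⁻ y : I, (ENNReal.ofReal y)⁻¹ ∂ρ
        = ∫⁻ y : I,
          liminf (fun r ↦ ENNReal.ofReal (x r * (1 - (y : ℝ) + y * x r)⁻¹)) atTop ∂ρ :=
          lintegral_congr fun y ↦ ((tendsto_ofReal_mul_inv_cbfDenom y).comp hx).liminf_eq.symm
      _ ≤ _ := lintegral_liminf_le fun r ↦ by fun_prop
      _ = ENNReal.ofReal a := hlim.liminf_eq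
  · filter_upwards [hx.eventually_gt_atTop 0] with r hr
    exact lintegral_mono (ofReal_mul_inv_cbfDenom_le hr)

lemma exists_forall_mem_smallRatioRegion (h0 : ρ {0} = 0) :
    ∃ R : ℝ, 1 ≤ R ∧ ∀ v ∈ wideSector, R ≤ ‖v‖ → v ∈ smallRatioRegion ρ := by
  have hlim := tendsto_cbfRatio ρ
  rw [measureReal_def, h0, ENNReal.toReal_zero] at hlim
  obtain ⟨R, hR⟩ := eventually_atTop.1
    (hlim.eventually_le_const (by norm_num : (0 : ℝ) < 1 / 100))
  exact ⟨max R 1, le_max_right _ _, fun v hv hle ↦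
    ⟨hv, (le_max_right _ _).trans hle, hR _ ((le_max_left _ _).trans hle)⟩⟩

lemma exists_probabilityMeasure_mul_cauchyTransform_eq (h0 : ρ {0} = 0) :
    ∃ μ : ProbabilityMeasure ℝ, (μ : Measure ℝ) (Iio 0) = 0 ∧
      ∀ v ∈ smallRatioRegion ρ, -v + cbfTransform ρ v ≠ 0 →
        cauchyTransform μ (-v + cbfTransform ρ v) = -v⁻¹ := by
  obtain ⟨ρ', hρ', heq⟩ := exists_cbfTransform_sub_eq_div ρ
  obtain ⟨R, hR, hmem⟩ := exists_forall_mem_smallRatioRegion h0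
  have hratio : Tendsto (fun r ↦ 1 - cbfRatio ρ r) atTop (𝓝 1) := by
    simpa [measureReal_def, h0] using (tendsto_cbfRatio ρ).const_sub 1
  have hlintegral : ∫⁻ y : I, (ENNReal.ofReal y)⁻¹ ∂ρ' = ENNReal.ofReal 1 := by
    refine lintegral_inv_ofReal_eq_of_tendsto (tendsto_id.atTop_mul_pos one_pos hratio)
      (hratio.congr' ?_)
    filter_upwards [eventually_ge_atTop R] with r hr
    have hr0 : 0 < r := by linarith
    have hr' := heq r (hmem r (ofReal_mem_wideSector hr0.le)
      (by rwa [Complex.norm_real, Real.norm_of_nonneg hr0.le]))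
    rw [ofReal_sub_cbfTransform, cbfTransform_ofReal_eq_mul_cbfRatio, ← Complex.ofReal_div,
      Complex.ofReal_inj, mul_div_cancel_left₀ _ hr0.ne'] at hr'
    exact hr'.symm
  obtain ⟨μ, hμ0, hμ⟩ :=
    exists_probabilityMeasure_cbfTransform_neg_eq (hlintegral.trans ENNReal.ofReal_one)
  refine ⟨μ, hμ0, fun v hv hne ↦ ?_⟩
  have hv' := heq v hv
  rw [show v - cbfTransform ρ v = -(-v + cbfTransform ρ v) by ring, hμ, neg_div,
    div_eq_mul_inv, ← mul_neg] at hv'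
  exact mul_left_cancel₀ hne hv'

theorem exists_isVoiculescuTransform_cbfTransform (h0 : ρ {0} = 0) :
    ∃ μ : ProbabilityMeasure ℝ, (μ : Measure ℝ) (Iio 0) = 0 ∧
      IsVoiculescuTransform μ fun z ↦ cbfTransform ρ (-z) := by
  obtain ⟨R, hR, hmem⟩ := exists_forall_mem_smallRatioRegion h0
  obtain ⟨μ, hμ0, hμ⟩ := exists_probabilityMeasure_mul_cauchyTransform_eq h0
  have hR0 : 0 < R := by linarith
  refine ⟨μ, hμ0, isVoiculescuTransform_iff.2 ⟨1, R, one_pos, hR0, ?_, fun z hz ↦ ?_, ?_⟩⟩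
  · refine DifferentiableOn.analyticOnNhd ?_ (isOpen_truncatedCone 1 R)
    exact (differentiableOn_cbfTransform ρ).comp differentiableOn_id.neg fun z hz ↦
      neg_mem_slitPlane_of_im_pos (im_pos_of_mem_truncatedCone hR0.le hz)
  · have him := im_pos_of_mem_truncatedCone hR0.le hz
    have hregion : -z ∈ smallRatioRegion ρ := hmem _ (neg_mem_wideSector hz) <| by
      rw [norm_neg]
      exact hz.2.le.trans ((le_abs_self _).trans (Complex.abs_im_le_norm z))
    have hpos : 0 < (z + cbfTransform ρ (-z)).im := by
      have hbound := norm_cbfTransform_le_of_mem_smallRatioRegion hregion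
      have hnorm := norm_le_of_mem_truncatedCone hR0.le hz
      have hle := neg_le_of_abs_le (Complex.abs_im_le_norm (cbfTransform ρ (-z)))
      rw [norm_neg] at hbound
      rw [Complex.add_im]
      linarith
    have hcauchy := hμ _ hregion fun h ↦ hpos.ne' <| by
      rw [neg_neg] at h
      rw [h, Complex.zero_im]
    rw [neg_neg, inv_neg, neg_neg] at hcauchy
    exact ⟨hpos, by rw [reciprocalCauchy, hcauchy, one_div, inv_inv]⟩
  · simpa [measureReal_def, h0] using tendsto_add_cbfTransform_neg_div ρ R

end CbfRatio

/-! ### Functions with an integral representation are complete Bernstein functions -/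

open ProbabilityTheory in
lemma isCompletelyMonotone_mgf {Ω : Type*} [MeasurableSpace Ω] {μ : Measure Ω} {X : Ω → ℝ}
    (hX : ∀ ω, X ω ≤ 0) (hint : ∀ r, 0 < r → Integrable (fun ω ↦ Real.exp (r * X ω)) μ) :
    IsCompletelyMonotone (mgf X μ) := by
  have hsub : Ioi 0 ⊆ interior (integrableExpSet X μ) := interior_maximal hint isOpen_Ioi
  refine ⟨(analyticOn_mgf.mono hsub).contDiffOn (uniqueDiffOn_Ioi 0), fun n r hr ↦ ?_⟩
  rw [iteratedDeriv_mgf (hsub hr), ← integral_const_mul]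
  refine integral_nonneg fun ω ↦ ?_
  rw [Pi.zero_apply, ← mul_assoc, ← mul_pow, neg_one_mul]
  have : 0 ≤ -X ω := neg_nonneg.2 (hX ω)
  positivity

lemma one_sub_exp_neg_nonneg {x : ℝ} (hx : 0 ≤ x) : 0 ≤ 1 - Real.exp (-x) :=
  sub_nonneg.2 (Real.exp_le_one_iff.2 (neg_nonpos.2 hx))

lemma one_sub_exp_neg_mul_exp_neg (s z r : ℝ) :
    (1 - Real.exp (-(z * r))) * Real.exp (-(s * r)) =
      Real.exp (-s * r) - Real.exp (-(s + z) * r) := by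
  rw [sub_mul, one_mul, ← Real.exp_add]
  ring_nf

lemma integrableOn_one_sub_exp_mul_exp {s z : ℝ} (hs : 0 < s) (hz : 0 ≤ z) :
    IntegrableOn (fun r ↦ (1 - Real.exp (-(z * r))) * Real.exp (-(s * r))) (Ioi 0) := by
  simp_rw [one_sub_exp_neg_mul_exp_neg]
  exact (integrableOn_exp_mul_Ioi (by linarith) 0).sub (integrableOn_exp_mul_Ioi (by linarith) 0)

lemma integral_one_sub_exp_mul_exp {s z : ℝ} (hs : 0 < s) (hz : 0 ≤ z) :
    ∫ r in Ioi (0 : ℝ), (1 - Real.exp (-(z * r))) * Real.exp (-(s * r)) = z / (s * (s + z)) := by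
  simp_rw [one_sub_exp_neg_mul_exp_neg]
  rw [integral_sub (integrableOn_exp_mul_Ioi (by linarith) 0)
    (integrableOn_exp_mul_Ioi (by linarith) 0), integral_exp_mul_Ioi (by linarith),
    integral_exp_mul_Ioi (by linarith), mul_zero, mul_zero, Real.exp_zero, neg_div_neg_eq,
    neg_div_neg_eq]
  have : s + z ≠ 0 := by linarith
  field_simp
  ring

lemma lintegral_one_sub_exp_mul_exp {s z : ℝ} (hs : 0 < s) (hz : 0 ≤ z) :
    ∫⁻ r in Ioi (0 : ℝ), ENNReal.ofReal ((1 - Real.exp (-(z * r))) * Real.exp (-(s * r))) =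
      ENNReal.ofReal (z / (s * (s + z))) := by
  rw [← integral_one_sub_exp_mul_exp hs hz,
    ofReal_integral_eq_lintegral_ofReal (integrableOn_one_sub_exp_mul_exp hs hz)]
  filter_upwards [ae_restrict_mem measurableSet_Ioi] with r hr
  exact mul_nonneg (one_sub_exp_neg_nonneg (mul_nonneg hz (le_of_lt hr))) (Real.exp_nonneg _)

lemma lintegral_mgf_mul_one_sub_exp {Ω : Type*} [MeasurableSpace Ω] {μ : Measure Ω} [SFinite μ]
    {X : Ω → ℝ} (hXm : Measurable X) (hX : ∀ᵐ ω ∂μ, X ω < 0)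
    (hint : ∀ r, 0 < r → Integrable (fun ω ↦ Real.exp (r * X ω)) μ) {z : ℝ} (hz : 0 ≤ z) :
    ∫⁻ r in Ioi (0 : ℝ), ENNReal.ofReal (ProbabilityTheory.mgf X μ r) *
        ENNReal.ofReal (1 - Real.exp (-(z * r))) =
      ∫⁻ ω, ENNReal.ofReal (z / (-X ω * (-X ω + z))) ∂μ := by
  calc ∫⁻ r in Ioi (0 : ℝ), ENNReal.ofReal (ProbabilityTheory.mgf X μ r) *
        ENNReal.ofReal (1 - Real.exp (-(z * r)))
    _ = ∫⁻ r in Ioi (0 : ℝ), ∫⁻ ω, ENNReal.ofReal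
        ((1 - Real.exp (-(z * r))) * Real.exp (-(-X ω * r))) ∂μ := by
      refine setLIntegral_congr_fun measurableSet_Ioi fun r hr ↦ ?_
      rw [ProbabilityTheory.mgf, ofReal_integral_eq_lintegral_ofReal (hint r hr)
        (.of_forall fun ω ↦ Real.exp_nonneg _), ← lintegral_mul_const _ (by fun_prop)]
      refine lintegral_congr fun ω ↦ ?_
      rw [← ENNReal.ofReal_mul (Real.exp_nonneg _), mul_comm, neg_mul, neg_neg, mul_comm r]
    _ = ∫⁻ ω, (∫⁻ r in Ioi (0 : ℝ), ENNReal.ofReal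
        ((1 - Real.exp (-(z * r))) * Real.exp (-(-X ω * r)))) ∂μ :=
      lintegral_lintegral_swap (by fun_prop)
    _ = _ := lintegral_congr_ae (hX.mono fun ω h ↦
      lintegral_one_sub_exp_mul_exp (neg_pos.2 h) hz)

/-- The substitution `y = 1 / (1 + s)` under which `cbfKernel w y` becomes
`w (1 + s) / (s + w)`. At `y = 0` the value is `0`, by division by zero. -/
noncomputable def rate (y : I) : ℝ := (1 - y) / y

lemma rate_nonneg (y : I) : 0 ≤ rate y := div_nonneg (sub_nonneg.2 y.2.2) y.2.1

lemma rate_eq_zero_iff {y : I} : rate y = 0 ↔ y ∈ ({0, 1} : Set I) := by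
  rw [rate, div_eq_zero_iff, sub_eq_zero, mem_insert_iff, mem_singleton_iff, or_comm,
    Icc.coe_eq_zero, @eq_comm _ 1, Icc.coe_eq_one]

@[fun_prop]
lemma measurable_rate : Measurable rate := by
  unfold rate
  fun_prop

/-- The measure of which the Lévy density of `cbfTransform ρ` is the Laplace transform in the
variable `rate`. -/
noncomputable def rateMeasure (ρ : Measure I) : Measure I :=
  ρ.withDensity fun y ↦ ENNReal.ofReal (rate y * (1 + rate y))

instance (ρ : Measure I) [IsFiniteMeasure ρ] : SigmaFinite (rateMeasure ρ) :=
  SigmaFinite.withDensity_ofReal _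

lemma ae_rateMeasure_rate_pos (ρ : Measure I) : ∀ᵐ y ∂rateMeasure ρ, 0 < rate y := by
  refine (ae_withDensity_iff (by fun_prop)).2 (.of_forall fun y h ↦ ?_)
  refine (rate_nonneg y).lt_of_ne' fun h0 ↦ h ?_
  rw [h0, zero_mul, ENNReal.ofReal_zero]

lemma mul_one_add_mul_exp_neg_le {s r : ℝ} (hs : 0 ≤ s) (hr : 0 < r) :
    s * (1 + s) * Real.exp (r * -s) ≤ 1 / r + 2 / r ^ 2 := by
  rw [mul_neg, Real.exp_neg, ← div_eq_mul_inv, div_le_iff₀ (Real.exp_pos _)]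
  calc s * (1 + s) = 1 / r * (r * s) + 2 / r ^ 2 * ((r * s) ^ 2 / 2) := by field_simp
    _ ≤ 1 / r * Real.exp (r * s) + 2 / r ^ 2 * Real.exp (r * s) := by
      have h := Real.quadratic_le_exp_of_nonneg (mul_nonneg hr.le hs)
      gcongr <;> nlinarith [mul_nonneg hr.le hs, sq_nonneg (r * s)]
    _ = _ := by ring

lemma integrable_exp_mul_neg_rate (ρ : Measure I) [IsFiniteMeasure ρ] {r : ℝ} (hr : 0 < r) :
    Integrable (fun y ↦ Real.exp (r * -rate y)) (rateMeasure ρ) := by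
  rw [rateMeasure, integrable_withDensity_iff_integrable_smul' (by fun_prop)
    (.of_forall fun _ ↦ ENNReal.ofReal_lt_top)]
  refine .of_bound (by fun_prop) (1 / r + 2 / r ^ 2) (.of_forall fun y ↦ ?_)
  have hs := rate_nonneg y
  rw [ENNReal.toReal_ofReal (by positivity), smul_eq_mul, Real.norm_of_nonneg (by positivity)]
  exact mul_one_add_mul_exp_neg_le hs hr

lemma rate_mul_one_add_rate_mul {y : I} (hy : y ∉ ({0, 1} : Set I)) {z : ℝ} (hz : 0 ≤ z) :
    rate y * (1 + rate y) * (z / (rate y * (rate y + z))) = z / (1 - y + y * z) := by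
  have hs : 0 < rate y := (rate_nonneg y).lt_of_ne' fun h ↦ hy (rate_eq_zero_iff.1 h)
  have hy0 : 0 < (y : ℝ) := unitInterval.pos_iff_ne_zero.2 fun h ↦ hy (.inl h)
  have h1 : 1 + rate y = 1 / y := by
    rw [rate]
    field_simp
    ring
  have h2 : 1 - y + y * z = y * (rate y + z) := by
    rw [rate]
    field_simp
  rw [h1, h2]
  have : rate y + z ≠ 0 := by positivity
  field_simp

/-- The Lévy density of `cbfTransform ρ`. -/
noncomputable def levyDensity (ρ : Measure I) : ℝ → ℝ :=
  ProbabilityTheory.mgf (fun y ↦ -rate y) (rateMeasure ρ)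

section LevyDensity

variable (ρ : Measure I) [IsFiniteMeasure ρ]

lemma isCompletelyMonotone_levyDensity : IsCompletelyMonotone (levyDensity ρ) :=
  isCompletelyMonotone_mgf (fun y ↦ neg_nonpos.2 (rate_nonneg y))
    fun _ ↦ integrable_exp_mul_neg_rate ρ

lemma lintegral_levyDensity {z : ℝ} (hz : 0 ≤ z) :
    ∫⁻ r in Ioi (0 : ℝ), ENNReal.ofReal (levyDensity ρ r) *
      ENNReal.ofReal (1 - Real.exp (-(z * r))) =
    ∫⁻ y in {0, 1}ᶜ, ENNReal.ofReal (z / (1 - (y : ℝ) + y * z)) ∂ρ := by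
  rw [levyDensity, lintegral_mgf_mul_one_sub_exp (by fun_prop)
    ((ae_rateMeasure_rate_pos ρ).mono fun y h ↦ neg_neg_iff_pos.2 h)
    (fun _ ↦ integrable_exp_mul_neg_rate ρ) hz, rateMeasure,
    lintegral_withDensity_eq_lintegral_mul _ (by fun_prop) (by fun_prop),
    ← lintegral_indicator (by measurability)]
  refine lintegral_congr fun y ↦ ?_
  have hs := rate_nonneg y
  rw [Pi.mul_apply, ← ENNReal.ofReal_mul (by positivity), neg_neg]
  by_cases hy : y ∈ ({0, 1} : Set I)
  · rw [indicator_of_notMem (notMem_compl_iff.2 hy), rate_eq_zero_iff.2 hy, zero_mul, zero_mul,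
      ENNReal.ofReal_zero]
  · rw [indicator_of_mem hy, rate_mul_one_add_rate_mul hy hz]

end LevyDensity

lemma min_one_le_two_mul_one_sub_exp_neg {x : ℝ} (hx : 0 ≤ x) :
    min 1 x ≤ 2 * (1 - Real.exp (-x)) := by
  have h : Real.exp (-x) ≤ 1 / (1 + x) := by
    rw [Real.exp_neg, one_div]
    exact inv_anti₀ (by linarith) (by linarith [Real.add_one_le_exp x])
  calc min 1 x ≤ 2 * x / (1 + x) := by
        rw [le_div_iff₀ (by linarith)]
        rcases le_total 1 x with h | h
        · rw [min_eq_left h]; linarith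
        · rw [min_eq_right h]; nlinarith
    _ = 2 * (1 - 1 / (1 + x)) := by
      have : 1 + x ≠ 0 := by linarith
      field_simp
      ring
    _ ≤ 2 * (1 - Real.exp (-x)) := by linarith

lemma ae_pos_of_measure_Iic_eq_zero {m : Measure ℝ} (hm : m (Iic 0) = 0) : ∀ᵐ x ∂m, 0 < x := by
  simp_rw [ae_iff, not_lt]
  exact hm

lemma isBernsteinTriplet_of_lintegral_eq {m : Measure ℝ} (hm : m (Iic 0) = 0) (a : ℝ≥0)
    {u : ℝ≥0 → ℝ≥0} (hu : ∀ z : ℝ≥0, ∫⁻ x, ENNReal.ofReal (1 - Real.exp (-(z * x))) ∂m = u z) :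
    IsBernsteinTriplet (fun z ↦ a + u z) a 0 m := by
  have hpos := ae_pos_of_measure_Iic_eq_zero hm
  refine ⟨hm, ?_, fun z ↦ ?_⟩
  · calc ∫⁻ x, ENNReal.ofReal (min 1 x) ∂m
        ≤ ∫⁻ x, 2 * ENNReal.ofReal (1 - Real.exp (-((1 : ℝ≥0) * x))) ∂m := by
          refine lintegral_mono_ae (hpos.mono fun x hx ↦ ?_)
          rw [← ENNReal.ofReal_ofNat 2, ← ENNReal.ofReal_mul (by norm_num), NNReal.coe_one, one_mul]
          exact ENNReal.ofReal_le_ofReal (min_one_le_two_mul_one_sub_exp_neg hx.le)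
      _ = 2 * u 1 := by rw [lintegral_const_mul _ (by fun_prop), hu]
      _ < ∞ := ENNReal.mul_lt_top (by simp) ENNReal.coe_lt_top
  · rw [NNReal.coe_add, NNReal.coe_zero, zero_mul, add_zero,
      integral_eq_lintegral_of_nonneg_ae (hpos.mono fun x hx ↦
        one_sub_exp_neg_nonneg (mul_nonneg z.coe_nonneg hx.le)) (by fun_prop),
      hu, ENNReal.coe_toReal]

lemma exists_mem_CBFflat {ρ : Measure I} [IsFiniteMeasure ρ] (h0 : ρ {0} = 0) :
    ∃ f ∈ CBFflat, ∀ z : ℝ≥0, 0 < z → cbfTransform ρ (z : ℝ) = ((f z : ℝ) : ℂ) := by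
  have hnn (z : ℝ≥0) (y : I) : 0 ≤ (z : ℝ) / (1 - (y : ℝ) + y * z) :=
    div_nonneg z.2 (add_nonneg (sub_nonneg.2 y.2.2) (mul_nonneg y.2.1 z.2))
  have hint (z : ℝ≥0) : Integrable (fun y : I ↦ (z : ℝ) / (1 - (y : ℝ) + y * z)) ρ := by
    rcases eq_zero_or_pos z with rfl | hz
    · simp
    · exact (integrable_inv_cbfDenom hz).const_mul (z : ℝ)
  let u (z : ℝ≥0) : ℝ≥0 := ⟨∫ y in ({0, 1}ᶜ : Set I), (z : ℝ) / (1 - (y : ℝ) + y * z) ∂ρ,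
    integral_nonneg (hnn z)⟩
  refine ⟨fun z ↦ ⟨ρ.real {1}, measureReal_nonneg⟩ + u z, ⟨_, levyDensity ρ,
    isCompletelyMonotone_levyDensity ρ, isBernsteinTriplet_of_lintegral_eq ?_ _ fun z ↦ ?_⟩,
    fun z hz ↦ ?_⟩
  · refine withDensity_absolutelyContinuous _ _ ?_
    rw [Measure.restrict_apply measurableSet_Iic, Iic_inter_Ioi, Ioc_self, measure_empty]
  · have hcont := (isCompletelyMonotone_levyDensity ρ).1.continuousOn
    rw [lintegral_withDensity_eq_lintegral_mul₀
      (hcont.aemeasurable measurableSet_Ioi).ennreal_ofReal (by fun_prop)]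
    exact (lintegral_levyDensity ρ z.coe_nonneg).trans
      ((ofReal_integral_eq_lintegral_ofReal (hint z).integrableOn (.of_forall (hnn z))).symm.trans
        (ENNReal.ofReal_eq_coe_nnreal _))
  · have hz' : (z : ℝ) ≠ 0 := NNReal.coe_ne_zero.2 hz.ne'
    have h01 : ∫ y in ({0, 1} : Set I), (z : ℝ) / (1 - (y : ℝ) + y * z) ∂ρ = ρ.real {1} := by
      rw [show ({0, 1} : Set I) = {0} ∪ {1} from rfl, setIntegral_union (by simp)
        (measurableSet_singleton _) (hint z).integrableOn (hint z).integrableOn,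
        Measure.restrict_singleton, Measure.restrict_singleton, h0]
      simp [hz', Measure.real]
    rw [cbfTransform_ofReal, ← integral_add_compl (toFinite {0, 1}).measurableSet (hint z),
      h01]
    rfl

/-! ### Completely monotone functions -/

/-- The `k`-th term at `x` of the Taylor series of `g` at `b`. The sign is attached to the
derivative, so that all terms are nonnegative for completely monotone `g` and `x ≤ b`. -/
noncomputable def taylorTerm (g : ℝ → ℝ) (b x : ℝ) (k : ℕ) : ℝ :=
  (-1) ^ k * iteratedDeriv k g b / k.factorial * (b - x) ^ k

namespace IsCompletelyMonotone

variable {g : ℝ → ℝ} (hg : IsCompletelyMonotone g)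

include hg

lemma nonneg {x : ℝ} (hx : 0 < x) : 0 ≤ g x := by
  simpa only [pow_zero, iteratedDeriv_zero, one_mul] using hg.2 0 x hx

lemma iteratedDerivWithin_eq {x b y : ℝ} (hx : 0 < x) (hb : x < b) (hy : y ∈ Icc x b) (k : ℕ) :
    iteratedDerivWithin k g (Icc x b) y = iteratedDeriv k g y :=
  iteratedDerivWithin_eq_iteratedDeriv (uniqueDiffOn_Icc hb)
    ((hg.1.contDiffAt (Ioi_mem_nhds (hx.trans_le hy.1))).of_le (mod_cast le_top)) hy

lemma taylorWithinEval_eq {x b : ℝ} (hx : 0 < x) (hb : x < b) (n : ℕ) :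
    taylorWithinEval g n (Icc x b) b x = ∑ k ∈ Finset.range (n + 1), taylorTerm g b x k := by
  rw [taylor_within_apply]
  refine Finset.sum_congr rfl fun k _ ↦ ?_
  rw [hg.iteratedDerivWithin_eq hx hb (right_mem_Icc.2 hb.le), smul_eq_mul, taylorTerm,
    show x - b = -1 * (b - x) by ring, mul_pow]
  ring

lemma exists_sub_sum_taylorTerm_eq {x b : ℝ} (hx : 0 < x) (hb : x < b) (n : ℕ) :
    ∃ ξ ∈ Ioo x b, g x - ∑ k ∈ Finset.range (n + 1), taylorTerm g b x k =
      (-1) ^ (n + 1) * iteratedDeriv (n + 1) g ξ / n.factorial * (ξ - x) ^ n * (b - x) := by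
  have hu : uIcc b x = Icc x b := uIcc_of_ge hb.le
  have hc : ContDiffOn ℝ (⊤ : ℕ∞) g (Icc x b) := hg.1.mono fun _ hy ↦ hx.trans_le hy.1
  have hd : DifferentiableOn ℝ (iteratedDerivWithin n g (Icc x b)) (Ioo x b) :=
    (hc.differentiableOn_iteratedDerivWithin (m := n) (by exact_mod_cast ENat.natCast_lt_top n)
      (uniqueDiffOn_Icc hb)).mono Ioo_subset_Icc_self
  obtain ⟨ξ, hξ, h⟩ := taylor_mean_remainder_cauchy (f := g) (x := x) (x₀ := b) (n := n) hb.ne'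
    (hu ▸ hc.of_le (mod_cast le_top)) (by rwa [hu, uIoo_of_ge hb.le])
  rw [uIoo_of_ge hb.le] at hξ
  rw [hu, hg.taylorWithinEval_eq hx hb,
    hg.iteratedDerivWithin_eq hx hb (Ioo_subset_Icc_self hξ)] at h
  refine ⟨ξ, hξ, ?_⟩
  rw [h, show x - ξ = -1 * (ξ - x) by ring, mul_pow, pow_succ]
  ring

lemma taylorTerm_nonneg {x b : ℝ} (hx : x ≤ b) (hb : 0 < b) (k : ℕ) : 0 ≤ taylorTerm g b x k :=
  mul_nonneg (div_nonneg (hg.2 k b hb) (by positivity)) (pow_nonneg (sub_nonneg.2 hx) _)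

lemma sum_taylorTerm_le {x b : ℝ} (hx : 0 < x) (hb : x < b) (n : ℕ) :
    ∑ k ∈ Finset.range (n + 1), taylorTerm g b x k ≤ g x := by
  obtain ⟨ξ, hξ, h⟩ := hg.exists_sub_sum_taylorTerm_eq hx hb n
  rw [← sub_nonneg, h]
  exact mul_nonneg (mul_nonneg (div_nonneg (hg.2 (n + 1) ξ (hx.trans hξ.1)) (by positivity))
    (pow_nonneg (sub_nonneg.2 hξ.1.le) _)) (sub_nonneg.2 hb.le)

lemma taylorTerm_le {x b : ℝ} (hx : 0 < x) (hb : x < b) (k : ℕ) : taylorTerm g b x k ≤ g x :=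
  (Finset.single_le_sum (fun j _ ↦ hg.taylorTerm_nonneg hb.le (hx.trans hb) j)
    (Finset.mem_range.2 k.lt_succ_self)).trans (hg.sum_taylorTerm_le hx hb k)

lemma antitoneOn : AntitoneOn g (Ioi 0) := fun x hx b _ hxb ↦ by
  rcases hxb.eq_or_lt with rfl | hb
  · rfl
  · simpa [taylorTerm] using hg.taylorTerm_le hx hb 0

lemma div_factorial_le {y ξ : ℝ} (hy : 0 < y) (hyξ : y < ξ) (n : ℕ) :
    (-1) ^ (n + 1) * iteratedDeriv (n + 1) g ξ / n.factorial ≤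
      (n + 1) * g y / (ξ - y) ^ (n + 1) := by
  have h := hg.taylorTerm_le hy hyξ (n + 1)
  have hξ : 0 < ξ - y := sub_pos.2 hyξ
  rw [taylorTerm, Nat.factorial_succ, Nat.cast_mul, Nat.cast_succ, mul_comm ((n : ℝ) + 1),
    ← div_div, div_mul_eq_mul_div, div_le_iff₀ (by positivity)] at h
  rw [le_div_iff₀ (by positivity)]
  linarith

lemma remainder_le {y x ξ b : ℝ} (hy : 0 < y) (hyx : y < x) (hxξ : x < ξ) (hξb : ξ < b) (n : ℕ) :
    (-1) ^ (n + 1) * iteratedDeriv (n + 1) g ξ / n.factorial * (ξ - x) ^ n * (b - x) ≤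
      (n + 1) * ((b - x) / (b - y)) ^ n * (g y * (b - x) / (x - y)) := by
  have hyξ : 0 < ξ - y := by linarith
  have hgy := hg.nonneg hy
  have : 0 ≤ ξ - x := by linarith
  have hbx : 0 ≤ b - x := by linarith
  have hby : 0 < b - y := by linarith
  have hratio : (ξ - x) / (ξ - y) ≤ (b - x) / (b - y) := by
    rw [div_le_div_iff₀ hyξ hby]
    nlinarith [mul_pos (sub_pos.2 hyx) (sub_pos.2 hξb)]
  have hinv : 1 / (ξ - y) ≤ 1 / (x - y) := one_div_le_one_div_of_le (by linarith) (by linarith)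
  calc (-1) ^ (n + 1) * iteratedDeriv (n + 1) g ξ / n.factorial * (ξ - x) ^ n * (b - x)
    _ ≤ (n + 1) * g y / (ξ - y) ^ (n + 1) * (ξ - x) ^ n * (b - x) := by
      exact mul_le_mul_of_nonneg_right (mul_le_mul_of_nonneg_right
        (hg.div_factorial_le hy (hyx.trans hxξ) n) (by positivity)) hbx
    _ = (n + 1) * ((ξ - x) / (ξ - y)) ^ n * (g y * (b - x) * (1 / (ξ - y))) := by
      rw [div_pow, pow_succ]
      field_simp
    _ ≤ (n + 1) * ((b - x) / (b - y)) ^ n * (g y * (b - x) * (1 / (x - y))) := by gcongr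
    _ = _ := by ring

/-- The remainder decays geometrically because the Taylor coefficients at `ξ` are controlled by the
value of `g` at a point to the left of `x`. -/
lemma hasSum_taylorTerm {x b : ℝ} (hx : 0 < x) (hb : x < b) :
    HasSum (taylorTerm g b x) (g x) := by
  rw [hasSum_iff_tendsto_nat_of_nonneg (hg.taylorTerm_nonneg hb.le (hx.trans hb)),
    ← tendsto_add_atTop_iff_nat 1]
  have hq0 : 0 ≤ (b - x) / (b - x / 2) := div_nonneg (by linarith) (by linarith)
  have hq1 : (b - x) / (b - x / 2) < 1 := (div_lt_one (by linarith)).2 (by linarith)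
  have hlim : Tendsto (fun n : ℕ ↦ g x - (n + 1) * ((b - x) / (b - x / 2)) ^ n *
      (g (x / 2) * (b - x) / (x - x / 2))) atTop (𝓝 (g x)) := by
    have h := (tendsto_self_mul_const_pow_of_lt_one hq0 hq1).add
      (tendsto_pow_atTop_nhds_zero_of_lt_one hq0 hq1)
    simpa only [add_zero, zero_mul, sub_zero, add_mul, one_mul] using
      (h.mul_const (g (x / 2) * (b - x) / (x - x / 2))).const_sub (g x)
  refine tendsto_of_tendsto_of_tendsto_of_le_of_le hlim tendsto_const_nhds (fun n ↦ ?_)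
    (hg.sum_taylorTerm_le hx hb)
  obtain ⟨ξ, hξ, h⟩ := hg.exists_sub_sum_taylorTerm_eq hx hb n
  dsimp only
  linarith [hg.remainder_le (half_pos hx) (half_lt_self hx) hξ.1 hξ.2 n]

end IsCompletelyMonotone

/-! ### Functions with an integral representation over the unit interval -/

/-- The functions on `(0,∞)` that are given by `cbfTransform`. -/
def HasCbfRep (u : ℝ → ℝ) : Prop :=
  ∃ ρ : Measure I, IsFiniteMeasure ρ ∧ ∀ x : ℝ, 0 < x → cbfTransform ρ x = (u x : ℂ)

lemma HasCbfRep.congr {u v : ℝ → ℝ} (hu : HasCbfRep u) (h : ∀ x, 0 < x → u x = v x) :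
    HasCbfRep v := by
  obtain ⟨ρ, hρ, h'⟩ := hu
  exact ⟨ρ, hρ, fun x hx ↦ by rw [h' x hx, h x hx]⟩

lemma HasCbfRep.const_mul {u : ℝ → ℝ} (hu : HasCbfRep u) {c : ℝ} (hc : 0 ≤ c) :
    HasCbfRep fun x ↦ c * u x := by
  obtain ⟨ρ, hρ, h⟩ := hu
  refine ⟨ENNReal.ofReal c • ρ, ρ.smul_finite ENNReal.ofReal_ne_top, fun x hx ↦ ?_⟩
  rw [cbfTransform, integral_smul_measure, ENNReal.toReal_ofReal hc, ← cbfTransform, h x hx,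
    Complex.real_smul, Complex.ofReal_mul]

lemma HasCbfRep.add {u v : ℝ → ℝ} (hu : HasCbfRep u) (hv : HasCbfRep v) :
    HasCbfRep fun x ↦ u x + v x := by
  obtain ⟨ρ, hρ, h⟩ := hu
  obtain ⟨τ, hτ, h'⟩ := hv
  refine ⟨ρ + τ, inferInstance, fun x hx ↦ ?_⟩
  have hx' := Complex.ofReal_mem_slitPlane.2 hx
  rw [cbfTransform, integral_add_measure (integrable_cbfKernel ρ hx') (integrable_cbfKernel τ hx'),
    ← cbfTransform, ← cbfTransform, h x hx, h' x hx, Complex.ofReal_add]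

lemma hasCbfRep_zero : HasCbfRep fun _ ↦ 0 :=
  ⟨0, inferInstance, fun x _ ↦ by rw [cbfTransform, integral_zero_measure, Complex.ofReal_zero]⟩

lemma HasCbfRep.sum {u : ℕ → ℝ → ℝ} (hu : ∀ k, HasCbfRep (u k)) (n : ℕ) :
    HasCbfRep fun x ↦ ∑ k ∈ Finset.range n, u k x := by
  induction n with
  | zero => simpa only [Finset.range_zero, Finset.sum_empty] using hasCbfRep_zero
  | succ n ih => simpa only [Finset.sum_range_succ] using ih.add (hu n)

lemma hasCbfRep_dirac (y : I) : HasCbfRep fun x ↦ x / (1 - (y : ℝ) + y * x) :=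
  ⟨Measure.dirac y, inferInstance, fun x _ ↦ by rw [cbfTransform_ofReal, integral_dirac]⟩

lemma HasCbfRep.of_tendsto {u : ℕ → ℝ → ℝ} {v : ℝ → ℝ} (hu : ∀ n, HasCbfRep (u n))
    (h : ∀ x, 0 < x → Tendsto (fun n ↦ u n x) atTop (𝓝 (v x))) : HasCbfRep v := by
  choose ρ hρ hρu using hu
  obtain ⟨C, hC⟩ := (h 1 one_pos).bddAbove_range
  obtain ⟨ρ', hρ', hlim⟩ := exists_cbfTransform_eq_of_tendsto (ρ := ρ) (C := C) fun n ↦ by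
    have hmass : (ρ n).real univ = u n 1 := by
      have := hρu n 1 one_pos
      rw [Complex.ofReal_one, cbfTransform_one] at this
      exact_mod_cast this
    exact hmass ▸ hC (mem_range_self n)
  refine ⟨ρ', hρ', fun x hx ↦ ?_⟩
  have hx' := Complex.ofReal_mem_slitPlane.2 hx
  refine hlim (fun _ ↦ x) x _ (fun _ ↦ hx') hx' tendsto_const_nhds ?_
  simp_rw [hρu _ x hx]
  exact (Complex.continuous_ofReal.tendsto _).comp (h x hx)

/-! ### Lévy integrals -/

/-- The Bernstein function with Lévy density `h`, without killing and drift. -/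
noncomputable def levyIntegral (h : ℝ → ℝ) (x : ℝ) : ℝ :=
  ∫ r in Ioi (0 : ℝ), (1 - Real.exp (-(x * r))) * h r

lemma one_sub_exp_neg_mul_le {x r : ℝ} (hx : 0 ≤ x) (hr : 0 ≤ r) :
    1 - Real.exp (-(x * r)) ≤ (1 + x) * min 1 r := by
  have h1 := Real.add_one_le_exp (-(x * r))
  have h2 := Real.exp_pos (-(x * r))
  rcases le_total 1 r with h | h
  · rw [min_eq_left h]; linarith
  · rw [min_eq_right h]; nlinarith

lemma tendsto_levyIntegral {h : ℕ → ℝ → ℝ} {k H : ℝ → ℝ}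
    (hm : ∀ n, AEStronglyMeasurable (h n) (volume.restrict (Ioi 0)))
    (hH : IntegrableOn (fun r ↦ min 1 r * H r) (Ioi 0))
    (hb : ∀ n r, 0 < r → |h n r| ≤ H r)
    (hlim : ∀ r, 0 < r → Tendsto (fun n ↦ h n r) atTop (𝓝 (k r))) {x : ℝ} (hx : 0 ≤ x) :
    Tendsto (fun n ↦ levyIntegral (h n) x) atTop (𝓝 (levyIntegral k x)) := by
  refine tendsto_integral_of_dominated_convergence (fun r ↦ (1 + x) * (min 1 r * H r))
    (fun n ↦ (by fun_prop : AEStronglyMeasurable _ _).mul (hm n)) (hH.const_mul _)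
    (fun n ↦ ?_) ?_
  · filter_upwards [ae_restrict_mem measurableSet_Ioi] with r (hr : 0 < r)
    rw [norm_mul, Real.norm_of_nonneg (one_sub_exp_neg_nonneg (mul_nonneg hx hr.le)), ← mul_assoc]
    exact mul_le_mul (one_sub_exp_neg_mul_le hx hr.le) (hb n r hr) (norm_nonneg _)
      (mul_nonneg (by linarith) (le_min zero_le_one hr.le))
  · filter_upwards [ae_restrict_mem measurableSet_Ioi] with r hr
    exact (hlim r hr).const_mul _

lemma HasCbfRep.levyIntegral_of_tendsto {h : ℕ → ℝ → ℝ} {k H : ℝ → ℝ}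
    (hm : ∀ n, AEStronglyMeasurable (h n) (volume.restrict (Ioi 0)))
    (hH : IntegrableOn (fun r ↦ min 1 r * H r) (Ioi 0))
    (hb : ∀ n r, 0 < r → |h n r| ≤ H r)
    (hlim : ∀ r, 0 < r → Tendsto (fun n ↦ h n r) atTop (𝓝 (k r)))
    (hu : ∀ n, HasCbfRep (levyIntegral (h n))) : HasCbfRep (levyIntegral k) :=
  .of_tendsto hu fun _ hx ↦ tendsto_levyIntegral hm hH hb hlim hx.le

lemma hasCbfRep_levyIntegral_exp {s : ℝ} (hs : 0 < s) :
    HasCbfRep (levyIntegral fun r ↦ Real.exp (-(s * r))) := by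
  have hy : 1 / (1 + s) ∈ I := ⟨by positivity, (div_le_one (by linarith)).2 (by linarith)⟩
  refine ((hasCbfRep_dirac ⟨_, hy⟩).const_mul (c := 1 / (s * (1 + s))) (by positivity)).congr
    fun x hx ↦ ?_
  rw [levyIntegral, integral_one_sub_exp_mul_exp hs hx.le,
    show 1 - 1 / (1 + s) + 1 / (1 + s) * x = (s + x) / (1 + s) by field_simp; ring]
  field_simp

lemma hasCbfRep_levyIntegral_sum {c s : ℕ → ℝ} (hc : ∀ k, 0 ≤ c k) (hs : ∀ k, 0 < s k) (n : ℕ) :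
    HasCbfRep (levyIntegral fun r ↦ ∑ k ∈ Finset.range n, c k * Real.exp (-(s k * r))) := by
  refine (HasCbfRep.sum (fun k ↦ (hasCbfRep_levyIntegral_exp (hs k)).const_mul (hc k)) n).congr
    fun x hx ↦ ?_
  simp_rw [levyIntegral, Finset.mul_sum, mul_left_comm _ (c _)]
  rw [integral_finsetSum _ fun k _ ↦
    (integrableOn_one_sub_exp_mul_exp (hs k) hx.le).const_mul (c k)]
  simp_rw [integral_const_mul]

/-- The points at which a completely monotone function is expanded: they converge to `r`, and
`n + 1 - node n r` is an exponential in `r`, so that the Taylor series at `n + 1` becomes a series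
of exponentials. -/
noncomputable def node (n : ℕ) (r : ℝ) : ℝ := (n + 1) * (1 - Real.exp (-(r / (n + 1))))

lemma node_lt (n : ℕ) (r : ℝ) : node n r < n + 1 :=
  mul_lt_of_lt_one_right n.cast_add_one_pos (sub_lt_self 1 (Real.exp_pos _))

lemma half_min_le_node (n : ℕ) {r : ℝ} (hr : 0 < r) : min 1 r / 2 ≤ node n r := by
  have hn : (0 : ℝ) < n + 1 := n.cast_add_one_pos
  have hexp := min_one_le_two_mul_one_sub_exp_neg (x := r / (n + 1)) (by positivity)
  have hmin : min 1 r ≤ (n + 1) * min 1 (r / (n + 1)) := by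
    rw [mul_min_of_nonneg _ _ hn.le, mul_one, mul_div_cancel₀ _ hn.ne']
    exact min_le_min_right _ (by linarith [n.cast_nonneg (α := ℝ)])
  rw [node]
  nlinarith

lemma node_pos (n : ℕ) {r : ℝ} (hr : 0 < r) : 0 < node n r :=
  (half_pos (lt_min one_pos hr)).trans_le (half_min_le_node n hr)

@[fun_prop]
lemma continuous_node (n : ℕ) : Continuous (node n) := by
  unfold node
  fun_prop

lemma tendsto_node (r : ℝ) : Tendsto (fun n ↦ node n r) atTop (𝓝 r) := by
  have hd : HasDerivAt (fun t : ℝ ↦ -Real.exp (-(r * t))) r 0 := by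
    refine ((hasDerivAt_id (0 : ℝ)).const_mul r).neg.exp.neg.congr_deriv ?_
    simp
  rw [hasDerivAt_iff_tendsto_slope_zero] at hd
  have ht : Tendsto (fun n : ℕ ↦ (1 : ℝ) / (n + 1)) atTop (𝓝[≠] 0) :=
    tendsto_nhdsWithin_iff.2 ⟨tendsto_one_div_add_atTop_nhds_zero_nat,
      .of_forall fun n ↦ Nat.one_div_pos_of_nat.ne'⟩
  refine (hd.comp ht).congr fun n ↦ ?_
  rw [Function.comp_apply, zero_add, mul_zero, neg_zero, Real.exp_zero, one_div, inv_inv,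
    smul_eq_mul, node, div_eq_mul_inv]
  ring

namespace IsCompletelyMonotone

variable {g : ℝ → ℝ} (hg : IsCompletelyMonotone g)

include hg

lemma aestronglyMeasurable : AEStronglyMeasurable g (volume.restrict (Ioi 0)) :=
  hg.1.continuousOn.aestronglyMeasurable measurableSet_Ioi

lemma apply_node_le (n : ℕ) {r : ℝ} (hr : 0 < r) : g (node n r) ≤ g (r / 2) + g (1 / 2) := by
  refine (hg.antitoneOn (half_pos (lt_min one_pos hr)) (node_pos n hr)
    (half_min_le_node n hr)).trans ?_
  have hr' := hg.nonneg (half_pos hr)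
  have h1 := hg.nonneg (half_pos one_pos)
  rcases min_choice 1 r with h | h <;> rw [h] <;> linarith

lemma integrableOn_min_mul_apply_half (hi : IntegrableOn (fun r ↦ min 1 r * g r) (Ioi 0)) :
    IntegrableOn (fun r ↦ min 1 r * g (r / 2)) (Ioi 0) := by
  have hhalf : IntegrableOn (fun r ↦ min 1 (r / 2) * g (r / 2)) (Ioi 0) := by
    simpa only [mul_one_div] using (integrableOn_Ioi_comp_mul_right_iff (fun r ↦ min 1 r * g r) 0
      (one_half_pos (α := ℝ))).2 (by simpa only [zero_mul] using hi)
  have hm : AEStronglyMeasurable (fun r ↦ g (r / 2)) (volume.restrict (Ioi 0)) :=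
    (hg.1.continuousOn.comp (s := Ioi 0) (by fun_prop) fun _ hr ↦ half_pos (mem_Ioi.1 hr)
      ).aestronglyMeasurable measurableSet_Ioi
  refine (hhalf.const_mul 2).mono' (.fun_mul (by fun_prop) hm) ?_
  filter_upwards [ae_restrict_mem measurableSet_Ioi] with r (hr : 0 < r)
  have hgr := hg.nonneg (half_pos hr)
  have hmin : min 1 r ≤ 2 * min 1 (r / 2) := by
    rw [mul_min_of_nonneg _ _ zero_le_two, mul_div_cancel₀ _ two_ne_zero]
    exact min_le_min_right _ (by norm_num)
  rw [Real.norm_of_nonneg (mul_nonneg (le_min zero_le_one hr.le) hgr), ← mul_assoc]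
  exact mul_le_mul_of_nonneg_right hmin hgr

lemma integrableOn_min_mul_node_bound (hi : IntegrableOn (fun r ↦ min 1 r * g r) (Ioi 0)) {ε : ℝ}
    (hε : 0 < ε) :
    IntegrableOn (fun r ↦ min 1 r * ((g (r / 2) + g (1 / 2)) * Real.exp (-(ε * r)))) (Ioi 0) := by
  have hexp : IntegrableOn (fun r ↦ g (1 / 2) * Real.exp (-ε * r)) (Ioi 0) :=
    (integrableOn_exp_mul_Ioi (neg_lt_zero.2 hε) 0).const_mul _
  have hhalf := hg.integrableOn_min_mul_apply_half hi
  have h1 := hhalf.bdd_mul (f := fun r ↦ Real.exp (-(ε * r))) (c := 1) (by fun_prop) <| by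
    filter_upwards [ae_restrict_mem measurableSet_Ioi] with r (hr : 0 < r)
    rw [Real.norm_of_nonneg (Real.exp_pos _).le]
    exact Real.exp_le_one_iff.2 (neg_nonpos.2 (by positivity))
  have h2 := hexp.bdd_mul (f := fun r ↦ min 1 r) (c := 1) (by fun_prop) <| by
    filter_upwards [ae_restrict_mem measurableSet_Ioi] with r (hr : 0 < r)
    rw [Real.norm_of_nonneg (le_min zero_le_one hr.le)]
    exact min_le_left 1 r
  refine (h1.add h2).congr (.of_forall fun r ↦ ?_)
  simp only [Pi.add_apply, neg_mul]
  ring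

lemma hasSum_taylorTerm_node (n : ℕ) (ε : ℝ) {r : ℝ} (hr : 0 < r) :
    HasSum (fun k : ℕ ↦ (-1) ^ k * iteratedDeriv k g (n + 1) / k.factorial * (n + 1) ^ k *
      Real.exp (-((k / (n + 1) + ε) * r))) (g (node n r) * Real.exp (-(ε * r))) := by
  refine ((hg.hasSum_taylorTerm (node_pos n hr) (node_lt n r)).mul_right _).congr_fun fun k ↦ ?_
  have hnode : (n : ℝ) + 1 - node n r = (n + 1) * Real.exp (-(r / (n + 1))) := by
    rw [node]; ring
  rw [taylorTerm, hnode, mul_pow, ← Real.exp_nat_mul, ← mul_assoc, mul_assoc _ (Real.exp _),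
    ← Real.exp_add]
  congr 2
  ring

lemma hasCbfRep_levyIntegral_node (hi : IntegrableOn (fun r ↦ min 1 r * g r) (Ioi 0)) (n : ℕ)
    {ε : ℝ} (hε : 0 < ε) :
    HasCbfRep (levyIntegral fun r ↦ g (node n r) * Real.exp (-(ε * r))) := by
  have hc (k : ℕ) : 0 ≤ (-1) ^ k * iteratedDeriv k g (n + 1) / k.factorial * ((n : ℝ) + 1) ^ k :=
    mul_nonneg (div_nonneg (hg.2 k (n + 1) n.cast_add_one_pos) (by positivity)) (by positivity)
  refine .levyIntegral_of_tendsto (fun N ↦ Continuous.aestronglyMeasurable (by fun_prop))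
    (hg.integrableOn_min_mul_node_bound hi hε) (fun N r hr ↦ ?_)
    (fun r hr ↦ (hg.hasSum_taylorTerm_node n ε hr).tendsto_sum_nat)
    (hasCbfRep_levyIntegral_sum hc fun k ↦ by positivity)
  have hterm (k : ℕ) := mul_nonneg (hc k) (Real.exp_pos (-((k / (n + 1) + ε) * r))).le
  rw [abs_of_nonneg (Finset.sum_nonneg fun k _ ↦ hterm k)]
  calc _ ≤ g (node n r) * Real.exp (-(ε * r)) :=
        sum_le_hasSum _ (fun k _ ↦ hterm k) (hg.hasSum_taylorTerm_node n ε hr)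
    _ ≤ (g (r / 2) + g (1 / 2)) * Real.exp (-(ε * r)) := by
        gcongr
        exact hg.apply_node_le n hr

lemma hasCbfRep_levyIntegral_mul_exp (hi : IntegrableOn (fun r ↦ min 1 r * g r) (Ioi 0)) {ε : ℝ}
    (hε : 0 < ε) : HasCbfRep (levyIntegral fun r ↦ g r * Real.exp (-(ε * r))) := by
  refine .levyIntegral_of_tendsto (fun n ↦ ?_) (hg.integrableOn_min_mul_node_bound hi hε)
    (fun n r hr ↦ ?_) (fun r hr ↦ ?_) (fun n ↦ hg.hasCbfRep_levyIntegral_node hi n hε)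
  · exact ((hg.1.continuousOn.comp (by fun_prop) fun r hr ↦ node_pos n hr).mul
      (by fun_prop)).aestronglyMeasurable measurableSet_Ioi
  · rw [abs_of_nonneg (mul_nonneg (hg.nonneg (node_pos n hr)) (Real.exp_pos _).le)]
    gcongr
    exact hg.apply_node_le n hr
  · exact ((hg.1.continuousOn.continuousAt (Ioi_mem_nhds hr)).tendsto.comp
      (tendsto_node r)).mul_const _

/-- A form of Bernstein's theorem: the factor `e^{-εr}` makes the exponential expansions at the
nodes integrable, and is removed at the end. -/
theorem hasCbfRep_levyIntegral (hi : IntegrableOn (fun r ↦ min 1 r * g r) (Ioi 0)) :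
    HasCbfRep (levyIntegral g) := by
  refine .levyIntegral_of_tendsto
    (h := fun n r ↦ g r * Real.exp (-(1 / (n + 1) * r)))
    (fun n ↦ hg.aestronglyMeasurable.mul (by fun_prop)) hi (fun n r hr ↦ ?_) (fun r _ ↦ ?_)
    (fun n ↦ hg.hasCbfRep_levyIntegral_mul_exp hi Nat.one_div_pos_of_nat)
  · have hgr := hg.nonneg hr
    rw [abs_of_nonneg (by positivity)]
    exact mul_le_of_le_one_right hgr (Real.exp_le_one_iff.2 (neg_nonpos.2 (by positivity)))
  · simpa only [zero_mul, neg_zero, Real.exp_zero, mul_one] using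
      ((tendsto_one_div_add_atTop_nhds_zero_nat (𝕜 := ℝ)).mul_const r).neg.rexp.const_mul (g r)

lemma integrable_withDensity_iff {u : ℝ → ℝ} :
    Integrable u ((volume.restrict (Ioi 0)).withDensity fun x ↦ ENNReal.ofReal (g x)) ↔
      IntegrableOn (fun r ↦ u r * g r) (Ioi 0) := by
  rw [integrable_withDensity_iff_integrable_smul₀' (by have := hg.aestronglyMeasurable; fun_prop)
    (.of_forall fun _ ↦ ENNReal.ofReal_lt_top)]
  refine integrableOn_congr_fun (fun r hr ↦ ?_) measurableSet_Ioi
  rw [ENNReal.toReal_ofReal (hg.nonneg hr), smul_eq_mul, mul_comm]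

lemma integral_withDensity (u : ℝ → ℝ) :
    ∫ r, u r ∂((volume.restrict (Ioi 0)).withDensity fun x ↦ ENNReal.ofReal (g x)) =
      ∫ r in Ioi 0, u r * g r := by
  rw [integral_withDensity_eq_integral_toReal_smul₀
    (by have := hg.aestronglyMeasurable; fun_prop) (.of_forall fun _ ↦ ENNReal.ofReal_lt_top)]
  refine setIntegral_congr_fun measurableSet_Ioi fun r hr ↦ ?_
  rw [ENNReal.toReal_ofReal (hg.nonneg hr), smul_eq_mul, mul_comm]

end IsCompletelyMonotone

/-! ### Complete Bernstein functions have an integral representation -/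

namespace IsBernsteinTriplet

variable {f : ℝ≥0 → ℝ≥0} {a b : ℝ≥0} {m : Measure ℝ} (h : IsBernsteinTriplet f a b m)

include h

lemma ae_pos : ∀ᵐ x ∂m, 0 < x := ae_pos_of_measure_Iic_eq_zero h.concentrated

lemma integrable_min : Integrable (fun x ↦ min 1 x) m := by
  refine ⟨by fun_prop, ?_⟩
  rw [hasFiniteIntegral_iff_ofReal (h.ae_pos.mono fun x hx ↦ le_min zero_le_one hx.le)]
  exact h.levy

lemma ae_norm_one_sub_exp_le {z c : ℝ} (hz : 0 ≤ z) (hc : 1 + z ≤ c) :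
    ∀ᵐ x ∂m, ‖1 - Real.exp (-(z * x))‖ ≤ c * min 1 x := by
  filter_upwards [h.ae_pos] with x hx
  rw [Real.norm_of_nonneg (one_sub_exp_neg_nonneg (mul_nonneg hz hx.le))]
  exact (one_sub_exp_neg_mul_le hz hx.le).trans
    (mul_le_mul_of_nonneg_right hc (le_min zero_le_one hx.le))

lemma integrable_one_sub_exp {z : ℝ} (hz : 0 ≤ z) :
    Integrable (fun x ↦ 1 - Real.exp (-(z * x))) m :=
  (h.integrable_min.const_mul (1 + z)).mono' (by fun_prop) (h.ae_norm_one_sub_exp_le hz le_rfl)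

lemma continuous : Continuous f := by
  refine NNReal.isEmbedding_coe.continuous_iff.2 (continuous_iff_continuousAt.2 ?_)
  intro z₀
  have hint : ContinuousAt (fun z : ℝ≥0 ↦ ∫ x, (1 - Real.exp (-(z * x))) ∂m) z₀ := by
    refine continuousAt_of_dominated (.of_forall fun z ↦ by fun_prop) ?_
      (h.integrable_min.const_mul (1 + (z₀ + 1))) (.of_forall fun x ↦ by fun_prop)
    filter_upwards [Iio_mem_nhds (lt_add_one z₀)] with z hz
    exact h.ae_norm_one_sub_exp_le z.coe_nonneg (by gcongr; exact_mod_cast hz.le)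
  have hlin : ContinuousAt (fun z : ℝ≥0 ↦ (a : ℝ) + b * z) z₀ := by fun_prop
  exact (hlin.add hint).congr (.of_forall fun z ↦ (h.repr z).symm)

lemma tendsto_div : Tendsto (fun z : ℝ≥0 ↦ (f z : ℝ) / z) atTop (𝓝 b) := by
  have hcoe : Tendsto (fun z : ℝ≥0 ↦ ((z : ℝ))⁻¹) atTop (𝓝 0) :=
    tendsto_inv_atTop_zero.comp (NNReal.tendsto_coe_atTop.2 tendsto_id)
  have hint : Tendsto (fun z : ℝ≥0 ↦ ∫ x, (z : ℝ)⁻¹ * (1 - Real.exp (-(z * x))) ∂m) atTop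
      (𝓝 (∫ _, (0 : ℝ) ∂m)) := by
    refine tendsto_integral_filter_of_dominated_convergence (fun x ↦ 2 * min 1 x)
      (.of_forall fun z ↦ by fun_prop) ?_ (h.integrable_min.const_mul 2)
      (h.ae_pos.mono fun x hx ↦ ?_)
    · filter_upwards [eventually_ge_atTop 1] with z hz
      have hz' : (1 : ℝ) ≤ z := by exact_mod_cast hz
      have hz0 : (0 : ℝ) < z := zero_lt_one.trans_le hz'
      filter_upwards [h.ae_norm_one_sub_exp_le z.coe_nonneg
        (by linarith : 1 + (z : ℝ) ≤ z * 2)] with x hx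
      rwa [norm_mul, norm_inv, Real.norm_of_nonneg hz0.le, inv_mul_le_iff₀ hz0, ← mul_assoc]
    · refine squeeze_zero (fun z ↦ ?_) (fun z ↦ ?_) hcoe
      · exact mul_nonneg (inv_nonneg.2 z.coe_nonneg)
          (one_sub_exp_neg_nonneg (mul_nonneg z.coe_nonneg hx.le))
      · exact mul_le_of_le_one_right (inv_nonneg.2 z.coe_nonneg)
          (sub_le_self _ (Real.exp_pos _).le)
  have hlim := ((hcoe.const_mul (a : ℝ)).add_const (b : ℝ)).add hint
  simp only [mul_zero, zero_add, integral_zero, add_zero] at hlim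
  refine hlim.congr' ?_
  filter_upwards [eventually_ne_atTop 0] with z hz
  have hz' : (z : ℝ) ≠ 0 := by exact_mod_cast hz
  rw [h.repr, integral_const_mul]
  field_simp

end IsBernsteinTriplet

lemma measure_singleton_zero_eq_zero {f : ℝ≥0 → ℝ≥0} {ρ : Measure I} [IsFiniteMeasure ρ]
    (hρ : ∀ z : ℝ≥0, 0 < z → cbfTransform ρ (z : ℝ) = ((f z : ℝ) : ℂ))
    (hf : Tendsto (fun z : ℝ≥0 ↦ (f z : ℝ) / z) atTop (𝓝 0)) : ρ {0} = 0 := by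
  have hcoe : Tendsto ((↑) : ℝ≥0 → ℝ) atTop atTop := NNReal.tendsto_coe_atTop.2 tendsto_id
  have hlim : Tendsto (fun z : ℝ≥0 ↦ (f z : ℝ) / z) atTop (𝓝 (ρ.real {0})) := by
    refine ((tendsto_cbfRatio ρ).comp hcoe).congr' ?_
    filter_upwards [eventually_gt_atTop 0] with z hz
    have hz' : (z : ℝ) ≠ 0 := by exact_mod_cast hz.ne'
    have h := hρ z hz
    rw [cbfTransform_ofReal_eq_mul_cbfRatio, Complex.ofReal_inj] at h
    rw [Function.comp_apply, ← h, mul_div_cancel_left₀ _ hz']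
  exact (measureReal_eq_zero_iff).1 (tendsto_nhds_unique hlim hf)

theorem exists_cbfTransform_eq {f : ℝ≥0 → ℝ≥0} (hf : f ∈ CBFflat) :
    ∃ ρ : Measure I, IsFiniteMeasure ρ ∧ ρ {0} = 0 ∧
      ∀ z : ℝ≥0, 0 < z → cbfTransform ρ (z : ℝ) = ((f z : ℝ) : ℂ) := by
  obtain ⟨a, g, hg, h⟩ := hf
  have hrep (z : ℝ≥0) : (f z : ℝ) = a + levyIntegral g z := by
    rw [h.repr, hg.integral_withDensity, NNReal.coe_zero, zero_mul, add_zero, levyIntegral]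
  obtain ⟨ρ, hρ, hρf⟩ := ((hasCbfRep_dirac 1).const_mul a.coe_nonneg).add
    (hg.hasCbfRep_levyIntegral (hg.integrable_withDensity_iff.1 h.integrable_min))
  have hf (z : ℝ≥0) (hz : 0 < z) : cbfTransform ρ (z : ℝ) = ((f z : ℝ) : ℂ) := by
    have hz' : (0 : ℝ) < z := by exact_mod_cast hz
    rw [hρf z hz', hrep, Complex.ofReal_inj]
    simp only [Icc.coe_one, sub_self, zero_add, one_mul, div_self hz'.ne', mul_one]
  exact ⟨ρ, hρ, measure_singleton_zero_eq_zero hf h.tendsto_div, hf⟩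

/-! ### The Laplace transform -/

lemma mconv_univ {M : Type*} [Monoid M] [MeasurableSpace M] [MeasurableMul₂ M] (μ ν : Measure M)
    [SFinite ν] : μ.mconv ν univ = μ univ * ν univ := by
  rw [Measure.mconv, Measure.map_apply (by fun_prop) .univ, preimage_univ, ← univ_prod_univ,
    Measure.prod_prod]

lemma isFiniteMeasure_of_le_one {α : Type*} [MeasurableSpace α] {ν : Measure α}
    (h : ν univ ≤ 1) : IsFiniteMeasure ν :=
  ⟨h.trans_lt ENNReal.one_lt_top⟩

/-- The Laplace transform of a measure on `[0,∞)`. -/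
noncomputable def laplaceTransform (ν : Measure ℝ≥0) (z : ℝ≥0) : ℝ :=
  ∫ y : ℝ≥0, Real.exp (-((z : ℝ) * y)) ∂ν

lemma norm_exp_neg_mul_coe_le_one (z y : ℝ≥0) : ‖Real.exp (-((z : ℝ) * y))‖ ≤ 1 := by
  rw [Real.norm_of_nonneg (Real.exp_pos _).le, Real.exp_le_one_iff]
  exact neg_nonpos.2 (mul_nonneg z.coe_nonneg y.coe_nonneg)

lemma tendsto_nhdsGT_zero_ext {X : Type*} [TopologicalSpace X] [T2Space X] {f g : ℝ≥0 → X}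
    (hf : Tendsto f (𝓝[>] 0) (𝓝 (f 0))) (hg : Tendsto g (𝓝[>] 0) (𝓝 (g 0)))
    (h : ∀ z, 0 < z → f z = g z) : f = g := by
  funext z
  rcases eq_zero_or_pos z with rfl | hz
  · exact tendsto_nhds_unique hf
      (hg.congr' (eventually_nhdsWithin_of_forall fun z hz ↦ (h z hz).symm))
  · exact h z hz

section LaplaceTransform

variable {ν τ : Measure ℝ≥0} [IsFiniteMeasure ν] [IsFiniteMeasure τ]

lemma continuous_laplaceTransform : Continuous (laplaceTransform ν) :=
  continuous_of_dominated (bound := fun _ ↦ 1) (fun z ↦ by fun_prop)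
    (fun z ↦ .of_forall (norm_exp_neg_mul_coe_le_one z)) (integrable_const _)
    (.of_forall fun y ↦ by fun_prop)

lemma laplaceTransform_conv (z : ℝ≥0) :
    laplaceTransform (ν.conv τ) z = laplaceTransform ν z * laplaceTransform τ z := by
  rw [laplaceTransform, integral_conv (.of_bound (by fun_prop) 1
    (.of_forall (norm_exp_neg_mul_coe_le_one z)))]
  simp_rw [NNReal.coe_add, mul_add, neg_add, Real.exp_add, integral_const_mul]
  rw [integral_mul_const, laplaceTransform, laplaceTransform]

open BoundedContinuousFunction in
theorem ext_of_laplaceTransform_eq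
    (h : ∀ z : ℝ≥0, 0 < z → laplaceTransform ν z = laplaceTransform τ z) : ν = τ := by
  have heq : laplaceTransform ν = laplaceTransform τ :=
    tendsto_nhdsGT_zero_ext (continuous_laplaceTransform.tendsto' 0 _ rfl |>.mono_left
      nhdsWithin_le_nhds) (continuous_laplaceTransform.tendsto' 0 _ rfl |>.mono_left
      nhdsWithin_le_nhds) h
  let u : ℝ≥0 →ᵇ ℝ := .ofNormedAddCommGroup (fun y ↦ Real.exp (-((1 : ℝ≥0) * y))) (by fun_prop) 1
    (norm_exp_neg_mul_coe_le_one 1)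
  have hu : Function.Injective u := fun x y hxy ↦ by
    have := Real.exp_injective hxy
    simpa using this
  have hpow (m n : ℕ) (y : ℝ≥0) :
      u y ^ m * star (u y) ^ n = Real.exp (-(((m + n : ℕ) : ℝ≥0) * y)) := by
    change Real.exp _ ^ m * Real.exp _ ^ n = _
    rw [← pow_add, ← Real.exp_nat_mul, NNReal.coe_one, one_mul, mul_neg, NNReal.coe_natCast]
  refine ext_of_integral_pow_mul_star_pow_eq hu fun m n ↦ ?_
  simp_rw [hpow]
  exact congr_fun heq _

end LaplaceTransform

/-! ### Existence of sub-probability measures with a given Laplace transform -/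

/-- Laplace transforms of sub-probability measures on `[0,∞]`, which the change of variables
`y = e^{-s}` moves to the compact interval `[0,1]`. -/
def IsSubLaplace (L : ℝ≥0 → ℝ) : Prop :=
  ∃ ν : Measure I, ν univ ≤ 1 ∧ ∀ z : ℝ≥0, 0 < z → ∫ y : I, (y : ℝ) ^ (z : ℝ) ∂ν = L z

@[fun_prop]
lemma continuous_coe_rpow (z : ℝ≥0) : Continuous fun y : I ↦ (y : ℝ) ^ (z : ℝ) :=
  (Real.continuous_rpow_const z.coe_nonneg).comp continuous_subtype_val

lemma isSubLaplace_mul_rpow (c y : I) : IsSubLaplace fun z ↦ c * (y : ℝ) ^ (z : ℝ) := by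
  refine ⟨ENNReal.ofReal c • Measure.dirac y, ?_, fun z _ ↦ ?_⟩
  · rw [Measure.smul_apply, measure_univ, smul_eq_mul, mul_one]
    exact ENNReal.ofReal_le_one.2 c.2.2
  · rw [integral_smul_measure, integral_dirac, ENNReal.toReal_ofReal c.2.1, smul_eq_mul]

namespace IsSubLaplace

lemma mul {L L' : ℝ≥0 → ℝ} (hL : IsSubLaplace L) (hL' : IsSubLaplace L') :
    IsSubLaplace fun z ↦ L z * L' z := by
  obtain ⟨ν, hν, h⟩ := hL
  obtain ⟨τ, hτ, h'⟩ := hL'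
  have := isFiniteMeasure_of_le_one hν
  have := isFiniteMeasure_of_le_one hτ
  refine ⟨ν.mconv τ, mconv_univ ν τ ▸ mul_le_one' hν hτ, fun z hz ↦ ?_⟩
  change _ = L z * L' z
  rw [integral_mconv (integrable_of_continuous (by fun_prop)), ← h z hz, ← h' z hz]
  simp_rw [Icc.coe_mul, fun x y : I ↦ Real.mul_rpow x.2.1 y.2.1 (z := (z : ℝ)),
    integral_const_mul]
  rw [integral_mul_const]

lemma pow {L : ℝ≥0 → ℝ} (hL : IsSubLaplace L) (n : ℕ) : IsSubLaplace fun z ↦ L z ^ n := by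
  induction n with
  | zero => simpa using isSubLaplace_mul_rpow 1 1
  | succ n ih => simpa only [pow_succ] using ih.mul hL

lemma of_tendsto {L : ℕ → ℝ≥0 → ℝ} {L' : ℝ≥0 → ℝ} (hL : ∀ n, IsSubLaplace (L n))
    (h : ∀ z, 0 < z → Tendsto (fun n ↦ L n z) atTop (𝓝 (L' z))) : IsSubLaplace L' := by
  choose ν hν hL using hL
  have := fun n ↦ isFiniteMeasure_of_le_one (hν n)
  have hmass (n : ℕ) : (ν n).real univ ≤ 1 := ENNReal.toReal_mono ENNReal.one_ne_top (hν n)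
  obtain ⟨ν', hν', hlim⟩ := exists_tendsto_hyperfilter_integral hmass
  have hlim' (f : C(I, ℝ)) :
      Tendsto (fun n ↦ ∫ y, f y ∂ν n) (hyperfilter ℕ) (𝓝 (∫ y, f y ∂ν')) := by
    have := (Complex.continuous_re.tendsto _).comp (hlim ⟨fun y ↦ (f y : ℂ), by fun_prop⟩)
    simpa only [Function.comp_def, ContinuousMap.coe_mk, integral_complex_ofReal,
      Complex.ofReal_re] using this
  refine ⟨ν', ?_, fun z hz ↦ ?_⟩
  · have hone := hlim' 1
    simp only [ContinuousMap.one_apply, integral_const, smul_eq_mul, mul_one] at hone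
    exact (ENNReal.toReal_le_toReal (measure_ne_top _ _) ENNReal.one_ne_top).1
      (ENNReal.toReal_one ▸ le_of_tendsto' hone hmass)
  · refine tendsto_nhds_unique (hlim' ⟨_, continuous_coe_rpow z⟩) ?_
    simp only [ContinuousMap.coe_mk, fun n ↦ hL n z hz]
    exact (h z hz).mono_left Nat.hyperfilter_le_atTop

end IsSubLaplace

/-- The point `e^{-r}` of the unit interval, for `r ≥ 0`. -/
noncomputable def expPoint (r : ℝ) : I :=
  ⟨min 1 (Real.exp (-r)), le_min zero_le_one (Real.exp_pos _).le, min_le_left _ _⟩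

lemma expPoint_rpow {r : ℝ} (hr : 0 ≤ r) (x : ℝ) : (expPoint r : ℝ) ^ x = Real.exp (-(x * r)) := by
  change min 1 (Real.exp (-r)) ^ x = _
  rw [min_eq_right (Real.exp_le_one_iff.2 (neg_nonpos.2 hr)), ← Real.exp_mul]
  ring_nf

lemma measurable_expPoint : Measurable expPoint := Measurable.subtype_mk (by fun_prop)

lemma isSubLaplace_one_sub_integral {m : Measure ℝ} (hm : ∀ᵐ r ∂m, 0 < r) (hm1 : m univ ≤ 1) :
    IsSubLaplace fun z ↦ 1 - ∫ r, (1 - Real.exp (-(z * r))) ∂m := by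
  have := isFiniteMeasure_of_le_one hm1
  refine ⟨(1 - m univ) • Measure.dirac 1 + m.map expPoint, ?_, fun z _ ↦ ?_⟩
  · rw [Measure.add_apply, Measure.smul_apply, Measure.map_apply measurable_expPoint .univ,
      preimage_univ, Measure.dirac_apply_of_mem (mem_univ _), smul_eq_mul, mul_one,
      tsub_add_cancel_of_le hm1]
  have hexp : (fun r ↦ (expPoint r : ℝ) ^ (z : ℝ)) =ᵐ[m] fun r ↦ Real.exp (-(z * r)) :=
    hm.mono fun r hr ↦ expPoint_rpow hr.le z
  have hint : Integrable (fun r ↦ Real.exp (-(z * r))) m :=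
    ((integrable_of_continuous (ρ := m.map expPoint) (continuous_coe_rpow z)).comp_measurable
      measurable_expPoint).congr hexp
  change _ = 1 - ∫ r, (1 - Real.exp (-(z * r))) ∂m
  have hsub : 1 - m univ ≠ ∞ := (tsub_le_self.trans_lt ENNReal.one_lt_top).ne
  rw [integral_add_measure
      ((integrable_of_continuous (continuous_coe_rpow z)).smul_measure hsub)
      (integrable_of_continuous (continuous_coe_rpow z)),
    integral_smul_measure, integral_dirac, ENNReal.toReal_sub_of_le hm1 ENNReal.one_ne_top,
    integral_map measurable_expPoint.aemeasurable (continuous_coe_rpow z).aestronglyMeasurable,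
    integral_congr_ae hexp,
    integral_sub (integrable_const 1) hint, integral_const, Icc.coe_one, Real.one_rpow,
    ENNReal.toReal_one, smul_eq_mul, smul_eq_mul, Measure.real]
  ring

/-- Compound Poisson distributions, as limits of binomial ones. -/
lemma isSubLaplace_exp_neg_integral {m : Measure ℝ} [IsFiniteMeasure m] (hm : ∀ᵐ r ∂m, 0 < r) :
    IsSubLaplace fun z ↦ Real.exp (-∫ r, (1 - Real.exp (-(z * r))) ∂m) := by
  obtain ⟨N, hN⟩ := ENNReal.exists_nat_gt (measure_ne_top m univ)
  have hstep (n : ℕ) (hn : N ≤ n) :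
      IsSubLaplace fun z ↦ 1 + (-∫ r, (1 - Real.exp (-(z * r))) ∂m) / n := by
    have hmass : ((n : ℝ≥0∞)⁻¹ • m) univ ≤ 1 := by
      have hmn : m univ < n := hN.trans_le (Nat.cast_le.2 hn)
      rw [Measure.smul_apply, smul_eq_mul,
        ENNReal.inv_mul_le_iff (pos_of_gt hmn).ne' (ENNReal.natCast_ne_top n), mul_one]
      exact hmn.le
    have := isSubLaplace_one_sub_integral (Measure.ae_smul_measure hm _) hmass
    simpa only [integral_smul_measure, ENNReal.toReal_inv, ENNReal.toReal_natCast, smul_eq_mul,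
      sub_eq_add_neg, div_eq_inv_mul, mul_neg] using this
  refine .of_tendsto (fun n ↦ (hstep (n + N) (Nat.le_add_left N n)).pow (n + N)) fun z _ ↦ ?_
  exact (Real.tendsto_one_add_div_pow_exp _).comp (tendsto_add_atTop_nat N)

lemma IsBernsteinTriplet.measure_Ioi_lt_top {f : ℝ≥0 → ℝ≥0} {a b : ℝ≥0} {m : Measure ℝ}
    (h : IsBernsteinTriplet f a b m) {ε : ℝ} (hε : 0 < ε) : m (Ioi ε) < ∞ := by
  refine (measure_mono fun r (hr : ε < r) ↦ ?_).trans_lt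
    (h.integrable_min.measure_norm_ge_lt_top (ε := min 1 ε) (lt_min one_pos hε))
  exact (min_le_min_left 1 hr.le).trans (le_abs_self _)

lemma IsBernsteinTriplet.isSubLaplace_exp_neg_integral {f : ℝ≥0 → ℝ≥0} {a b : ℝ≥0}
    {m : Measure ℝ} (h : IsBernsteinTriplet f a b m) :
    IsSubLaplace fun z ↦ Real.exp (-∫ r, (1 - Real.exp (-(z * r))) ∂m) := by
  let s (n : ℕ) : Set ℝ := Ioi (1 / (n + 1))
  have hs (n : ℕ) : MeasurableSet (s n) := measurableSet_Ioi
  refine .of_tendsto (L := fun n z ↦ Real.exp (-∫ r in s n, (1 - Real.exp (-(z * r))) ∂m))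
    (fun n ↦ ?_) fun z _ ↦ (Tendsto.neg ?_).rexp
  · have : IsFiniteMeasure (m.restrict (s n)) :=
      isFiniteMeasure_restrict.2 (h.measure_Ioi_lt_top Nat.one_div_pos_of_nat).ne
    exact FreeRegular.isSubLaplace_exp_neg_integral (ae_restrict_of_ae h.ae_pos)
  · simp_rw [← integral_indicator (hs _)]
    have hint := h.integrable_one_sub_exp z.coe_nonneg
    refine tendsto_integral_of_dominated_convergence _
      (fun n ↦ (hint.indicator (hs n)).aestronglyMeasurable) hint.norm
      (fun n ↦ .of_forall fun r ↦ norm_indicator_le_norm_self _ _) (h.ae_pos.mono fun r hr ↦ ?_)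
    refine tendsto_const_nhds.congr' ?_
    filter_upwards [(tendsto_one_div_add_atTop_nhds_zero_nat (𝕜 := ℝ)).eventually
      (Iio_mem_nhds hr)] with n hn
    rw [indicator_of_mem (show r ∈ s n from hn)]

lemma IsBernsteinTriplet.isSubLaplace {f : ℝ≥0 → ℝ≥0} {a b : ℝ≥0} {m : Measure ℝ}
    (h : IsBernsteinTriplet f a b m) : IsSubLaplace fun z ↦ Real.exp (-(f z : ℝ)) := by
  obtain ⟨ν, hν, hL⟩ := (isSubLaplace_mul_rpow (expPoint a) (expPoint b)).mul
    h.isSubLaplace_exp_neg_integral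
  refine ⟨ν, hν, fun z hz ↦ ?_⟩
  have ha := expPoint_rpow a.coe_nonneg 1
  rw [Real.rpow_one, one_mul] at ha
  simp only [hL z hz, ha, expPoint_rpow b.coe_nonneg, ← Real.exp_add, h.repr]
  ring_nf

/-- The inverse of the change of variables `y = e^{-s}`. -/
noncomputable def negLog (y : I) : ℝ≥0 := Real.toNNReal (-Real.log y)

@[fun_prop]
lemma measurable_negLog : Measurable negLog := by
  unfold negLog
  fun_prop

lemma exp_neg_mul_negLog {y : I} (hy : y ≠ 0) (x : ℝ) :
    Real.exp (-(x * negLog y)) = (y : ℝ) ^ x := by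
  rw [negLog, Real.coe_toNNReal _ (neg_nonneg.2 (Real.log_nonpos y.2.1 y.2.2)),
    Real.rpow_def_of_pos (unitInterval.pos_iff_ne_zero.2 hy)]
  ring_nf

/-- The mass at `0`, which corresponds to the point `∞`, does not contribute to the transform. -/
lemma IsSubLaplace.exists_laplaceTransform_eq {L : ℝ≥0 → ℝ} (h : IsSubLaplace L) :
    ∃ ν : Measure ℝ≥0, ν univ ≤ 1 ∧ ∀ z : ℝ≥0, 0 < z → laplaceTransform ν z = L z := by
  obtain ⟨ν, hν, hL⟩ := h
  refine ⟨(ν.restrict {0}ᶜ).map negLog, ?_, fun z hz ↦ ?_⟩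
  · rw [Measure.map_apply measurable_negLog .univ, preimage_univ, Measure.restrict_apply_univ]
    exact (measure_mono (subset_univ _)).trans hν
  rw [laplaceTransform, integral_map (by fun_prop) (by fun_prop), ← hL z hz,
    ← setIntegral_eq_integral_of_forall_compl_eq_zero (s := {0}ᶜ) (μ := ν)]
  · exact setIntegral_congr_fun (measurableSet_singleton 0).compl fun y hy ↦
      exp_neg_mul_negLog hy z
  · intro y hy
    rw [notMem_compl_iff, mem_singleton_iff] at hy
    rw [hy, Icc.coe_zero, Real.zero_rpow (NNReal.coe_ne_zero.2 hz.ne')]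

theorem IsBernsteinTriplet.exists_hasLaplaceExponent {f : ℝ≥0 → ℝ≥0} {a b : ℝ≥0} {m : Measure ℝ}
    (h : IsBernsteinTriplet f a b m) : ∃ ν : Measure ℝ≥0, ν univ ≤ 1 ∧ HasLaplaceExponent ν f :=
  h.isSubLaplace.exists_laplaceTransform_eq

/-! ### The class of complete Bernstein functions -/

lemma IsCompletelyMonotone.const_mul {g : ℝ → ℝ} (hg : IsCompletelyMonotone g) (t : ℝ≥0) :
    IsCompletelyMonotone fun x ↦ t * g x := by
  refine ⟨contDiffOn_const.mul hg.1, fun n x hx ↦ ?_⟩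
  rw [iteratedDeriv_const_mul_field, mul_left_comm]
  exact mul_nonneg t.coe_nonneg (hg.2 n x hx)

lemma IsBernsteinTriplet.const_mul {f : ℝ≥0 → ℝ≥0} {a b : ℝ≥0} {m : Measure ℝ}
    (h : IsBernsteinTriplet f a b m) (t : ℝ≥0) :
    IsBernsteinTriplet (fun z ↦ t * f z) (t * a) (t * b) ((t : ℝ≥0∞) • m) where
  concentrated := by rw [Measure.smul_apply, h.concentrated, smul_zero]
  levy := by
    rw [lintegral_smul_measure]
    exact ENNReal.mul_lt_top ENNReal.coe_lt_top h.levy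
  repr z := by
    rw [integral_smul_measure, NNReal.coe_mul, h.repr, NNReal.coe_mul, NNReal.coe_mul,
      ENNReal.coe_toReal, smul_eq_mul]
    ring

lemma const_mul_mem_CBFflat {f : ℝ≥0 → ℝ≥0} (hf : f ∈ CBFflat) (t : ℝ≥0) :
    (fun z ↦ t * f z) ∈ CBFflat := by
  obtain ⟨a, g, hg, h⟩ := hf
  have hdensity : (fun x ↦ ENNReal.ofReal (t * g x)) = (t : ℝ≥0∞) • fun x ↦ .ofReal (g x) := by
    funext x
    rw [ENNReal.ofReal_mul t.coe_nonneg, ENNReal.ofReal_coe_nnreal, Pi.smul_apply, smul_eq_mul]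
  refine ⟨t * a, fun x ↦ t * g x, hg.const_mul t, ?_⟩
  rw [hdensity, withDensity_smul' _ _ ENNReal.coe_ne_top]
  simpa only [mul_zero] using h.const_mul t

lemma continuous_of_mem_CBFflat {f : ℝ≥0 → ℝ≥0} (hf : f ∈ CBFflat) : Continuous f := by
  obtain ⟨_, _, -, h⟩ := hf
  exact h.continuous

lemma tendsto_nhdsGT_zero_of_mem_CBFflat {f : ℝ≥0 → ℝ≥0} (hf : f ∈ CBFflat) :
    Tendsto f (𝓝[>] 0) (𝓝 (f 0)) :=
  (continuous_of_mem_CBFflat hf).continuousWithinAt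

lemma exists_nnratCast_btwn {a b : ℝ≥0} (hab : a < b) : ∃ q : ℚ≥0, a < q ∧ q < b := by
  obtain ⟨q, hq, haq, hqb⟩ := (NNReal.lt_iff_exists_rat_btwn a b).1 hab
  lift q to ℚ≥0 using hq
  have hcast : Real.toNNReal (q : ℚ) = q := by
    rw [Rat.cast_nnratCast]
    exact Real.toNNReal_coe (r := (q : ℝ≥0))
  rw [hcast] at haq hqb
  exact ⟨q, haq, hqb⟩

lemma eq_mul_apply_one_of_map_add {h : ℝ≥0 → ℝ≥0} (hadd : ∀ s t, h (s + t) = h s + h t)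
    (t : ℝ≥0) : h t = t * h 1 := by
  let H : ℝ≥0 →+ ℝ≥0 := ⟨⟨h, by simpa only [add_zero, left_eq_add] using hadd 0 0⟩, hadd⟩
  have hrat (q : ℚ≥0) : h q = q * h 1 := by
    change H q = q * H 1
    simpa only [smul_eq_mul, mul_one] using map_nnratCast_smul H ℝ≥0 ℝ≥0 q 1
  have hmono : Monotone h := fun s t hst ↦ by
    rw [← add_tsub_cancel_of_le hst, hadd]
    exact le_self_add
  rcases eq_zero_or_pos (h 1) with h1 | h1
  · obtain ⟨n, hn⟩ := exists_nat_ge t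
    have hle := hmono (hn.trans_eq (NNRat.cast_natCast n).symm)
    rw [hrat, h1, mul_zero] at hle
    rw [h1, mul_zero, nonpos_iff_eq_zero.1 hle]
  by_contra hne
  rw [← div_eq_iff h1.ne'] at hne
  rcases lt_or_gt_of_ne hne with hlt | hgt
  · obtain ⟨q, hq, hqt⟩ := exists_nnratCast_btwn hlt
    rw [div_lt_iff₀ h1, ← hrat] at hq
    exact (hmono hqt.le).not_gt hq
  · obtain ⟨q, hqt, hq⟩ := exists_nnratCast_btwn hgt
    rw [lt_div_iff₀ h1, ← hrat] at hq
    exact (hmono hqt.le).not_gt hq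

/-! ### Bondesson semigroups -/

namespace HasLaplaceExponent

variable {ν τ : Measure ℝ≥0} {f g : ℝ≥0 → ℝ≥0}

lemma eq_of_pos (h : HasLaplaceExponent ν f) (h' : HasLaplaceExponent ν g) {z : ℝ≥0}
    (hz : 0 < z) : f z = g z :=
  NNReal.coe_injective (neg_injective (Real.exp_injective ((h z hz).symm.trans (h' z hz))))

lemma measure_ext [IsFiniteMeasure ν] [IsFiniteMeasure τ] (h : HasLaplaceExponent ν f)
    (h' : HasLaplaceExponent τ f) : ν = τ :=
  ext_of_laplaceTransform_eq fun z hz ↦ (h z hz).trans (h' z hz).symm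

lemma conv [IsFiniteMeasure ν] [IsFiniteMeasure τ] (h : HasLaplaceExponent ν f)
    (h' : HasLaplaceExponent τ g) : HasLaplaceExponent (ν.conv τ) fun z ↦ f z + g z := by
  intro z hz
  rw [NNReal.coe_add, neg_add, Real.exp_add, ← h z hz, ← h' z hz]
  exact laplaceTransform_conv z

end HasLaplaceExponent

lemma IsBondessonFlat.isFiniteMeasure {ν : Measure ℝ≥0} (h : IsBondessonFlat ν) :
    IsFiniteMeasure ν :=
  isFiniteMeasure_of_le_one h.1

theorem existsUnique_isBondessonFlatSemigroup {f : ℝ≥0 → ℝ≥0} (hf : f ∈ CBFflat) :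
    ∃! ν : ℝ≥0 → Measure ℝ≥0, IsBondessonFlatSemigroup ν ∧
      ∀ t, HasLaplaceExponent (ν t) fun z ↦ t * f z := by
  have hexists (t : ℝ≥0) : ∃ ν : Measure ℝ≥0, ν univ ≤ 1 ∧
      HasLaplaceExponent ν fun z ↦ t * f z := by
    obtain ⟨_, _, -, h⟩ := const_mul_mem_CBFflat hf t
    exact h.exists_hasLaplaceExponent
  choose ν hν hL using hexists
  have := fun t ↦ isFiniteMeasure_of_le_one (hν t)
  refine ⟨ν, ⟨⟨fun t ↦ ⟨hν t, _, const_mul_mem_CBFflat hf t, hL t⟩, fun s t ↦ ?_⟩, hL⟩, ?_⟩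
  · refine (hL (s + t)).measure_ext ?_
    simp_rw [add_mul]
    exact (hL s).conv (hL t)
  · rintro τ ⟨hτ, hτL⟩
    funext t
    have := (hτ.1 t).isFiniteMeasure
    exact (hτL t).measure_ext (hL t)

theorem IsBondessonFlatSemigroup.existsUnique {ν : ℝ≥0 → Measure ℝ≥0}
    (hν : IsBondessonFlatSemigroup ν) :
    ∃! f : ℝ≥0 → ℝ≥0, f ∈ CBFflat ∧ ∀ t, HasLaplaceExponent (ν t) fun z ↦ t * f z := by
  obtain ⟨hB, hadd⟩ := hν
  have := fun t ↦ (hB t).isFiniteMeasure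
  choose _ f hf hL using hB
  have hlinear (z : ℝ≥0) (hz : 0 < z) (t : ℝ≥0) : f t z = t * f 1 z :=
    eq_mul_apply_one_of_map_add (h := (f · z))
      (fun s t ↦ (hL (s + t)).eq_of_pos (hadd s t ▸ (hL s).conv (hL t)) hz) t
  refine ⟨f 1, ⟨hf 1, fun t z hz ↦ ?_⟩, ?_⟩
  · rw [hL t z hz, hlinear z hz t]
  · rintro g ⟨hg, hLg⟩
    refine tendsto_nhdsGT_zero_ext (tendsto_nhdsGT_zero_of_mem_CBFflat hg)
      (tendsto_nhdsGT_zero_of_mem_CBFflat (hf 1)) fun z hz ↦ ?_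
    simpa only [one_mul] using (hLg 1).eq_of_pos (hL 1) hz

/-! ### Continuation to the negative half-axis -/

/-- The upper half-plane together with the negative half-axis. -/
def continuationDomain : Set ℂ := {z | 0 < z.im ∨ (z.im = 0 ∧ z.re < 0)}

lemma neg_mem_slitPlane_of_mem_continuationDomain {z : ℂ} (hz : z ∈ continuationDomain) :
    -z ∈ slitPlane := by
  rcases hz with hz | ⟨-, hz⟩
  · exact neg_mem_slitPlane_of_im_pos hz
  · exact Complex.mem_slitPlane_iff.2 (.inl (by rwa [Complex.neg_re, neg_pos]))

lemma convex_continuationDomain : Convex ℝ continuationDomain := by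
  rw [convex_iff_forall_pos]
  rintro z hz w hw a b ha hb -
  simp only [continuationDomain, mem_ofPred_eq, Complex.add_re, Complex.real_smul,
    Complex.re_ofReal_mul, Complex.add_im, Complex.im_ofReal_mul]
  rcases hz with hz | ⟨hz, hz'⟩ <;> rcases hw with hw | ⟨hw, hw'⟩
  · left; positivity
  · left; rw [hw, mul_zero, add_zero]; positivity
  · left; rw [hz, mul_zero, zero_add]; positivity
  · right
    exact ⟨by rw [hz, hw, mul_zero, mul_zero, add_zero],
      add_neg (mul_neg_of_pos_of_neg ha hz') (mul_neg_of_pos_of_neg hb hw')⟩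

lemma truncatedCone_subset_continuationDomain {α M : ℝ} (hM : 0 ≤ M) :
    truncatedCone α M ⊆ continuationDomain :=
  fun _ hz ↦ .inl (im_pos_of_mem_truncatedCone hM hz)

lemma neg_ofReal_mem_continuationDomain {x : ℝ} (hx : 0 < x) : -(x : ℂ) ∈ continuationDomain :=
  .inr ⟨by rw [Complex.neg_im, Complex.ofReal_im, neg_zero],
    by rwa [Complex.neg_re, Complex.ofReal_re, neg_neg_iff_pos]⟩

lemma analyticOnNhd_cbfTransform_neg (ρ : Measure I) [IsFiniteMeasure ρ] :
    AnalyticOnNhd ℂ (fun z ↦ cbfTransform ρ (-z)) continuationDomain := fun _ hz ↦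
  ((differentiableOn_cbfTransform ρ).analyticOnNhd Complex.isOpen_slitPlane _
    (neg_mem_slitPlane_of_mem_continuationDomain hz)).comp analyticAt_id.neg

section EqOn

variable {φ ψ : ℂ → ℂ} (hφ : AnalyticOnNhd ℂ φ continuationDomain)
  (hψ : AnalyticOnNhd ℂ ψ continuationDomain)

include hφ hψ

lemma eqOn_continuationDomain_of_eqOn_truncatedCone {α M : ℝ} (hα : 0 < α) (hM : 0 ≤ M)
    (h : EqOn φ ψ (truncatedCone α M)) : EqOn φ ψ continuationDomain := by
  have hz : ((M + 1 : ℝ) : ℂ) * Complex.I ∈ truncatedCone α M :=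
    mul_I_mem_truncatedCone hα hM (lt_add_one M)
  exact hφ.eqOn_of_preconnected_of_eventuallyEq hψ convex_continuationDomain.isPreconnected
    (truncatedCone_subset_continuationDomain hM hz)
    (h.eventuallyEq_of_mem ((isOpen_truncatedCone α M).mem_nhds hz))

lemma eqOn_continuationDomain_of_eqOn_neg
    (h : ∀ x : ℝ, 0 < x → φ (-(x : ℂ)) = ψ (-(x : ℂ))) : EqOn φ ψ continuationDomain := by
  refine hφ.eqOn_of_preconnected_of_frequently_eq hψ convex_continuationDomain.isPreconnected
    (neg_ofReal_mem_continuationDomain one_pos) ?_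
  have hpos : ∀ᶠ x : ℝ in 𝓝[≠] 1, φ (-(x : ℂ)) = ψ (-(x : ℂ)) :=
    nhdsWithin_le_nhds ((lt_mem_nhds one_pos).mono h)
  refine Tendsto.frequently (f := fun x : ℝ ↦ -(x : ℂ)) ?_ hpos.frequently
  exact tendsto_nhdsWithin_iff.2
    ⟨tendsto_nhdsWithin_of_tendsto_nhds (Complex.continuous_ofReal.neg.tendsto' 1 _ rfl),
    eventually_nhdsWithin_of_forall fun x hx ↦ by simpa using hx⟩

end EqOn

lemma IsFreeConv.isVoiculescuTransform_add {μ ν χ : ProbabilityMeasure ℝ} (h : IsFreeConv μ ν χ)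
    {φ ψ : ℂ → ℂ} (hφ : IsVoiculescuTransform μ φ) (hψ : IsVoiculescuTransform ν ψ) :
    IsVoiculescuTransform χ (φ + ψ) := by
  obtain ⟨φ', ψ', hφ', hψ', hadd⟩ := h
  obtain ⟨α, M, hα, hM, heq⟩ := hφ'.exists_eqOn hφ
  obtain ⟨α', M', hα', -, heq'⟩ := hψ'.exists_eqOn hψ
  have hN : 0 ≤ max M M' := hM.le.trans (le_max_left _ _)
  exact hadd.congr (lt_min hα hα') fun z hz ↦ congr_arg₂ (· + ·)
    (heq (truncatedCone_mono (min_le_left _ _) (le_max_left _ _) hN hz))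
    (heq' (truncatedCone_mono (min_le_right _ _) (le_max_right _ _) hN hz))

namespace IsVoiculescuOnNegAxis

variable {f g k : ℝ≥0 → ℝ≥0} {μ ν χ : ProbabilityMeasure ℝ}

lemma isVoiculescuTransform_cbfTransform {ρ : Measure I} [IsFiniteMeasure ρ]
    (h : IsVoiculescuOnNegAxis μ f)
    (hρ : ∀ z : ℝ≥0, 0 < z → cbfTransform ρ (z : ℝ) = ((f z : ℝ) : ℂ)) :
    IsVoiculescuTransform μ fun z ↦ cbfTransform ρ (-z) := by
  obtain ⟨⟨φ, hφ, hφan, hφf⟩, -⟩ := h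
  have heq := eqOn_continuationDomain_of_eqOn_neg hφan (analyticOnNhd_cbfTransform_neg ρ)
    fun x hx ↦ by
      lift x to ℝ≥0 using hx.le
      rw [neg_neg, hφf x hx, hρ x hx]
  exact hφ.congr one_pos (heq.mono (truncatedCone_subset_continuationDomain le_rfl))

lemma eq_add (hμ : IsVoiculescuOnNegAxis μ f) (hν : IsVoiculescuOnNegAxis ν g)
    (hχ : IsVoiculescuOnNegAxis χ k) (h : IsFreeConv μ ν χ) {z : ℝ≥0} (hz : 0 < z) :
    k z = f z + g z := by
  obtain ⟨⟨φ, hφ, hφan, hf⟩, -⟩ := hμ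
  obtain ⟨⟨ψ, hψ, hψan, hg⟩, -⟩ := hν
  obtain ⟨⟨θ, hθ, hθan, hk⟩, -⟩ := hχ
  obtain ⟨α, M, hα, hM, heq⟩ := hθ.exists_eqOn (h.isVoiculescuTransform_add hφ hψ)
  have := eqOn_continuationDomain_of_eqOn_truncatedCone hθan (hφan.add hψan) hα hM.le heq
    (neg_ofReal_mem_continuationDomain (NNReal.coe_pos.2 hz))
  rw [Pi.add_apply, hf z hz, hg z hz, hk z hz] at this
  exact_mod_cast this

lemma unique (hf : IsVoiculescuOnNegAxis μ f) (hg : IsVoiculescuOnNegAxis μ g) : f = g := by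
  refine tendsto_nhdsGT_zero_ext hf.2 hg.2 fun z hz ↦ ?_
  obtain ⟨⟨φ, hφ, hφan, hf⟩, -⟩ := hf
  obtain ⟨⟨ψ, hψ, hψan, hg⟩, -⟩ := hg
  obtain ⟨α, M, hα, hM, heq⟩ := hφ.exists_eqOn hψ
  have := eqOn_continuationDomain_of_eqOn_truncatedCone hφan hψan hα hM.le heq
    (neg_ofReal_mem_continuationDomain (NNReal.coe_pos.2 hz))
  rw [hf z hz, hg z hz] at this
  exact_mod_cast this

end IsVoiculescuOnNegAxis

/-! ### Free regular measures and semigroups -/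

lemma cbfTransform_smul (ρ : Measure I) (t : ℝ≥0) (w : ℂ) :
    cbfTransform ((t : ℝ≥0∞) • ρ) w = ((t : ℝ) : ℂ) * cbfTransform ρ w := by
  rw [cbfTransform, integral_smul_measure, ← cbfTransform, ENNReal.coe_toReal, Complex.real_smul]

lemma isFreeConv_of_const_mul {φ : ℂ → ℂ} {s t u : ℝ} (hu : u = s + t)
    {μ ν χ : ProbabilityMeasure ℝ} (hμ : IsVoiculescuTransform μ fun z ↦ (s : ℂ) * φ z)
    (hν : IsVoiculescuTransform ν fun z ↦ (t : ℂ) * φ z)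
    (hχ : IsVoiculescuTransform χ fun z ↦ (u : ℂ) * φ z) : IsFreeConv μ ν χ := by
  refine ⟨_, _, hμ, hν, ?_⟩
  simpa only [hu, Complex.ofReal_add, add_mul] using hχ

section Representation

variable {ρ : Measure I} [IsFiniteMeasure ρ] (h0 : ρ {0} = 0)

include h0

lemma exists_isVoiculescuTransform_const_mul (t : ℝ≥0) :
    ∃ μ : ProbabilityMeasure ℝ, (μ : Measure ℝ) (Iio 0) = 0 ∧
      IsVoiculescuTransform μ fun z ↦ ((t : ℝ) : ℂ) * cbfTransform ρ (-z) := by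
  have := ρ.smul_finite (ENNReal.coe_ne_top (r := t))
  simp_rw [← cbfTransform_smul]
  exact exists_isVoiculescuTransform_cbfTransform (by rw [Measure.smul_apply, h0, smul_zero])

lemma isFreeConvIter_of_const_mul {t : ℝ≥0} {ν : ProbabilityMeasure ℝ}
    (hν : IsVoiculescuTransform ν fun z ↦ ((t : ℝ) : ℂ) * cbfTransform ρ (-z)) (k : ℕ)
    {u : ℝ} (hu : u = (k + 1) * t) {χ : ProbabilityMeasure ℝ}
    (hχ : IsVoiculescuTransform χ fun z ↦ (u : ℂ) * cbfTransform ρ (-z)) :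
    IsFreeConvIter ν (k + 1) χ := by
  induction k generalizing u χ with
  | zero =>
    rw [Nat.cast_zero, zero_add, one_mul] at hu
    exact hχ.eq (hu ▸ hν)
  | succ k ih =>
    obtain ⟨χ', -, hχ'⟩ := exists_isVoiculescuTransform_const_mul h0 ((k + 1) * t)
    refine ⟨χ', ih (by push_cast; rfl) hχ', isFreeConv_of_const_mul ?_ hχ' hν hχ⟩
    rw [hu]
    push_cast
    ring

lemma isFreeRegular_of_isVoiculescuTransform {μ : ProbabilityMeasure ℝ}
    (h : IsVoiculescuTransform μ fun z ↦ cbfTransform ρ (-z)) : IsFreeRegular μ := by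
  refine ⟨fun n hn ↦ ?_, fun t ht ↦ ?_⟩
  · obtain ⟨k, rfl⟩ := Nat.exists_eq_add_of_le' hn
    obtain ⟨ν, -, hν⟩ := exists_isVoiculescuTransform_const_mul h0 ((k : ℝ≥0) + 1)⁻¹
    have hk : (1 : ℝ) = (k + 1) * (((k : ℝ≥0) + 1)⁻¹ : ℝ≥0) := by
      push_cast
      exact (mul_inv_cancel₀ k.cast_add_one_ne_zero).symm
    refine ⟨ν, isFreeConvIter_of_const_mul h0 hν k hk ?_⟩
    simpa only [Complex.ofReal_one, one_mul] using h
  · obtain ⟨χ, hχ, hV⟩ := exists_isVoiculescuTransform_const_mul h0 ⟨t, ht.le⟩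
    exact ⟨χ, ⟨_, h, hV⟩, hχ⟩

end Representation

lemma isVoiculescuOnNegAxis_of_cbfTransform {ρ : Measure I} [IsFiniteMeasure ρ] {f : ℝ≥0 → ℝ≥0}
    (hf : f ∈ CBFflat) (hρ : ∀ z : ℝ≥0, 0 < z → cbfTransform ρ (z : ℝ) = ((f z : ℝ) : ℂ))
    {μ : ProbabilityMeasure ℝ} (h : IsVoiculescuTransform μ fun z ↦ cbfTransform ρ (-z)) :
    IsVoiculescuOnNegAxis μ f :=
  ⟨⟨_, h, analyticOnNhd_cbfTransform_neg ρ, fun z hz ↦ by rw [neg_neg, hρ z hz]⟩,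
    tendsto_nhdsGT_zero_of_mem_CBFflat hf⟩

theorem isFreeRegular_iff (μ : ProbabilityMeasure ℝ) :
    IsFreeRegular μ ↔ ∃ f ∈ CBFflat, IsVoiculescuOnNegAxis μ f := by
  constructor
  · rintro ⟨-, h⟩
    obtain ⟨ρ, _, h0, hV⟩ := exists_cbfTransform_isVoiculescuTransform h
    obtain ⟨f, hf, hρf⟩ := exists_mem_CBFflat h0
    exact ⟨f, hf, isVoiculescuOnNegAxis_of_cbfTransform hf hρf hV⟩
  · rintro ⟨f, hf, h⟩
    obtain ⟨ρ, _, h0, hρf⟩ := exists_cbfTransform_eq hf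
    exact isFreeRegular_of_isVoiculescuTransform h0 (h.isVoiculescuTransform_cbfTransform hρf)

theorem existsUnique_isFreeRegular {f : ℝ≥0 → ℝ≥0} (hf : f ∈ CBFflat) :
    ∃! μ : ProbabilityMeasure ℝ, IsFreeRegular μ ∧ IsVoiculescuOnNegAxis μ f := by
  obtain ⟨ρ, _, h0, hρf⟩ := exists_cbfTransform_eq hf
  obtain ⟨μ, -, hμ⟩ := exists_isVoiculescuTransform_cbfTransform h0
  refine ⟨μ, ⟨isFreeRegular_of_isVoiculescuTransform h0 hμ,
    isVoiculescuOnNegAxis_of_cbfTransform hf hρf hμ⟩, ?_⟩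
  rintro ν ⟨-, hν⟩
  exact (hν.isVoiculescuTransform_cbfTransform hρf).eq hμ

theorem existsUnique_isFreeRegularSemigroup {f : ℝ≥0 → ℝ≥0} (hf : f ∈ CBFflat) :
    ∃! μ : ℝ≥0 → ProbabilityMeasure ℝ, IsFreeRegularSemigroup μ ∧
      ∀ t, IsVoiculescuOnNegAxis (μ t) fun z ↦ t * f z := by
  choose μ hμ huniq using fun t ↦ existsUnique_isFreeRegular (const_mul_mem_CBFflat hf t)
  obtain ⟨ρ, _, -, hρf⟩ := exists_cbfTransform_eq hf
  have hV (t : ℝ≥0) :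
      IsVoiculescuTransform (μ t) fun z ↦ ((t : ℝ) : ℂ) * cbfTransform ρ (-z) := by
    have := ρ.smul_finite (ENNReal.coe_ne_top (r := t))
    simp_rw [← cbfTransform_smul]
    refine (hμ t).2.isVoiculescuTransform_cbfTransform fun z hz ↦ ?_
    rw [cbfTransform_smul, hρf z hz, NNReal.coe_mul, Complex.ofReal_mul]
  refine ⟨μ, ⟨⟨fun t ↦ (hμ t).1, fun s t ↦ isFreeConv_of_const_mul (NNReal.coe_add s t) (hV s)
    (hV t) (hV (s + t))⟩, fun t ↦ (hμ t).2⟩, ?_⟩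
  rintro ν ⟨hν, hνf⟩
  exact funext fun t ↦ huniq t (ν t) ⟨hν.1 t, hνf t⟩

theorem IsFreeRegularSemigroup.existsUnique {μ : ℝ≥0 → ProbabilityMeasure ℝ}
    (hμ : IsFreeRegularSemigroup μ) :
    ∃! f : ℝ≥0 → ℝ≥0, f ∈ CBFflat ∧ ∀ t, IsVoiculescuOnNegAxis (μ t) fun z ↦ t * f z := by
  choose f hf hV using fun t ↦ (isFreeRegular_iff (μ t)).1 (hμ.1 t)
  have hlinear (t : ℝ≥0) : f t = fun z ↦ t * f 1 z :=
    tendsto_nhdsGT_zero_ext (tendsto_nhdsGT_zero_of_mem_CBFflat (hf t))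
      (tendsto_nhdsGT_zero_of_mem_CBFflat (const_mul_mem_CBFflat (hf 1) t)) fun z hz ↦
      eq_mul_apply_one_of_map_add (h := (f · z))
        (fun s t ↦ (hV s).eq_add (hV t) (hV (s + t)) (hμ.2 s t) hz) t
  refine ⟨f 1, ⟨hf 1, fun t ↦ hlinear t ▸ hV t⟩, ?_⟩
  rintro g ⟨-, hg⟩
  simpa only [one_mul] using (hg 1).unique (hV 1)

end FreeRegular

theorem proposition1 :
    -- a probability measure is free regular iff `z ↦ φ_μ(-z)` is in the class `CBFflat`
    (∀ μ : ProbabilityMeasure ℝ,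
      IsFreeRegular μ ↔ ∃ f ∈ CBFflat, IsVoiculescuOnNegAxis μ f) ∧
    -- every function of the class arises, from exactly one free regular measure
    (∀ f ∈ CBFflat, ∃! μ : ProbabilityMeasure ℝ,
      IsFreeRegular μ ∧ IsVoiculescuOnNegAxis μ f) ∧
    -- free regular semigroups are in bijection with `CBFflat`
    ((∀ f ∈ CBFflat, ∃! μ : ℝ≥0 → ProbabilityMeasure ℝ, IsFreeRegularSemigroup μ ∧
        ∀ t, IsVoiculescuOnNegAxis (μ t) fun z => t * f z) ∧
      ∀ μ : ℝ≥0 → ProbabilityMeasure ℝ, IsFreeRegularSemigroup μ →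
        ∃! f : ℝ≥0 → ℝ≥0, f ∈ CBFflat ∧
          ∀ t, IsVoiculescuOnNegAxis (μ t) fun z => t * f z) ∧
    -- driftless Bondesson class semigroups are in bijection with `CBFflat`
    ((∀ f ∈ CBFflat, ∃! ν : ℝ≥0 → Measure ℝ≥0, IsBondessonFlatSemigroup ν ∧
        ∀ t, HasLaplaceExponent (ν t) fun z => t * f z) ∧
      ∀ ν : ℝ≥0 → Measure ℝ≥0, IsBondessonFlatSemigroup ν →
        ∃! f : ℝ≥0 → ℝ≥0, f ∈ CBFflat ∧
          ∀ t, HasLaplaceExponent (ν t) fun z => t * f z) := by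
  exact ⟨isFreeRegular_iff, fun _ hf ↦ existsUnique_isFreeRegular hf,
    ⟨fun _ hf ↦ existsUnique_isFreeRegularSemigroup hf, fun _ hμ ↦ hμ.existsUnique⟩,
    fun _ hf ↦ existsUnique_isBondessonFlatSemigroup hf, fun _ hν ↦ hν.existsUnique⟩
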